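/- Let $0<p<\infty$ and $\alpha>-1$. For $0<r<\infty$ let $A^r_\alpha$ be the weighted Bergman space of all analytic $f$ in the unit disc $\mathbb D$ with $$\|f\|_{A^r_\alpha}=\Big((\alpha+1)\int_{\mathbb D}|f(z)|^r(1-|z|^2)^\alpha\,dA(z)\Big)^{1/r}<\infty,$$ where $dA$ is area measure normalized by $A(\mathbb D)=1$. Let $\mu$ be a positive Borel measure on $[0,1)$. For $s>0$, call $\mu$ an $s$-Carleson measure if there is a constant $C>0$ with $\mu([t,1))\le C(1-t)^s$ for all $t\in[0,1)$, a vanishing $s$-Carleson measure if $\mu([t,1))/(1-t)^s\to0$ as $t\to1^-$, and a vanishing $1$-logarithmic $s$-Carleson measure if $\mu([t,1))\log\frac1{1-t}\,/(1-t)^s\to0$ as $t\to1^-$. For $\beta>0$ and $f(z)=\sum_{k\ge0}a_kz^k$ analytic in $\mathbb D$, put $$\mathcal H_{\mu,\beta}(f)(z)=\sum_{n=0}^\infty\Big(\sum_{k=0}^\infty\mu_{n,k,\beta}\,a_k\Big)z^n,\qquad \mu_{n,k,\beta}=\int_{[0,1)}\frac{\Gamma(n+\beta)}{n!\,\Gamma(\beta)}\,t^{n+k}\,d\mu(t),$$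 whenever the inner series converge and the outer series converges in $\mathbb D$. We say that $\mathcal H_{\mu,\beta}$ is a compact operator from $A^p_\alpha$ into $A^q_\alpha$ if $\mathcal H_{\mu,\beta}(f)$ is defined and belongs to $A^q_\alpha$ for every $f\in A^p_\alpha$, and for every bounded sequence $(f_n)$ in $A^p_\alpha$ the sequence $(\mathcal H_{\mu,\beta}(f_n))$ has a subsequence converging in $A^q_\alpha$. Assume that $\mu$ is an $\frac{\alpha+2}{p}$-Carleson measure if $0<p\le1$, an $\frac{\alpha+2-(p-1)^2}{p}$-Carleson measure if $1\le p\le2$, and an $\frac{\alpha+1}{p}$-Carleson measure if $p\ge2$. Then: (i) If $q\ge p$ and $q>1$, and $\frac1q+\frac1{q'}=1$, then $\mathcal H_{\mu,\alpha+2}$ is a compact operator from $A^p_\alpha$ into $A^q_\alpha$ if and only if $\mu$ is a vanishing $\left(\frac{\alpha+2}{p}+\frac{\alpha+2}{q'}\right)$-Carleson measure. (ii) If $q\ge p$ and $q=1$ (so $0<p\le1$), then $\mathcal H_{\mu,\alpha+2}$ is a compact operator from $A^p_\alpha$ into $A^1_\alpha$ if and only if $\mu$ is a vanishing $1$-logarithmic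 $\left(\frac{\alpha+2}{p}\right)$-Carleson measure. -/

import Mathlib

open MeasureTheory Filter Topology Set
open scoped ENNReal

namespace HilbertBergman

noncomputable section

/-- The open unit disc. -/
def disc : Set ℂ := Metric.ball 0 1

/-- Area measure on the disc, normalized to have total mass one. -/
def discArea : Measure ℂ := (ENNReal.ofReal Real.pi)⁻¹ • volume.restrict disc

/-- The (quasi-)norm of the weighted Bergman space, as an extended nonnegative number:
`((α + 1) ∫ |f z| ^ p (1 - |z| ^ 2) ^ α dA(z)) ^ (1 / p)`. -/
def bergmanNorm (p α : ℝ) (f : ℂ → ℂ) : ℝ≥0∞ :=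
  (ENNReal.ofReal (α + 1) *
    ∫⁻ z, ‖f z‖ₑ ^ p * ENNReal.ofReal ((1 - ‖z‖ ^ 2) ^ α) ∂discArea) ^ (1 / p)

/-- The weighted Bergman space: functions analytic in the disc with finite norm.
Only the restriction of a function to the disc is relevant. -/
def bergmanSpace (p α : ℝ) : Set (ℂ → ℂ) :=
  {f | DifferentiableOn ℂ f disc ∧ bergmanNorm p α f < ∞}

/-- The `k`-th Taylor coefficient of `f` at the origin. -/
def taylorCoeff (f : ℂ → ℂ) (k : ℕ) : ℂ := iteratedDeriv k f 0 / (k.factorial : ℂ)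

/-- The entries of the generalized Hankel matrix of `μ`. -/
def hankelEntry (μ : Measure (Ico (0 : ℝ) 1)) (β : ℝ) (n k : ℕ) : ℝ :=
  ∫ t, Real.Gamma (n + β) / (n.factorial * Real.Gamma β) * (t : ℝ) ^ (n + k) ∂μ

/-- The generalized Hilbert operator of `μ` is defined at `f`, with value `g` on the disc: all
the series `∑ₖ μ_{n,k,β} aₖ` converge (as limits of partial sums), say to `cₙ`, and the power
series `∑ₙ cₙ zⁿ` converges to `g z` at every point `z` of the disc. -/
def IsHilbertImage (μ : Measure (Ico (0 : ℝ) 1)) (β : ℝ) (f g : ℂ → ℂ) : Prop :=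
  ∃ c : ℕ → ℂ,
    (∀ n, Tendsto (fun N => ∑ k ∈ Finset.range N, (hankelEntry μ β n k : ℂ) * taylorCoeff f k)
      atTop (𝓝 (c n))) ∧
    ∀ z ∈ disc, HasSum (fun n => c n * z ^ n) (g z)

/-- The generalized Hilbert operator of `μ` is a compact operator from the Bergman space with
parameters `(p, α)` into the one with parameters `(q, γ)`: it is defined on the whole of the
former space, takes values in the latter, and the image of every bounded sequence has a
subsequence that converges in the latter space. -/
structure IsCompactHilbert (μ : Measure (Ico (0 : ℝ) 1)) (β p α q γ : ℝ) : Prop where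
  maps : ∀ f ∈ bergmanSpace p α, ∃ g ∈ bergmanSpace q γ, IsHilbertImage μ β f g
  compact : ∀ f g : ℕ → ℂ → ℂ, (∀ n, f n ∈ bergmanSpace p α) →
    (∃ C : ℝ≥0∞, C < ∞ ∧ ∀ n, bergmanNorm p α (f n) ≤ C) →
    (∀ n, IsHilbertImage μ β (f n) (g n)) →
    ∃ h ∈ bergmanSpace q γ, ∃ φ : ℕ → ℕ, StrictMono φ ∧
      Tendsto (fun n => bergmanNorm q γ (g (φ n) - h)) atTop (𝓝 0)

/-- The mass `μ([t, 1))`. -/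
def tail (μ : Measure (Ico (0 : ℝ) 1)) (t : ℝ) : ℝ≥0∞ := μ {x | t ≤ (x : ℝ)}

/-- `s`-Carleson measures on `[0, 1)`: `μ([t, 1)) ≤ C (1 - t) ^ s`. -/
def IsCarleson (μ : Measure (Ico (0 : ℝ) 1)) (s : ℝ) : Prop :=
  ∃ C : ℝ, 0 < C ∧ ∀ t ∈ Ico (0 : ℝ) 1, tail μ t ≤ ENNReal.ofReal (C * (1 - t) ^ s)

/-- Vanishing `s`-Carleson measures on `[0, 1)`: `μ([t, 1)) / (1 - t) ^ s → 0` as `t → 1⁻`. -/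
def IsVanishingCarleson (μ : Measure (Ico (0 : ℝ) 1)) (s : ℝ) : Prop :=
  Tendsto (fun t : ℝ => tail μ t / ENNReal.ofReal ((1 - t) ^ s)) (𝓝[<] 1) (𝓝 0)

/-- Vanishing `a`-logarithmic `s`-Carleson measures on `[0, 1)`:
`μ([t, 1)) (log (1 / (1 - t))) ^ a / (1 - t) ^ s → 0` as `t → 1⁻`. -/
def IsVanishingLogCarleson (μ : Measure (Ico (0 : ℝ) 1)) (a s : ℝ) : Prop :=
  Tendsto (fun t : ℝ => tail μ t * ENNReal.ofReal (Real.log (1 / (1 - t)) ^ a) /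
    ENNReal.ofReal ((1 - t) ^ s)) (𝓝[<] 1) (𝓝 0)

/-- The standing Carleson condition on `μ`, in the three ranges of `p`; the clauses agree at
`p = 1` and at `p = 2`. -/
structure StandingCondition (μ : Measure (Ico (0 : ℝ) 1)) (p α : ℝ) : Prop where
  le_one : p ≤ 1 → IsCarleson μ ((α + 2) / p)
  one_le_two : 1 ≤ p → p ≤ 2 → IsCarleson μ ((α + 2 - (p - 1) ^ 2) / p)
  two_le : 2 ≤ p → IsCarleson μ ((α + 1) / p)

end

end HilbertBergman

namespace HilbertBergman

/-! ### Taylor coefficients and circle means -/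

/-! Write `s = (α + 2) / p`. Once the series defining the operator are known to converge, it is the
integral operator `f ↦ ∫ f(t) (1 - t z) ^ (-(α + 2)) dμ(t)`, so only the values of `f` on the radius
matter, and both directions come down to dyadic behaviour near the boundary point `1`.

Sufficiency. Cut the radius into intervals `1 - t ≈ 2 ^ (-j)` and the disc into shells `|1 - z| ≈ 2
^ (-i)`, of weighted area at most a constant times `2 ^ (-i(α + 2))`. There the kernel is at most a
constant times `2 ^ ((α + 2) min(i, j))`. By the sub-mean value property of `|f| ^ p`, the radial
maxima of `f`, weighted by `2 ^ (-j s)`, form a sequence `x` in `ℓ ^ p`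
(`exists_tsum_radialSup_le`), hence in `ℓ ^ q`. For `q > 1` the resulting matrix decays
exponentially away from the diagonal, and the `q`-th power of the norm of the image is bounded by `∑
(x_j W_j) ^ q`, where `W_j` is the dyadic mass times `2 ^ (j (s + (α + 2) / q'))`. For `q = 1` there
is no decay on one side of the diagonal: `j + 1` shells contribute equally, and this is the
logarithm. The vanishing condition gives `W_j → 0`. A diagonal operator with multipliers tending to
zero is compact, and a normal families argument transfers this to the Bergman spaces
(`isCompactHilbert_of_estimate`).

Convergence of the defining series needs the Taylor partial sums on the radius to have a common
`μ`-integrable majorant. For `q > 1` the exponent in the vanishing condition exceeds `s`, and a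
bound `(1 - t) ^ (-(s + δ))` suffices. For `q = 1` there is no such room; but then `p ≤ 1`, and
Hardy's inequality together with the `s`-Carleson condition gives absolute convergence.

Necessity. The test functions `(1 - a) ^ s / (1 - a z) ^ (2 s)` are bounded in the space, and their
images have nonnegative Taylor coefficients, bounded below in terms of `μ([a, 1))`. Along a
subsequence the images converge in norm to some `F`, which need not be identified. For `q > 1` they
are evaluated at `a`, and `F` is absorbed because its radial growth is strictly slower than that of
point evaluations. For `q = 1` evaluation would lose the logarithm. Hardy's inequality turns the
coefficient bounds into `∑ a ^ m / (m + 1)`, which is of logarithmic size, and `F` is absorbed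
because its Hardy sum has small tails. -/

theorem cauchyPowerSeries_apply_eq {f : ℂ → ℂ} {r : ℝ} (hr : 0 < r)
    (hf : DifferentiableOn ℂ f (Metric.closedBall 0 r)) (k : ℕ) (w : ℂ) :
    (cauchyPowerSeries f 0 r k fun _ => w) = taylorCoeff f k * w ^ k := by
  lift r to NNReal using hr.le
  have h := (hf.hasFPowerSeriesOnBall (by exact_mod_cast hr)).factorial_smul 1 k
  rw [← iteratedDeriv_eq_iteratedFDeriv] at h
  have h1 : (cauchyPowerSeries f 0 r k fun _ => w)
      = w ^ k * (cauchyPowerSeries f 0 r k fun _ => 1) := by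
    have := (cauchyPowerSeries f 0 r k).map_smul_univ (fun _ => w) (fun _ => (1 : ℂ))
    simp only [Finset.prod_const, Finset.card_univ, Fintype.card_fin, smul_eq_mul, mul_one] at this
    exact this
  have h2 : (k.factorial : ℂ) ≠ 0 := by exact_mod_cast k.factorial_ne_zero
  rw [h1, taylorCoeff, ← h, nsmul_eq_mul, mul_div_cancel_left₀ _ h2, mul_comm]

/-- Periodicity reconciles the parameter interval of circle integrals with the angular interval of
polar coordinates. -/
theorem lintegral_circle_eq (F : ℂ → ℝ) (hF0 : ∀ z, 0 ≤ F z) {c : ℂ} {r : ℝ}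
    (hF : ContinuousOn F (Metric.sphere c |r|)) :
    ENNReal.ofReal (∫ θ in (0 : ℝ)..2 * Real.pi, F (circleMap c r θ)) =
      ∫⁻ θ in Ioo (-Real.pi) Real.pi, ENNReal.ofReal (F (circleMap c r θ)) := by
  have hcont : Continuous fun θ => F (circleMap c r θ) :=
    hF.comp_continuous (continuous_circleMap c r) fun θ => circleMap_mem_sphere' c r θ
  have hper : Function.Periodic (fun θ => F (circleMap c r θ)) (2 * Real.pi) := fun θ => by
    simp only [periodic_circleMap c r θ]
  have h := hper.intervalIntegral_add_eq 0 (-Real.pi)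
  rw [zero_add, show -Real.pi + 2 * Real.pi = Real.pi by ring] at h
  rw [h, intervalIntegral.integral_of_le (by linarith [Real.pi_pos]), integral_Ioc_eq_integral_Ioo,
    ofReal_integral_eq_lintegral_ofReal]
  · exact (hcont.integrableOn_Icc (a := -Real.pi) (b := Real.pi)).mono_set Ioo_subset_Icc_self
  · exact Eventually.of_forall fun θ => hF0 _

/-- Cauchy's estimate in terms of the circle mean. -/
theorem enorm_taylorCoeff_mul_le {f : ℂ → ℂ} {r : ℝ} (hr : 0 < r)
    (hf : DifferentiableOn ℂ f (Metric.closedBall 0 r)) (k : ℕ) :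
    ENNReal.ofReal (2 * Real.pi) * (‖taylorCoeff f k‖ₑ * ENNReal.ofReal r ^ k) ≤
      ∫⁻ θ in Ioo (-Real.pi) Real.pi, ‖f (circleMap 0 r θ)‖ₑ := by
  have h := norm_cauchyPowerSeries_le f 0 r k
  have h1 : ‖taylorCoeff f k‖ ≤ ‖cauchyPowerSeries f 0 r k‖ := by
    have := (cauchyPowerSeries f 0 r k).le_opNorm fun _ => 1
    rw [cauchyPowerSeries_apply_eq hr hf] at this
    simpa using this
  have hc : ContinuousOn (fun z => ‖f z‖) (Metric.sphere 0 |r|) := by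
    rw [abs_of_pos hr]
    exact (hf.continuousOn.mono Metric.sphere_subset_closedBall).norm
  have h3 := lintegral_circle_eq (fun z => ‖f z‖) (fun z => norm_nonneg _) hc
  simp only [ofReal_norm] at h3
  rw [← h3, ← ofReal_norm, ← ENNReal.ofReal_pow hr.le, ← ENNReal.ofReal_mul (norm_nonneg _),
    ← ENNReal.ofReal_mul (by positivity)]
  apply ENNReal.ofReal_le_ofReal
  have h4 := h1.trans h
  rw [abs_of_pos hr] at h4
  have hpi := Real.pi_pos
  calc 2 * Real.pi * (‖taylorCoeff f k‖ * r ^ k)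
      ≤ 2 * Real.pi * ((((2 * Real.pi)⁻¹ * ∫ θ in (0 : ℝ)..2 * Real.pi, ‖f (circleMap 0 r θ)‖)
          * r⁻¹ ^ k) * r ^ k) := by gcongr
    _ = _ := by
      rw [inv_pow]
      field_simp

theorem hasSum_taylorCoeff {f : ℂ → ℂ} (hf : DifferentiableOn ℂ f disc) {z : ℂ} (hz : z ∈ disc) :
    HasSum (fun k => taylorCoeff f k * z ^ k) (f z) := by
  have h := Complex.hasSum_taylorSeries_on_ball hf hz
  refine h.congr_fun fun k => ?_
  simp only [taylorCoeff, sub_zero, smul_eq_mul]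
  ring

/-! ### Polar coordinates on a ball -/

/-- Measurability is asked only of the indicator, since functions analytic in the ball are arbitrary
outside it. -/
theorem lintegral_ball_eq_polar (F : ℂ → ℝ≥0∞) (R : ℝ)
    (hF : Measurable ((Metric.ball (0 : ℂ) R).indicator F)) :
    ∫⁻ z in Metric.ball (0 : ℂ) R, F z =
      ∫⁻ ρ in Ioo 0 R, ENNReal.ofReal ρ * ∫⁻ θ in Ioo (-Real.pi) Real.pi, F (circleMap 0 ρ θ) := by
  set G := (Metric.ball (0 : ℂ) R).indicator F with hG
  have hcirc : ∀ p : ℝ × ℝ, Complex.polarCoord.symm p = circleMap 0 p.1 p.2 := fun p => by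
    simp [circleMap, Complex.exp_mul_I]
  have hm : Measurable fun p : ℝ × ℝ => circleMap 0 p.1 p.2 := by
    unfold circleMap
    fun_prop
  rw [← lintegral_indicator Metric.isOpen_ball.measurableSet, ← hG,
    ← Complex.lintegral_comp_polarCoord_symm, polarCoord_target, Measure.volume_eq_prod,
    ← Measure.prod_restrict, lintegral_prod]
  · rw [← lintegral_indicator measurableSet_Ioi, ← lintegral_indicator measurableSet_Ioo]
    congr 1
    ext ρ
    by_cases h0 : 0 < ρ
    · rw [indicator_of_mem (by exact h0)]
      by_cases h1 : ρ < R
      · rw [indicator_of_mem (by exact ⟨h0, h1⟩)]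
        simp only [smul_eq_mul, hcirc]
        rw [← lintegral_const_mul']
        · refine lintegral_congr fun θ => ?_
          rw [hG, indicator_of_mem]
          simp [abs_of_pos h0, h1]
        · simp
      · rw [indicator_of_notMem (by simp [h1])]
        simp only [smul_eq_mul, hcirc]
        rw [lintegral_eq_zero_iff']
        · refine Eventually.of_forall fun θ => ?_
          have h2 : circleMap 0 ρ θ ∉ Metric.ball (0 : ℂ) R := by simpa [abs_of_pos h0] using h1
          simp only [hG, indicator_of_notMem h2, mul_zero, Pi.zero_apply]
        · exact ((hF.comp hm).comp measurable_prodMk_left).const_mul _ |>.aemeasurable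
    · rw [indicator_of_notMem (by simpa using h0), indicator_of_notMem (by simp [h0])]
  · simp only [smul_eq_mul, hcirc]
    exact ((ENNReal.measurable_ofReal.comp measurable_fst).mul (hF.comp hm)).aemeasurable

theorem measurable_indicator_of_continuousOn {E : Type*} [TopologicalSpace E] [MeasurableSpace E]
    [BorelSpace E] [Zero E] {U : Set ℂ} (hU : IsOpen U) {F : ℂ → E} (hF : ContinuousOn F U) :
    Measurable (U.indicator F) := by
  classical
  rw [← Set.piecewise_eq_indicator]
  exact hF.measurable_piecewise continuousOn_const hU.measurableSet

theorem lintegral_Ioo_ofReal_id (R : ℝ) (hR : 0 ≤ R) :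
    ∫⁻ ρ in Ioo 0 R, ENNReal.ofReal ρ = ENNReal.ofReal (R ^ 2 / 2) := by
  rw [← ofReal_integral_eq_lintegral_ofReal]
  · rw [← integral_Ioc_eq_integral_Ioo, ← intervalIntegral.integral_of_le hR, integral_id]
    simp
  · exact (continuous_id.integrableOn_Icc (a := 0) (b := R)).mono_set Ioo_subset_Icc_self
  · exact (ae_restrict_iff' measurableSet_Ioo).2 (Eventually.of_forall fun x hx => hx.1.le)

/-! ### Sub-mean value properties -/

/-- Cauchy's estimate for the zeroth coefficient on each circle, integrated against `ρ dρ`. -/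
theorem enorm_center_mul_le {f : ℂ → ℂ} {R : ℝ}
    (hf : DifferentiableOn ℂ f (Metric.ball 0 R)) (hR : 0 ≤ R) :
    ENNReal.ofReal (Real.pi * R ^ 2) * ‖f 0‖ₑ ≤ ∫⁻ z in Metric.ball (0 : ℂ) R, ‖f z‖ₑ := by
  rw [lintegral_ball_eq_polar _ _
    (measurable_indicator_of_continuousOn Metric.isOpen_ball hf.continuousOn.enorm)]
  calc ENNReal.ofReal (Real.pi * R ^ 2) * ‖f 0‖ₑ
      = ∫⁻ ρ in Ioo 0 R, ENNReal.ofReal ρ * (ENNReal.ofReal (2 * Real.pi) * ‖f 0‖ₑ) := by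
        rw [lintegral_mul_const' _ _ (by finiteness), lintegral_Ioo_ofReal_id R hR, ← mul_assoc,
          ← ENNReal.ofReal_mul (by positivity)]
        ring_nf
    _ ≤ _ := by
        refine setLIntegral_mono' measurableSet_Ioo fun ρ hρ => ?_
        gcongr
        have := enorm_taylorCoeff_mul_le hρ.1
          (hf.mono (Metric.closedBall_subset_ball hρ.2)) 0
        simpa [taylorCoeff] using this

theorem enorm_mul_le_lintegral_ball {f : ℂ → ℂ} {c : ℂ} {R : ℝ}
    (hf : DifferentiableOn ℂ f (Metric.ball c R)) (hR : 0 ≤ R) :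
    ENNReal.ofReal (Real.pi * R ^ 2) * ‖f c‖ₑ ≤ ∫⁻ z in Metric.ball c R, ‖f z‖ₑ := by
  have h := enorm_center_mul_le (f := fun z => f (c + z)) (R := R) (by
    refine hf.comp (by fun_prop) fun z hz => ?_
    simpa using hz) hR
  simp only [add_zero] at h
  refine h.trans_eq ?_
  have hmp := measurePreserving_add_left (volume : Measure ℂ) c
  have h1 := hmp.setLIntegral_comp_preimage_emb (measurableEmbedding_addLeft c)
    (fun z => ‖f z‖ₑ) (Metric.ball c R)
  rw [← h1]
  congr 2
  ext z
  simp

/-- Hölder's inequality on the ball upgrades the case `p = 1`; the surplus power of the volume is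
then cancelled. -/
theorem submean_of_one_le {p : ℝ} (hp : 1 ≤ p) {f : ℂ → ℂ} {c : ℂ} {R : ℝ} (hR : 0 < R)
    (hf : DifferentiableOn ℂ f (Metric.ball c R)) :
    ‖f c‖ₑ ^ p * ENNReal.ofReal (Real.pi * R ^ 2) ≤ ∫⁻ z in Metric.ball c R, ‖f z‖ₑ ^ p := by
  have h1 := enorm_mul_le_lintegral_ball hf hR.le
  have hp0 : 0 < p := by linarith
  set V := ENNReal.ofReal (Real.pi * R ^ 2) with hV
  have hV0 : V ≠ 0 := by
    have : 0 < Real.pi * R ^ 2 := by have := Real.pi_pos; positivity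
    simpa [hV] using this
  have hVt : V ≠ ∞ := by finiteness
  have hvol : volume.restrict (Metric.ball c R) univ = V := by
    rw [Measure.restrict_apply_univ, Complex.volume_ball, hV,
      ENNReal.ofReal_mul Real.pi_pos.le, mul_comm, ENNReal.ofReal_pow hR.le]
    congr 1
    rw [ENNReal.ofReal, Real.toNNReal_of_nonneg Real.pi_pos.le]
    rfl
  have h2 := eLpNorm'_le_eLpNorm'_mul_rpow_measure_univ (μ := volume.restrict (Metric.ball c R))
    one_pos hp (hf.continuousOn.aestronglyMeasurable Metric.isOpen_ball.measurableSet)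
  simp only [eLpNorm', ENNReal.rpow_one, div_one, one_div, hvol] at h2
  have h3 := ENNReal.rpow_le_rpow (h1.trans h2) hp0.le
  rw [ENNReal.mul_rpow_of_nonneg _ _ hp0.le, ENNReal.mul_rpow_of_nonneg _ _ hp0.le,
    ENNReal.rpow_inv_rpow hp0.ne', ← ENNReal.rpow_mul] at h3
  have h4 : V ^ p = V ^ ((1 - p⁻¹) * p) * V := by
    nth_rewrite 3 [← ENNReal.rpow_one V]
    rw [← ENNReal.rpow_add _ _ hV0 hVt]
    congr 1
    field_simp
    ring
  have h5 : V ^ ((1 - p⁻¹) * p) ≠ 0 := (ENNReal.rpow_pos (pos_iff_ne_zero.2 hV0) hVt).ne'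
  have h6 : V ^ ((1 - p⁻¹) * p) ≠ ∞ := ENNReal.rpow_ne_top_of_ne_zero hV0 hVt
  rw [h4, mul_assoc, mul_comm (∫⁻ z in Metric.ball c R, ‖f z‖ₑ ^ p)] at h3
  rw [mul_comm]
  exact (ENNReal.mul_le_mul_iff_right h5 h6).1 h3

/-- The argument of Hardy and Littlewood: let `N` be the supremum of `|f| ^ p` weighted by the
squared distance to the boundary. Apply the case `p = 1` on a ball of half that distance, write `|f|
= |f| ^ (1 - p) |f| ^ p`, and bound the first factor through `N`. The result is `N ≤ 4 N ^ (1 - p) I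
^ p`, and `N ^ (1 - p)` cancels. -/
theorem submean_of_lt_one {p : ℝ} (hp0 : 0 < p) (hp : p < 1) {f : ℂ → ℂ} {c : ℂ} {R : ℝ}
    (hR : 0 < R) (hf : DifferentiableOn ℂ f (Metric.closedBall c R)) :
    ‖f c‖ₑ ^ p * ENNReal.ofReal (R ^ 2) ≤
      4 ^ (1 / p) * ∫⁻ z in Metric.ball c R, ‖f z‖ₑ ^ p := by
  set I := ∫⁻ z in Metric.ball c R, ‖f z‖ₑ ^ p with hI
  set N := ⨆ z ∈ Metric.ball c R, ‖f z‖ₑ ^ p * ENNReal.ofReal ((R - dist z c) ^ 2) with hN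
  have hcN : ‖f c‖ₑ ^ p * ENNReal.ofReal (R ^ 2) ≤ N := by
    have := le_iSup₂ (f := fun z (_ : z ∈ Metric.ball c R) =>
      ‖f z‖ₑ ^ p * ENNReal.ofReal ((R - dist z c) ^ 2)) c (Metric.mem_ball_self hR)
    rwa [dist_self, sub_zero] at this
  refine hcN.trans ?_
  -- Finiteness of `N` makes the final cancellation legitimate; this is where analyticity on the
  -- closed ball is needed.
  have hNtop : N ≠ ∞ := by
    obtain ⟨K, hK⟩ := (isCompact_closedBall c R).exists_bound_of_continuousOn hf.continuousOn
    refine ne_top_of_le_ne_top (b := ENNReal.ofReal K ^ p * ENNReal.ofReal (R ^ 2)) (by finiteness) ?_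
    refine iSup₂_le fun z hz => ?_
    have hz' : dist z c < R := hz
    have : ‖f z‖ₑ ≤ ENNReal.ofReal K := by
      rw [← ofReal_norm]
      exact ENNReal.ofReal_le_ofReal (hK z (Metric.ball_subset_closedBall hz))
    have h0 : 0 ≤ dist z c := dist_nonneg
    gcongr
    linarith
  by_cases hN0 : N = 0
  · simp [hN0]
  have key : N ≤ 4 * (N ^ (1 - p) * I ^ p) := by
    refine iSup₂_le fun z hz => ?_
    have hz' : dist z c < R := hz
    set d := R - dist z c with hd
    have hd0 : 0 < d := by linarith
    set D := ENNReal.ofReal ((d / 2) ^ 2) with hD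
    have hD0 : D ≠ 0 := by
      have : 0 < (d / 2) ^ 2 := by positivity
      simpa [hD] using hd0.ne'
    have hDt : D ≠ ∞ := by finiteness
    have hsub : Metric.ball z (d / 2) ⊆ Metric.ball c R :=
      Metric.ball_subset_ball' (by linarith)
    have h1 : D * ‖f z‖ₑ ≤ ∫⁻ w in Metric.ball z (d / 2), ‖f w‖ₑ := by
      refine le_trans ?_ (enorm_mul_le_lintegral_ball (f := f)
        (hf.mono (hsub.trans Metric.ball_subset_closedBall)) (by linarith))
      rw [hD]
      gcongr
      nlinarith [Real.pi_gt_three, sq_nonneg (d / 2)]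
    have h2 : ∫⁻ w in Metric.ball z (d / 2), ‖f w‖ₑ ≤ (N / D) ^ (1 / p - 1) * I := by
      calc ∫⁻ w in Metric.ball z (d / 2), ‖f w‖ₑ
          ≤ ∫⁻ w in Metric.ball z (d / 2), (N / D) ^ (1 / p - 1) * ‖f w‖ₑ ^ p := by
            refine setLIntegral_mono' measurableSet_ball fun w hw => ?_
            have hw1 : ‖f w‖ₑ ^ p ≤ N / D := by
              rw [ENNReal.le_div_iff_mul_le (Or.inl hD0) (Or.inl hDt)]
              refine le_trans ?_ (le_iSup₂ (f := fun z (_ : z ∈ Metric.ball c R) =>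
                ‖f z‖ₑ ^ p * ENNReal.ofReal ((R - dist z c) ^ 2)) w (hsub hw))
              have h3 := dist_triangle w z c
              have h4 : dist w z < d / 2 := hw
              refine mul_le_mul_right (ENNReal.ofReal_le_ofReal (pow_le_pow_left₀ (by linarith) ?_ 2)) _
              linarith
            have hpp : 0 ≤ 1 / p - 1 := by
              rw [sub_nonneg, le_div_iff₀ hp0]
              linarith
            calc ‖f w‖ₑ = (‖f w‖ₑ ^ p) ^ (1 / p - 1) * ‖f w‖ₑ ^ p := by
                  rw [← ENNReal.rpow_mul, ← ENNReal.rpow_add_of_nonneg _ _ (by positivity) hp0.le]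
                  have : p * (1 / p - 1) + p = 1 := by field_simp; ring
                  rw [this, ENNReal.rpow_one]
              _ ≤ _ := by gcongr
        _ = (N / D) ^ (1 / p - 1) * ∫⁻ w in Metric.ball z (d / 2), ‖f w‖ₑ ^ p := by
            rw [lintegral_const_mul' _ _ (ENNReal.rpow_ne_top_of_ne_zero
              (ENNReal.div_ne_zero.2 ⟨hN0, hDt⟩) (ENNReal.div_ne_top hNtop hD0))]
        _ ≤ _ := by
            gcongr
            exact lintegral_mono_set hsub
    have h3 := ENNReal.rpow_le_rpow (h1.trans h2) hp0.le
    rw [ENNReal.mul_rpow_of_nonneg _ _ hp0.le, ENNReal.mul_rpow_of_nonneg _ _ hp0.le,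
      ← ENNReal.rpow_mul, show (1 / p - 1) * p = 1 - p by field_simp] at h3
    have h4 : (N / D) ^ (1 - p) * D ^ (1 - p) = N ^ (1 - p) := by
      rw [← ENNReal.mul_rpow_of_nonneg _ _ (by linarith), ENNReal.div_mul_cancel hD0 hDt]
    have h5 : D ^ p * D ^ (1 - p) = D := by
      rw [← ENNReal.rpow_add _ _ hD0 hDt]
      simp
    have h6 : ENNReal.ofReal (d ^ 2) = 4 * D := by
      rw [hD, show (4 : ℝ≥0∞) = ENNReal.ofReal 4 by simp, ← ENNReal.ofReal_mul (by norm_num)]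
      ring_nf
    calc ‖f z‖ₑ ^ p * ENNReal.ofReal (d ^ 2) = 4 * (D ^ p * ‖f z‖ₑ ^ p * D ^ (1 - p)) := by
          rw [h6]
          nth_rewrite 1 [← h5]
          ring
      _ ≤ 4 * ((N / D) ^ (1 - p) * I ^ p * D ^ (1 - p)) := by gcongr
      _ = 4 * (((N / D) ^ (1 - p) * D ^ (1 - p)) * I ^ p) := by ring
      _ = _ := by rw [h4]
  have h1 : N = N ^ (1 - p) * N ^ p := by
    rw [← ENNReal.rpow_add _ _ hN0 hNtop]
    simp
  have h2 : N ^ (1 - p) * N ^ p ≤ N ^ (1 - p) * (4 * I ^ p) := by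
    rw [← h1]
    exact key.trans_eq (by ring)
  have h3 : N ^ p ≤ 4 * I ^ p := (ENNReal.mul_le_mul_iff_right
    (ENNReal.rpow_pos (pos_iff_ne_zero.2 hN0) hNtop).ne'
    (ENNReal.rpow_ne_top_of_ne_zero hN0 hNtop)).1 h2
  have h4 := ENNReal.rpow_le_rpow h3 (one_div_nonneg.2 hp0.le)
  rwa [ENNReal.mul_rpow_of_nonneg _ _ (one_div_nonneg.2 hp0.le), ← ENNReal.rpow_mul,
    ← ENNReal.rpow_mul, mul_one_div_cancel hp0.ne', ENNReal.rpow_one, ENNReal.rpow_one] at h4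

/-- The power `|f| ^ p` of an analytic function has the sub-mean value property over balls, up to
a constant that depends on `p` only. -/
theorem enorm_rpow_mul_sq_le {p : ℝ} (hp : 0 < p) {f : ℂ → ℂ} {c : ℂ} {R : ℝ} (hR : 0 < R)
    (hf : DifferentiableOn ℂ f (Metric.closedBall c R)) :
    ‖f c‖ₑ ^ p * ENNReal.ofReal (R ^ 2) ≤
      4 ^ (1 / p) * ∫⁻ z in Metric.ball c R, ‖f z‖ₑ ^ p := by
  rcases lt_or_ge p 1 with h | h
  · exact submean_of_lt_one hp h hR hf
  · calc ‖f c‖ₑ ^ p * ENNReal.ofReal (R ^ 2)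
        ≤ ‖f c‖ₑ ^ p * ENNReal.ofReal (Real.pi * R ^ 2) := by
          gcongr
          nlinarith [Real.pi_gt_three, sq_nonneg R]
      _ ≤ 1 * ∫⁻ z in Metric.ball c R, ‖f z‖ₑ ^ p := by
          rw [one_mul]
          exact submean_of_one_le h hR (hf.mono Metric.ball_subset_closedBall)
      _ ≤ _ := by
          gcongr
          exact ENNReal.one_le_rpow (by norm_num) (by positivity)

/-! ### Weighted area measure -/

/-- The area measure of the disc with weight `(1 - |z| ^ 2) ^ α`, without normalization. -/
noncomputable def areaMeasure (α : ℝ) : Measure ℂ :=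
  (volume.restrict disc).withDensity fun z => ENNReal.ofReal ((1 - ‖z‖ ^ 2) ^ α)

/-- The normalizing constant of the weighted Bergman norm. -/
noncomputable def normalizer (α : ℝ) : ℝ≥0∞ :=
  ENNReal.ofReal (α + 1) * (ENNReal.ofReal Real.pi)⁻¹

theorem normalizer_ne_zero {α : ℝ} (hα : -1 < α) : normalizer α ≠ 0 := by
  have : 0 < α + 1 := by linarith
  simp [normalizer, this]

theorem normalizer_ne_top (α : ℝ) : normalizer α ≠ ∞ := by
  have := Real.pi_pos
  simp [normalizer, ENNReal.mul_eq_top, this]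

theorem measurable_weight (α : ℝ) :
    Measurable fun z : ℂ => ENNReal.ofReal ((1 - ‖z‖ ^ 2) ^ α) := by
  fun_prop

theorem isOpen_disc : IsOpen disc := Metric.isOpen_ball

theorem mem_disc {z : ℂ} : z ∈ disc ↔ ‖z‖ < 1 := by simp [disc]

theorem lintegral_areaMeasure (α : ℝ) (F : ℂ → ℝ≥0∞) :
    ∫⁻ z, F z ∂areaMeasure α = ∫⁻ z in disc, ENNReal.ofReal ((1 - ‖z‖ ^ 2) ^ α) * F z := by
  rw [areaMeasure, lintegral_withDensity_eq_lintegral_mul_non_measurable _ (measurable_weight α)]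
  · rfl
  · exact Eventually.of_forall fun z => ENNReal.ofReal_lt_top

theorem setLIntegral_areaMeasure (α : ℝ) (F : ℂ → ℝ≥0∞) {S : Set ℂ} (hS : MeasurableSet S)
    (hSd : S ⊆ disc) :
    ∫⁻ z in S, F z ∂areaMeasure α = ∫⁻ z in S, ENNReal.ofReal ((1 - ‖z‖ ^ 2) ^ α) * F z := by
  rw [areaMeasure, restrict_withDensity hS, Measure.restrict_restrict hS,
    inter_eq_self_of_subset_left hSd,
    lintegral_withDensity_eq_lintegral_mul_non_measurable _ (measurable_weight α)]
  · rfl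
  · exact Eventually.of_forall fun z => ENNReal.ofReal_lt_top

theorem ae_areaMeasure_mem_disc (α : ℝ) : ∀ᵐ z ∂areaMeasure α, z ∈ disc :=
  (withDensity_absolutelyContinuous _ _).ae_le (ae_restrict_mem isOpen_disc.measurableSet)

theorem bergmanNorm_eq (p α : ℝ) (f : ℂ → ℂ) :
    bergmanNorm p α f = (normalizer α * ∫⁻ z, ‖f z‖ₑ ^ p ∂areaMeasure α) ^ (1 / p) := by
  rw [bergmanNorm, lintegral_areaMeasure, discArea, lintegral_smul_measure, normalizer, smul_eq_mul,
    mul_assoc]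
  simp only [mul_comm]

theorem bergmanNorm_rpow {p : ℝ} (hp : 0 < p) (α : ℝ) (f : ℂ → ℂ) :
    bergmanNorm p α f ^ p = normalizer α * ∫⁻ z, ‖f z‖ₑ ^ p ∂areaMeasure α := by
  rw [bergmanNorm_eq, ← ENNReal.rpow_mul, one_div_mul_cancel hp.ne', ENNReal.rpow_one]

theorem lintegral_eq_bergmanNorm {p α : ℝ} (hp : 0 < p) (hα : -1 < α) (f : ℂ → ℂ) :
    ∫⁻ z, ‖f z‖ₑ ^ p ∂areaMeasure α = (normalizer α)⁻¹ * bergmanNorm p α f ^ p := by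
  rw [bergmanNorm_rpow hp, ← mul_assoc, ENNReal.inv_mul_cancel (normalizer_ne_zero hα)
    (normalizer_ne_top α), one_mul]

theorem bergmanNorm_congr {p α : ℝ} {f g : ℂ → ℂ} (h : EqOn f g disc) :
    bergmanNorm p α f = bergmanNorm p α g := by
  rw [bergmanNorm_eq, bergmanNorm_eq]
  congr 2
  refine lintegral_congr_ae ?_
  filter_upwards [ae_areaMeasure_mem_disc α] with z hz
  rw [h hz]

/-! ### Elementary estimates for `1 - tz` -/

theorem one_sub_le_norm_one_sub_mul {z : ℂ} (hz : ‖z‖ ≤ 1) {t : ℝ} (ht0 : 0 ≤ t) :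
    1 - t ≤ ‖1 - t * z‖ := by
  have h := norm_sub_norm_le (1 : ℂ) (t * z)
  rw [norm_one, norm_mul, Complex.norm_real, Real.norm_of_nonneg ht0] at h
  nlinarith

theorem norm_one_sub_le_two_mul {z : ℂ} (hz : ‖z‖ ≤ 1) {t : ℝ} (ht0 : 0 ≤ t) (ht1 : t ≤ 1) :
    ‖1 - z‖ ≤ 2 * ‖1 - t * z‖ := by
  have h1 := one_sub_le_norm_one_sub_mul hz ht0
  have h2 : 1 - z = (1 - t * z) - ((1 - t : ℝ) : ℂ) * z := by push_cast; ring
  calc ‖1 - z‖ ≤ ‖1 - t * z‖ + ‖((1 - t : ℝ) : ℂ) * z‖ := by rw [h2]; exact norm_sub_le _ _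
    _ ≤ ‖1 - t * z‖ + (1 - t) := by
        rw [norm_mul, Complex.norm_real, Real.norm_of_nonneg (by linarith)]
        nlinarith
    _ ≤ _ := by linarith

/-- On the unit circle the chord is `2 |sin (θ / 2)| ≥ 2 |θ| / π`; moving in to radius `ρ` costs the
factor two. -/
theorem abs_le_pi_mul_norm_one_sub_circleMap {ρ θ : ℝ} (hρ0 : 0 ≤ ρ) (hρ1 : ρ ≤ 1)
    (hθ : |θ| ≤ Real.pi) : |θ| ≤ Real.pi * ‖1 - circleMap 0 ρ θ‖ := by
  have h1 : ‖Complex.exp (θ * Complex.I)‖ ≤ 1 := by simp [Complex.norm_exp]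
  have h2 := norm_one_sub_le_two_mul h1 hρ0 hρ1
  have h3 : circleMap 0 ρ θ = ρ * Complex.exp (θ * Complex.I) := by simp [circleMap]
  rw [← h3, norm_sub_rev 1 (Complex.exp _), mul_comm (θ : ℂ),
    Complex.norm_exp_I_mul_ofReal_sub_one] at h2
  have h4 := Real.mul_abs_le_abs_sin (x := θ / 2) (by rw [abs_div, abs_two]; linarith)
  rw [norm_mul, Real.norm_eq_abs, Real.norm_eq_abs, abs_two] at h2
  rw [abs_div, abs_two] at h4
  have hpi := Real.pi_pos
  have h5 : 2 / Real.pi * (|θ| / 2) = |θ| / Real.pi := by field_simp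
  rw [h5, div_le_iff₀ hpi] at h4
  nlinarith

/-! ### Measure of discs centred at `1` -/

/-- Comparability is required on both sides because `α` may have either sign. -/
theorem rpow_le_of_comparable {α x d : ℝ} {k : ℝ} (hk : 0 < k) (hd : 0 < d)
    (hx : 0 < x) (h1 : d ≤ k * x) (h2 : x ≤ k * d) : d ^ α ≤ k ^ |α| * x ^ α := by
  rcases le_total 0 α with h | h
  · rw [abs_of_nonneg h, ← Real.mul_rpow hk.le hx.le]
    exact Real.rpow_le_rpow hd.le h1 h
  · rw [abs_of_nonpos h, Real.rpow_neg hk.le, ← Real.inv_rpow hk.le,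
      ← Real.mul_rpow (by positivity) hx.le]
    refine Real.rpow_le_rpow_of_nonpos (by positivity) ?_ h
    rw [inv_mul_le_iff₀ hk]
    exact h2

theorem lintegral_one_sub_rpow {α : ℝ} (hα : -1 < α) {r : ℝ} (hr : 0 < r) :
    ∫⁻ ρ in Ioo (1 - r) 1, ENNReal.ofReal ((1 - ρ) ^ α) = ENNReal.ofReal (r ^ (α + 1) / (α + 1)) := by
  have hint : IntervalIntegrable (fun u : ℝ => u ^ α) volume 0 r :=
    intervalIntegral.intervalIntegrable_rpow' hα
  have h2 := hint.comp_sub_left 1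
  simp only [sub_zero] at h2
  rw [← ofReal_integral_eq_lintegral_ofReal]
  · rw [← integral_Ioc_eq_integral_Ioo, ← intervalIntegral.integral_of_le (by linarith)]
    have h := intervalIntegral.integral_comp_sub_left (a := 1 - r) (b := 1)
      (fun u : ℝ => u ^ α) 1
    rw [h, sub_self, sub_sub_cancel, integral_rpow (Or.inl hα), Real.zero_rpow (by linarith),
      sub_zero]
  · have h3 := h2.symm
    rw [intervalIntegrable_iff_integrableOn_Ioo_of_le (by linarith)] at h3
    exact h3
  · exact (ae_restrict_iff' measurableSet_Ioo).2 (Eventually.of_forall fun x hx =>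
      Real.rpow_nonneg (by linarith [hx.2]) _)

/-- The set lies in the polar rectangle `1 - r < ρ < 1`, `|θ| ≤ π r`, where the weight is comparable
to `(1 - ρ) ^ α`. The angle contributes `r` and the radius `r ^ (α + 1)`. -/
theorem exists_areaMeasure_le {α : ℝ} (hα : -1 < α) :
    ∃ C : ℝ≥0∞, C ≠ ∞ ∧ ∀ r : ℝ, 0 < r →
      areaMeasure α {z | ‖1 - z‖ < r} ≤ C * ENNReal.ofReal (r ^ (α + 2)) := by
  refine ⟨ENNReal.ofReal (2 ^ |α| * (2 * Real.pi) / (α + 1)), by finiteness, fun r hr => ?_⟩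
  have hpi := Real.pi_pos
  have hS : MeasurableSet {z : ℂ | ‖1 - z‖ < r} :=
    (isOpen_lt (by fun_prop) continuous_const).measurableSet
  set F : ℂ → ℝ≥0∞ := fun z => ENNReal.ofReal ((1 - ‖z‖ ^ 2) ^ α) *
    {z : ℂ | ‖1 - z‖ < r}.indicator 1 z with hF
  have hFm : Measurable F :=
    (measurable_weight α).mul (measurable_one.indicator hS)
  rw [← lintegral_indicator_one hS, lintegral_areaMeasure, disc]
  change ∫⁻ z in Metric.ball 0 1, F z ≤ _
  rw [lintegral_ball_eq_polar F 1 (hFm.indicator measurableSet_ball)]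
  calc ∫⁻ ρ in Ioo 0 1, ENNReal.ofReal ρ * ∫⁻ θ in Ioo (-Real.pi) Real.pi, F (circleMap 0 ρ θ)
      ≤ ∫⁻ ρ in Ioo (0 : ℝ) 1, (Ioo (1 - r) 1).indicator (fun ρ =>
          ENNReal.ofReal (2 ^ |α| * (2 * Real.pi * r)) * ENNReal.ofReal ((1 - ρ) ^ α)) ρ := by
        refine setLIntegral_mono' measurableSet_Ioo fun ρ hρ => ?_
        have hn : ∀ θ, ‖circleMap 0 ρ θ‖ = ρ := fun θ => by simp [abs_of_pos hρ.1]
        by_cases hρr : 1 - r < ρ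
        · rw [indicator_of_mem (by exact ⟨hρr, hρ.2⟩)]
          have h1 : ENNReal.ofReal ((1 - ρ ^ 2) ^ α) ≤ ENNReal.ofReal (2 ^ |α| * (1 - ρ) ^ α) := by
            apply ENNReal.ofReal_le_ofReal
            exact rpow_le_of_comparable two_pos (by nlinarith [hρ.1, hρ.2]) (by linarith [hρ.2])
              (by nlinarith [hρ.1, hρ.2]) (by nlinarith [hρ.1, hρ.2])
          calc ENNReal.ofReal ρ * ∫⁻ θ in Ioo (-Real.pi) Real.pi, F (circleMap 0 ρ θ)
              ≤ 1 * ∫⁻ θ in Ioo (-Real.pi) Real.pi,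
                (Icc (-(Real.pi * r)) (Real.pi * r)).indicator
                  (fun _ => ENNReal.ofReal (2 ^ |α| * (1 - ρ) ^ α)) θ := by
                refine mul_le_mul' (ENNReal.ofReal_le_one.2 hρ.2.le) ?_
                refine setLIntegral_mono' measurableSet_Ioo fun θ hθ => ?_
                by_cases hz : ‖1 - circleMap 0 ρ θ‖ < r
                · have h2 := abs_le_pi_mul_norm_one_sub_circleMap hρ.1.le hρ.2.le
                    (abs_le.2 ⟨hθ.1.le, hθ.2.le⟩)
                  have h3 : |θ| ≤ Real.pi * r := h2.trans (by gcongr)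
                  rw [indicator_of_mem (by exact abs_le.1 h3)]
                  simp only [hF, hn]
                  rw [indicator_of_mem (by exact hz), Pi.one_apply, mul_one]
                  exact h1
                · simp only [hF]
                  rw [indicator_of_notMem (by exact hz), mul_zero]
                  exact zero_le
            _ ≤ ∫⁻ θ, (Icc (-(Real.pi * r)) (Real.pi * r)).indicator
                  (fun _ => ENNReal.ofReal (2 ^ |α| * (1 - ρ) ^ α)) θ := by
                rw [one_mul]
                exact setLIntegral_le_lintegral _ _
            _ = _ := by
                have h4 : (0 : ℝ) ≤ 1 - ρ := by linarith [hρ.2]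
                rw [lintegral_indicator_const measurableSet_Icc, Real.volume_Icc,
                  ← ENNReal.ofReal_mul (by positivity), ← ENNReal.ofReal_mul (by positivity)]
                congr 1
                ring
        · have h5 : ∀ θ, F (circleMap 0 ρ θ) = 0 := fun θ => by
            have h6 : ¬ ‖1 - circleMap 0 ρ θ‖ < r := by
              have := norm_sub_norm_le 1 (circleMap 0 ρ θ)
              rw [hn, norm_one] at this
              linarith
            simp only [hF]
            rw [indicator_of_notMem (by exact h6), mul_zero]
          simp [h5]
    _ ≤ ∫⁻ ρ, (Ioo (1 - r) 1).indicator (fun ρ =>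
          ENNReal.ofReal (2 ^ |α| * (2 * Real.pi * r)) * ENNReal.ofReal ((1 - ρ) ^ α)) ρ :=
        setLIntegral_le_lintegral _ _
    _ = _ := by
        rw [lintegral_indicator measurableSet_Ioo, lintegral_const_mul' _ _ (by finiteness),
          lintegral_one_sub_rpow hα hr, ← ENNReal.ofReal_mul (by positivity),
          ← ENNReal.ofReal_mul (div_nonneg (by positivity) (by linarith))]
        congr 1
        rw [show α + 2 = α + 1 + 1 by ring, Real.rpow_add_one hr.ne' (α + 1)]
        ring

/-! ### Pointwise estimates in the Bergman space -/

theorem one_sub_norm_mem_of_mem_ball {z w : ℂ}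
    (hw : w ∈ Metric.closedBall z ((1 - ‖z‖) / 2)) :
    (1 - ‖z‖) / 2 ≤ 1 - ‖w‖ ∧ 1 - ‖w‖ ≤ 3 * (1 - ‖z‖) / 2 := by
  rw [Metric.mem_closedBall, dist_eq_norm] at hw
  have h := abs_norm_sub_norm_le w z
  have := abs_le.1 (h.trans hw)
  constructor <;> linarith [this.1, this.2]

/-- On this ball the weight is comparable to `(1 - |z|) ^ α`, so the unweighted sub-mean value
property applies. The integral is kept local: slow radial growth and the `ℓ ^ p` bound for radial
maxima both depend on it. -/
theorem exists_local_pointwise {p : ℝ} (hp : 0 < p) (α : ℝ) :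
    ∃ C : ℝ≥0∞, C ≠ ∞ ∧ ∀ f : ℂ → ℂ, DifferentiableOn ℂ f disc → ∀ z ∈ disc,
      ‖f z‖ₑ ^ p * ENNReal.ofReal ((1 - ‖z‖) ^ (α + 2)) ≤
        C * ∫⁻ w in Metric.ball z ((1 - ‖z‖) / 2), ‖f w‖ₑ ^ p ∂areaMeasure α := by
  refine ⟨ENNReal.ofReal (4 * 3 ^ |α|) * 4 ^ (1 / p), by finiteness, fun f hf z hz => ?_⟩
  set d := 1 - ‖z‖ with hd
  have hd0 : 0 < d := by have := mem_disc.1 hz; linarith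
  have hsub : Metric.closedBall z (d / 2) ⊆ disc := fun w hw => by
    have := (one_sub_norm_mem_of_mem_ball hw).1
    exact mem_disc.2 (by linarith)
  have h1 := enorm_rpow_mul_sq_le hp (c := z) (R := d / 2) (by linarith) (hf.mono hsub)
  rw [setLIntegral_areaMeasure _ _ measurableSet_ball (Metric.ball_subset_closedBall.trans hsub)]
  have h2 : ENNReal.ofReal (d ^ α) * ∫⁻ w in Metric.ball z (d / 2), ‖f w‖ₑ ^ p ≤
      ENNReal.ofReal (3 ^ |α|) * ∫⁻ w in Metric.ball z (d / 2),
        ENNReal.ofReal ((1 - ‖w‖ ^ 2) ^ α) * ‖f w‖ₑ ^ p := by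
    rw [← lintegral_const_mul' _ _ (by finiteness), ← lintegral_const_mul' _ _ (by finiteness)]
    refine setLIntegral_mono' measurableSet_ball fun w hw => ?_
    obtain ⟨h3, h4⟩ := one_sub_norm_mem_of_mem_ball (Metric.ball_subset_closedBall hw)
    have h5 : 0 ≤ ‖w‖ := norm_nonneg w
    rw [← mul_assoc, ← ENNReal.ofReal_mul (by positivity)]
    gcongr
    apply rpow_le_of_comparable three_pos hd0 <;> nlinarith
  have h6 : ENNReal.ofReal (d ^ (α + 2)) =
      4 * (ENNReal.ofReal (d ^ α) * ENNReal.ofReal ((d / 2) ^ 2)) := by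
    rw [show (4 : ℝ≥0∞) = ENNReal.ofReal 4 by simp, ← ENNReal.ofReal_mul (by positivity),
      ← ENNReal.ofReal_mul (by positivity), Real.rpow_add hd0, Real.rpow_two]
    ring_nf
  calc ‖f z‖ₑ ^ p * ENNReal.ofReal (d ^ (α + 2))
      = 4 * (ENNReal.ofReal (d ^ α) * (‖f z‖ₑ ^ p * ENNReal.ofReal ((d / 2) ^ 2))) := by
        rw [h6]; ring
    _ ≤ 4 * (ENNReal.ofReal (d ^ α) *
          (4 ^ (1 / p) * ∫⁻ w in Metric.ball z (d / 2), ‖f w‖ₑ ^ p)) := by gcongr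
    _ = 4 * 4 ^ (1 / p) * (ENNReal.ofReal (d ^ α) *
          ∫⁻ w in Metric.ball z (d / 2), ‖f w‖ₑ ^ p) := by ring
    _ ≤ _ := by
        refine (mul_le_mul_right h2 _).trans_eq ?_
        rw [ENNReal.ofReal_mul (by norm_num), show ENNReal.ofReal 4 = 4 by simp]
        ring

theorem enorm_mul_rpow_eq {p β d : ℝ} (hp : 0 < p) (hd : 0 ≤ d) (x : ℝ≥0∞) :
    (x ^ p * ENNReal.ofReal (d ^ β)) ^ (1 / p) = x * ENNReal.ofReal (d ^ (β / p)) := by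
  rw [ENNReal.mul_rpow_of_nonneg _ _ (by positivity), ← ENNReal.rpow_mul,
    mul_one_div_cancel hp.ne', ENNReal.rpow_one,
    ENNReal.ofReal_rpow_of_nonneg (by positivity) (by positivity), ← Real.rpow_mul hd,
    mul_one_div]

/-- Point evaluations are bounded on the Bergman space, with growth `(1 - |z|) ^ (-(α + 2) / p)`. -/
theorem exists_pointwise {p α : ℝ} (hp : 0 < p) (hα : -1 < α) :
    ∃ C : ℝ≥0∞, C ≠ ∞ ∧ ∀ f : ℂ → ℂ, DifferentiableOn ℂ f disc → ∀ z ∈ disc,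
      ‖f z‖ₑ * ENNReal.ofReal ((1 - ‖z‖) ^ ((α + 2) / p)) ≤ C * bergmanNorm p α f := by
  obtain ⟨C, hC, h⟩ := exists_local_pointwise hp α
  refine ⟨(C * (normalizer α)⁻¹) ^ (1 / p), ?_, fun f hf z hz => ?_⟩
  · have := normalizer_ne_zero hα
    exact ENNReal.rpow_ne_top_of_nonneg (by positivity)
      (ENNReal.mul_ne_top hC (ENNReal.inv_ne_top.2 this))
  have hd0 : 0 < 1 - ‖z‖ := by have := mem_disc.1 hz; linarith
  have h1 := (h f hf z hz).trans (mul_le_mul_right (setLIntegral_le_lintegral _ _) C)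
  rw [lintegral_eq_bergmanNorm hp hα, ← mul_assoc] at h1
  have h2 := ENNReal.rpow_le_rpow h1 (one_div_nonneg.2 hp.le)
  rwa [enorm_mul_rpow_eq hp hd0.le, ENNReal.mul_rpow_of_nonneg _ _ (by positivity),
    ← ENNReal.rpow_mul (bergmanNorm p α f), mul_one_div_cancel hp.ne', ENNReal.rpow_one] at h2

/-- Along the radius, functions in the Bergman space grow strictly slower than point
evaluations. -/
theorem tendsto_enorm_mul_rpow {p α : ℝ} (hp : 0 < p) (hα : -1 < α) {f : ℂ → ℂ}
    (hf : f ∈ bergmanSpace p α) :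
    Tendsto (fun t : ℝ => ‖f t‖ₑ * ENNReal.ofReal ((1 - t) ^ ((α + 2) / p))) (𝓝[<] 1) (𝓝 0) := by
  obtain ⟨C, hC, h⟩ := exists_local_pointwise hp α
  obtain ⟨K, hK, hν⟩ := exists_areaMeasure_le hα
  have hfin : ∫⁻ z, ‖f z‖ₑ ^ p ∂areaMeasure α ≠ ∞ := by
    rw [lintegral_eq_bergmanNorm hp hα]
    exact ENNReal.mul_ne_top (ENNReal.inv_ne_top.2 (normalizer_ne_zero hα))
      (ENNReal.rpow_ne_top_of_nonneg hp.le hf.2.ne)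
  have hlt : ∀ᶠ t : ℝ in 𝓝[<] 1, t ∈ Ioo (0 : ℝ) 1 := Ioo_mem_nhdsLT one_pos
  -- The balls of the local estimate lie in sets shrinking to `1`, so absolute continuity of the
  -- integral makes the right-hand side vanish in the limit.
  have hν0 : Tendsto (areaMeasure α ∘ fun t : ℝ => {z : ℂ | ‖1 - z‖ < 2 * (1 - t)}) (𝓝[<] 1)
      (𝓝 0) := by
    have h1 : Tendsto (fun t : ℝ => K * ENNReal.ofReal ((2 * (1 - t)) ^ (α + 2))) (𝓝[<] 1)
        (𝓝 (K * ENNReal.ofReal ((2 * (1 - 1)) ^ (α + 2)))) := by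
      refine ENNReal.Tendsto.const_mul (ENNReal.tendsto_ofReal ?_) (Or.inr hK)
      have : ContinuousAt (fun t : ℝ => (2 * (1 - t)) ^ (α + 2)) 1 :=
        ContinuousAt.rpow_const (by fun_prop) (Or.inr (by linarith))
      exact this.tendsto.mono_left nhdsWithin_le_nhds
    rw [sub_self, mul_zero, Real.zero_rpow (by linarith), ENNReal.ofReal_zero, mul_zero] at h1
    refine tendsto_of_tendsto_of_tendsto_of_le_of_le' tendsto_const_nhds h1
      (Eventually.of_forall fun _ => zero_le) ?_
    filter_upwards [hlt] with t ht
    exact hν _ (by linarith [ht.2])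
  have h2 := (ENNReal.Tendsto.const_mul (tendsto_setLIntegral_zero hfin hν0) (Or.inr hC)).ennrpow_const
    (1 / p)
  rw [mul_zero, ENNReal.zero_rpow_of_pos (by positivity)] at h2
  refine tendsto_of_tendsto_of_tendsto_of_le_of_le' tendsto_const_nhds h2
    (Eventually.of_forall fun _ => zero_le) ?_
  filter_upwards [hlt] with t ht
  have hn : ‖(t : ℂ)‖ = t := by rw [Complex.norm_real, Real.norm_of_nonneg ht.1.le]
  have h3 := h f hf.1 t (mem_disc.2 (by rw [hn]; exact ht.2))
  rw [hn] at h3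
  rw [← enorm_mul_rpow_eq hp (by linarith [ht.2])]
  refine ENNReal.rpow_le_rpow (h3.trans ?_) (by positivity)
  refine mul_le_mul_right (lintegral_mono_set fun w hw => ?_) _
  have h4 : ‖w - t‖ < (1 - t) / 2 := by simpa [dist_eq_norm] using hw
  have h5 : ‖(1 : ℂ) - t‖ = 1 - t := by
    rw [show (1 : ℂ) - t = ((1 - t : ℝ) : ℂ) by push_cast; rfl, Complex.norm_real,
      Real.norm_of_nonneg (by linarith [ht.2])]
  have h6 : ‖1 - w‖ ≤ ‖(1 : ℂ) - t‖ + ‖w - t‖ := by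
    rw [norm_sub_rev w]
    simpa using norm_add_le ((1 : ℂ) - t) (t - w)
  show ‖1 - w‖ < 2 * (1 - t)
  linarith [ht.2]

/-! ### Powers of two and a discrete convolution inequality -/

theorem two_rpow_add (x y : ℝ) : (2 : ℝ≥0∞) ^ (x + y) = 2 ^ x * 2 ^ y :=
  ENNReal.rpow_add x y two_ne_zero ENNReal.ofNat_ne_top

theorem two_rpow_ne_top (x : ℝ) : (2 : ℝ≥0∞) ^ x ≠ ∞ :=
  ENNReal.rpow_ne_top_of_ne_zero two_ne_zero ENNReal.ofNat_ne_top

theorem two_rpow_le {x y : ℝ} (h : x ≤ y) : (2 : ℝ≥0∞) ^ x ≤ 2 ^ y :=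
  ENNReal.rpow_le_rpow_of_exponent_le (by norm_num) h

theorem ofReal_two_rpow (x : ℝ) : ENNReal.ofReal (2 ^ x) = 2 ^ x := by
  rw [← ENNReal.ofReal_rpow_of_pos two_pos]
  simp

theorem half_pow_eq (j : ℕ) : (1 / 2 : ℝ) ^ j = 2 ^ (-(j : ℝ)) := by
  rw [Real.rpow_neg two_pos.le, Real.rpow_natCast, one_div, inv_pow]

theorem ofReal_half_pow_rpow (j : ℕ) (x : ℝ) :
    ENNReal.ofReal (((1 / 2 : ℝ) ^ j) ^ x) = 2 ^ (-(j * x)) := by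
  rw [half_pow_eq, ← Real.rpow_mul two_pos.le, ofReal_two_rpow, neg_mul]

theorem tsum_two_rpow_le {κ : ℝ} (hκ : 0 < κ) (i : ℕ) :
    ∑' j : ℕ, (2 : ℝ≥0∞) ^ (-(κ * |(i : ℝ) - j|)) ≤
      ∑' n : ℕ, (2 : ℝ≥0∞) ^ (-(κ * n)) + ∑' n : ℕ, (2 : ℝ≥0∞) ^ (-(κ * n)) := by
  rw [← Summable.sum_add_tsum_nat_add' (k := i) ENNReal.summable]
  refine add_le_add ?_ (ENNReal.tsum_le_tsum fun n => ?_)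
  · rw [← Finset.sum_range_reflect]
    refine le_trans (Finset.sum_le_sum fun n hn => ?_) (ENNReal.sum_le_tsum (Finset.range i))
    apply two_rpow_le
    have hn' := Finset.mem_range.1 hn
    have h1 : ((i - 1 - n : ℕ) : ℝ) = i - 1 - n := by
      rw [Nat.cast_sub (by omega), Nat.cast_sub (by omega)]
      simp
    have h2 : (n : ℝ) ≤ |(i : ℝ) - (i - 1 - n : ℕ)| := by
      rw [h1]
      exact le_trans (by linarith) (le_abs_self _)
    have := mul_le_mul_of_nonneg_left h2 hκ.le
    linarith
  · apply two_rpow_le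
    push_cast
    rw [show (i : ℝ) - (n + i) = -n by ring, abs_neg, abs_of_nonneg (by positivity)]

theorem tsum_two_rpow_ne_top {κ : ℝ} (hκ : 0 < κ) :
    ∑' n : ℕ, (2 : ℝ≥0∞) ^ (-(κ * n)) ≠ ∞ := by
  have hr1 : (2 : ℝ≥0∞) ^ (-κ) < 1 :=
    ENNReal.rpow_lt_one_of_one_lt_of_neg (by norm_num) (by linarith)
  have hpow : ∀ n : ℕ, (2 : ℝ≥0∞) ^ (-(κ * n)) = ((2 : ℝ≥0∞) ^ (-κ)) ^ n := fun n => by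
    rw [← ENNReal.rpow_natCast, ← ENNReal.rpow_mul, neg_mul]
  simp_rw [hpow]
  rw [ENNReal.tsum_geometric]
  exact ENNReal.inv_ne_top.2 (tsub_pos_of_lt hr1).ne'

theorem exists_tsum_two_rpow_le {κ : ℝ} (hκ : 0 < κ) :
    ∃ C : ℝ≥0∞, C ≠ ∞ ∧ ∀ i : ℕ, ∑' j : ℕ, (2 : ℝ≥0∞) ^ (-(κ * |(i : ℝ) - j|)) ≤ C :=
  ⟨_, ENNReal.add_ne_top.2 ⟨tsum_two_rpow_ne_top hκ, tsum_two_rpow_ne_top hκ⟩,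
    tsum_two_rpow_le hκ⟩

/-- Half of the exponential decay bounds each term by `S i ^ (1 / q)`, a single term being at most
the whole sum; the other half is summed. This works for every positive `q` without Hölder's
inequality. -/
theorem exists_tsum_conv_rpow_le {q κ : ℝ} (hq : 0 < q) (hκ : 0 < κ) :
    ∃ C : ℝ≥0∞, C ≠ ∞ ∧ ∀ y : ℕ → ℝ≥0∞,
      ∑' i : ℕ, (∑' j : ℕ, y j * 2 ^ (-(κ * |(i : ℝ) - j|))) ^ q ≤ C * ∑' j, y j ^ q := by
  obtain ⟨C₁, hC₁, h₁⟩ := exists_tsum_two_rpow_le (κ := κ / 2) (by linarith)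
  obtain ⟨C₂, hC₂, h₂⟩ := exists_tsum_two_rpow_le (κ := κ / 2 * q) (by positivity)
  refine ⟨C₁ ^ q * C₂, by finiteness, fun y => ?_⟩
  set S : ℕ → ℝ≥0∞ := fun i => ∑' j : ℕ, y j ^ q * 2 ^ (-(κ / 2 * q * |(i : ℝ) - j|)) with hS
  have hle : ∀ i j : ℕ, y j * 2 ^ (-(κ / 2 * |(i : ℝ) - j|)) ≤ S i ^ (1 / q) := fun i j => by
    rw [one_div, ENNReal.le_rpow_inv_iff hq, ENNReal.mul_rpow_of_nonneg _ _ hq.le, ← ENNReal.rpow_mul]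
    refine le_trans (le_of_eq ?_) (ENNReal.le_tsum j)
    congr 2
    ring
  calc ∑' i : ℕ, (∑' j : ℕ, y j * 2 ^ (-(κ * |(i : ℝ) - j|))) ^ q
      ≤ ∑' i : ℕ, (∑' j : ℕ, S i ^ (1 / q) * 2 ^ (-(κ / 2 * |(i : ℝ) - j|))) ^ q := by
        refine ENNReal.tsum_le_tsum fun i => ENNReal.rpow_le_rpow
          (ENNReal.tsum_le_tsum fun j => ?_) hq.le
        calc y j * 2 ^ (-(κ * |(i : ℝ) - j|))
            = (y j * 2 ^ (-(κ / 2 * |(i : ℝ) - j|))) * 2 ^ (-(κ / 2 * |(i : ℝ) - j|)) := by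
              rw [mul_assoc, ← two_rpow_add]
              ring_nf
          _ ≤ _ := by gcongr; exact hle i j
    _ ≤ ∑' i : ℕ, C₁ ^ q * S i := by
        refine ENNReal.tsum_le_tsum fun i => ?_
        rw [ENNReal.tsum_mul_left, ENNReal.mul_rpow_of_nonneg _ _ hq.le, ← ENNReal.rpow_mul,
          one_div_mul_cancel hq.ne', ENNReal.rpow_one, mul_comm]
        gcongr
        exact h₁ i
    _ = C₁ ^ q * ∑' j : ℕ, y j ^ q * ∑' i : ℕ, 2 ^ (-(κ / 2 * q * |(j : ℝ) - i|)) := by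
        rw [ENNReal.tsum_mul_left, hS, ENNReal.tsum_comm]
        congr 1
        refine tsum_congr fun j => ?_
        rw [← ENNReal.tsum_mul_left]
        refine tsum_congr fun i => ?_
        rw [abs_sub_comm]
    _ ≤ C₁ ^ q * ∑' j : ℕ, y j ^ q * C₂ := by
        gcongr with j
        exact h₂ j
    _ = _ := by rw [ENNReal.tsum_mul_right]; ring

/-! ### Dyadic decompositions of the radius and of the disc -/

theorem half_pow_unique {i j : ℕ} {x : ℝ} (hi : (1 / 2 : ℝ) ^ (i + 1) < x) (hi' : x ≤ (1 / 2) ^ i)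
    (hj : (1 / 2 : ℝ) ^ (j + 1) < x) (hj' : x ≤ (1 / 2) ^ j) : i = j := by
  have h1 := (pow_lt_pow_iff_right_of_lt_one₀ (a := (1 / 2 : ℝ)) (by norm_num) (by norm_num)).1
    (hi.trans_le hj')
  have h2 := (pow_lt_pow_iff_right_of_lt_one₀ (a := (1 / 2 : ℝ)) (by norm_num) (by norm_num)).1
    (hj.trans_le hi')
  omega

/-- The `j`-th dyadic interval of the radius: `2 ^ (-j - 1) < 1 - t ≤ 2 ^ (-j)`. -/
def dyadic (j : ℕ) : Set ℝ := {t | (1 / 2 : ℝ) ^ (j + 1) < 1 - t ∧ 1 - t ≤ (1 / 2) ^ j}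

theorem dyadic_bounds {j : ℕ} {t : ℝ} (ht : t ∈ dyadic j) : 0 ≤ t ∧ t < 1 := by
  have h1 : (0 : ℝ) < (1 / 2) ^ (j + 1) := by positivity
  have h2 : (1 / 2 : ℝ) ^ j ≤ 1 := pow_le_one₀ (by norm_num) (by norm_num)
  exact ⟨by linarith [ht.2], by linarith [ht.1]⟩

theorem exists_mem_dyadic {t : ℝ} (ht : t ∈ Ico (0 : ℝ) 1) : ∃ j, t ∈ dyadic j :=
  exists_nat_pow_near_of_lt_one (by linarith [ht.2]) (by linarith [ht.1]) (by norm_num)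
    (by norm_num)

theorem measurableSet_dyadic (j : ℕ) : MeasurableSet (dyadic j) :=
  (measurableSet_lt (f := fun _ => (1 / 2 : ℝ) ^ (j + 1)) (g := fun t : ℝ => 1 - t)
    (by fun_prop) (by fun_prop)).inter
    (measurableSet_le (f := fun t : ℝ => 1 - t) (by fun_prop) measurable_const)

/-- The `i`-th dyadic shell of the disc around the boundary point `1`. -/
def shell (i : ℕ) : Set ℂ := {z | (1 / 2 : ℝ) ^ i < ‖1 - z‖ ∧ ‖1 - z‖ ≤ 2 * (1 / 2) ^ i}

theorem measurableSet_shell (i : ℕ) : MeasurableSet (shell i) :=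
  (measurableSet_lt (f := fun _ => (1 / 2 : ℝ) ^ i) (g := fun z : ℂ => ‖1 - z‖)
    (by fun_prop) (by fun_prop)).inter
    (measurableSet_le (f := fun z : ℂ => ‖1 - z‖) (by fun_prop) measurable_const)

theorem pairwise_disjoint_shell : Pairwise (Function.onFun Disjoint shell) := by
  intro i j hij
  refine Set.disjoint_left.2 fun z hi hj => hij ?_
  refine half_pow_unique (x := ‖1 - z‖ / 2) ?_ ?_ ?_ ?_
  · rw [pow_succ]; linarith [hi.1]
  · linarith [hi.2]
  · rw [pow_succ]; linarith [hj.1]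
  · linarith [hj.2]

theorem exists_mem_shell {z : ℂ} (hz : z ∈ disc) : ∃ i, z ∈ shell i := by
  have hz' := mem_disc.1 hz
  have h0 : 0 < ‖1 - z‖ := by
    rw [norm_pos_iff, sub_ne_zero]
    rintro rfl
    simp at hz'
  have h1 : ‖1 - z‖ ≤ 2 := by
    have := norm_sub_le 1 z
    rw [norm_one] at this
    linarith
  obtain ⟨i, hi, hi'⟩ := exists_nat_pow_near_of_lt_one (x := ‖1 - z‖ / 2) (y := 1 / 2)
    (by linarith) (by linarith) (by norm_num) (by norm_num)
  refine ⟨i, ?_, by linarith⟩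
  rw [pow_succ] at hi
  linarith

theorem tsum_shell_le (α : ℝ) (F : ℂ → ℝ≥0∞) :
    ∑' i, ∫⁻ z in shell i, F z ∂areaMeasure α ≤ ∫⁻ z, F z ∂areaMeasure α := by
  rw [← lintegral_iUnion measurableSet_shell pairwise_disjoint_shell]
  exact setLIntegral_le_lintegral _ _

theorem le_tsum_shell (α : ℝ) (F : ℂ → ℝ≥0∞) :
    ∫⁻ z, F z ∂areaMeasure α ≤ ∑' i, ∫⁻ z in shell i, F z ∂areaMeasure α := by
  rw [← lintegral_iUnion measurableSet_shell pairwise_disjoint_shell,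
    Measure.restrict_eq_self_of_ae_mem]
  filter_upwards [ae_areaMeasure_mem_disc α] with z hz
  exact mem_iUnion.2 (exists_mem_shell hz)

theorem exists_areaMeasure_shell_le {α : ℝ} (hα : -1 < α) :
    ∃ C : ℝ≥0∞, C ≠ ∞ ∧ ∀ i : ℕ, areaMeasure α (shell i) ≤ C * 2 ^ (-(i * (α + 2))) := by
  obtain ⟨C, hC, h⟩ := exists_areaMeasure_le hα
  refine ⟨C * ENNReal.ofReal (4 ^ (α + 2)), by finiteness, fun i => ?_⟩
  have hp : (0 : ℝ) < (1 / 2) ^ i := by positivity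
  refine (measure_mono fun z hz => ?_).trans ((h (4 * (1 / 2) ^ i) (by positivity)).trans_eq ?_)
  · show ‖1 - z‖ < 4 * (1 / 2) ^ i
    linarith [hz.2]
  · rw [Real.mul_rpow (by norm_num) hp.le, ENNReal.ofReal_mul (by positivity),
      ofReal_half_pow_rpow, mul_assoc]

/-- An upper estimate of an integral over the disc by the values on the dyadic shells. -/
theorem exists_lintegral_le_tsum {α : ℝ} (hα : -1 < α) :
    ∃ C : ℝ≥0∞, C ≠ ∞ ∧ ∀ (F : ℂ → ℝ≥0∞) (b : ℕ → ℝ≥0∞),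
      (∀ i, ∀ z ∈ shell i ∩ disc, F z ≤ b i) →
      ∫⁻ z, F z ∂areaMeasure α ≤ C * ∑' i : ℕ, b i * 2 ^ (-(i * (α + 2))) := by
  obtain ⟨C, hC, h⟩ := exists_areaMeasure_shell_le hα
  refine ⟨C, hC, fun F b hFb => (le_tsum_shell α F).trans ?_⟩
  rw [← ENNReal.tsum_mul_left]
  refine ENNReal.tsum_le_tsum fun i => ?_
  calc ∫⁻ z in shell i, F z ∂areaMeasure α
      ≤ ∫⁻ _ in shell i, b i ∂areaMeasure α := by
        refine lintegral_mono_ae ?_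
        filter_upwards [ae_restrict_mem (measurableSet_shell i),
          ae_restrict_of_ae (ae_areaMeasure_mem_disc α)] with z hz hz'
        exact hFb i z ⟨hz, hz'⟩
    _ = b i * areaMeasure α (shell i) := by rw [lintegral_const, Measure.restrict_apply_univ]
    _ ≤ b i * (C * 2 ^ (-(i * (α + 2)))) := by gcongr; exact h i
    _ = _ := by ring

/-- The maximum of `|f|` over a dyadic interval of the radius. -/
noncomputable def radialSup (f : ℂ → ℂ) (j : ℕ) : ℝ≥0∞ := ⨆ t ∈ dyadic j, ‖f (t : ℝ)‖ₑ

theorem le_radialSup (f : ℂ → ℂ) {j : ℕ} {t : ℝ} (ht : t ∈ dyadic j) :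
    ‖f (t : ℝ)‖ₑ ≤ radialSup f j :=
  le_iSup₂ (f := fun (t : ℝ) (_ : t ∈ dyadic j) => ‖f (t : ℝ)‖ₑ) t ht

theorem ofReal_mem_disc {t : ℝ} (ht0 : 0 ≤ t) (ht1 : t < 1) : (t : ℂ) ∈ disc := by
  rw [mem_disc, Complex.norm_real, Real.norm_of_nonneg ht0]
  exact ht1

/-- The radial maxima of a function in the Bergman space form a weighted `ℓ ^ p` sequence. -/
theorem exists_tsum_radialSup_le {p α : ℝ} (hp : 0 < p) (hα : -1 < α) :
    ∃ C : ℝ≥0∞, C ≠ ∞ ∧ ∀ f : ℂ → ℂ, DifferentiableOn ℂ f disc →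
      ∑' j : ℕ, (radialSup f j * 2 ^ (-(j * ((α + 2) / p)))) ^ p ≤ C * bergmanNorm p α f ^ p := by
  obtain ⟨C, hC, h⟩ := exists_local_pointwise hp α
  have hβ : 0 < α + 2 := by linarith
  refine ⟨2 ^ (α + 2) * C * 3 * (normalizer α)⁻¹, ?_, fun f hf => ?_⟩
  · have := normalizer_ne_zero hα
    finiteness
  set v : ℕ → ℝ≥0∞ := fun i => ∫⁻ w in shell i, ‖f w‖ₑ ^ p ∂areaMeasure α with hv
  have hloc : ∀ j, (radialSup f j * 2 ^ (-(j * ((α + 2) / p)))) ^ p ≤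
      2 ^ (α + 2) * C * (v j + v (j + 1) + v (j + 2)) := fun j => by
    rw [← ENNReal.le_rpow_inv_iff hp, radialSup, ENNReal.iSup_mul]
    refine iSup_le fun t => ?_
    rw [ENNReal.iSup_mul]
    refine iSup_le fun ht => ?_
    rw [ENNReal.le_rpow_inv_iff hp, ENNReal.mul_rpow_of_nonneg _ _ hp.le, ← ENNReal.rpow_mul]
    obtain ⟨ht0, ht1⟩ := dyadic_bounds ht
    have hn : ‖(t : ℂ)‖ = t := by rw [Complex.norm_real, Real.norm_of_nonneg ht0]
    have h1 := h f hf t (ofReal_mem_disc ht0 ht1)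
    rw [hn] at h1
    have h2 : (2 : ℝ≥0∞) ^ (-(j * ((α + 2) / p)) * p) ≤
        2 ^ (α + 2) * ENNReal.ofReal ((1 - t) ^ (α + 2)) := by
      rw [← ofReal_two_rpow (α + 2), ← ENNReal.ofReal_mul (by positivity),
        ← Real.mul_rpow two_pos.le (by linarith),
        show -(j * ((α + 2) / p)) * p = -(j * (α + 2)) by field_simp, ← ofReal_half_pow_rpow]
      refine ENNReal.ofReal_le_ofReal (Real.rpow_le_rpow (by positivity) ?_ hβ.le)
      have := ht.1
      rw [pow_succ] at this
      linarith
    have h3 : ∫⁻ w in Metric.ball (t : ℂ) ((1 - t) / 2), ‖f w‖ₑ ^ p ∂areaMeasure α ≤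
        v j + v (j + 1) + v (j + 2) := by
      -- In this ball `|1 - w|` lies between half and three halves of `1 - t`, that is, between `2 ^
      -- (-j - 2)` and `(3 / 2) 2 ^ (-j)`; three consecutive shells cover this range.
      have hsub : Metric.ball (t : ℂ) ((1 - t) / 2) ⊆
          (shell j ∪ shell (j + 1)) ∪ shell (j + 2) := by
        intro w hw
        have h4 : ‖w - t‖ < (1 - t) / 2 := by simpa [dist_eq_norm] using hw
        have h5 : ‖(1 : ℂ) - t‖ = 1 - t := by
          rw [show (1 : ℂ) - t = ((1 - t : ℝ) : ℂ) by push_cast; rfl, Complex.norm_real,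
            Real.norm_of_nonneg (by linarith)]
        have h6 : ‖1 - w‖ ≤ ‖(1 : ℂ) - t‖ + ‖w - t‖ := by
          rw [norm_sub_rev w]
          simpa using norm_add_le ((1 : ℂ) - t) (t - w)
        have h7 : ‖(1 : ℂ) - t‖ ≤ ‖1 - w‖ + ‖w - t‖ := by
          simpa using norm_add_le ((1 : ℂ) - w) (w - t)
        obtain ⟨h8, h9⟩ := ht
        rw [pow_succ] at h8
        simp only [shell, mem_union, mem_ofPred_eq, pow_succ]
        rcases lt_or_ge ((1 / 2 : ℝ) ^ j) ‖1 - w‖ with h10 | h10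
        · exact Or.inl (Or.inl ⟨h10, by linarith⟩)
        rcases lt_or_ge ((1 / 2 : ℝ) ^ j * (1 / 2)) ‖1 - w‖ with h11 | h11
        · exact Or.inl (Or.inr ⟨h11, by linarith⟩)
        · exact Or.inr ⟨by linarith, by linarith⟩
      exact (lintegral_mono_set hsub).trans ((lintegral_union_le _ _ _).trans
        (add_le_add_left (lintegral_union_le _ _ _) _))
    calc ‖f t‖ₑ ^ p * 2 ^ (-(j * ((α + 2) / p)) * p)
        ≤ ‖f t‖ₑ ^ p * (2 ^ (α + 2) * ENNReal.ofReal ((1 - t) ^ (α + 2))) := by gcongr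
      _ = 2 ^ (α + 2) * (‖f t‖ₑ ^ p * ENNReal.ofReal ((1 - t) ^ (α + 2))) := by ring
      _ ≤ 2 ^ (α + 2) * (C * (v j + v (j + 1) + v (j + 2))) := by
          exact mul_le_mul_right (h1.trans (mul_le_mul_right h3 _)) _
      _ = _ := by ring
  have hshift : ∀ k, ∑' j, v (j + k) ≤ ∑' j, v j := fun k =>
    ENNReal.tsum_comp_le_tsum_of_injective (add_left_injective k) v
  calc ∑' j : ℕ, (radialSup f j * 2 ^ (-(j * ((α + 2) / p)))) ^ p
      ≤ ∑' j, 2 ^ (α + 2) * C * (v j + v (j + 1) + v (j + 2)) := ENNReal.tsum_le_tsum hloc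
    _ = 2 ^ (α + 2) * C * (∑' j, v j + ∑' j, v (j + 1) + ∑' j, v (j + 2)) := by
        rw [ENNReal.tsum_mul_left, ENNReal.tsum_add, ENNReal.tsum_add]
    _ ≤ 2 ^ (α + 2) * C * (∑' j, v j + ∑' j, v j + ∑' j, v j) := by
        exact mul_le_mul_right (add_le_add (add_le_add le_rfl (hshift 1)) (hshift 2)) _
    _ = 2 ^ (α + 2) * C * 3 * ∑' j, v j := by ring
    _ ≤ 2 ^ (α + 2) * C * 3 * ∫⁻ w, ‖f w‖ₑ ^ p ∂areaMeasure α := by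
        gcongr
        exact tsum_shell_le α _
    _ = _ := by rw [lintegral_eq_bergmanNorm hp hα]; ring

/-! ### The binomial series with real exponent -/

/-- The coefficients of `(1 - z) ^ (-β)`. -/
noncomputable def binomCoeff (β : ℝ) (n : ℕ) : ℝ :=
  Real.Gamma (n + β) / (n.factorial * Real.Gamma β)

theorem binomCoeff_pos {β : ℝ} (hβ : 0 < β) (n : ℕ) : 0 < binomCoeff β n := by
  have h1 := Real.Gamma_pos_of_pos hβ
  have h2 : 0 < Real.Gamma (n + β) := Real.Gamma_pos_of_pos (by positivity)
  have h3 : (0 : ℝ) < n.factorial := by exact_mod_cast n.factorial_pos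
  unfold binomCoeff
  positivity

/-- Both sides are the rising factorial of `β` over `n!`; for the Gamma quotient this is the
functional equation, iterated. -/
theorem choose_eq_binomCoeff {β : ℝ} (hβ : 0 < β) (n : ℕ) :
    Ring.choose (β + n - 1 : ℝ) n = binomCoeff β n := by
  have h1 := Ring.factorial_nsmul_multichoose_eq_ascPochhammer β n
  rw [Polynomial.ascPochhammer_smeval_eq_eval, Ring.multichoose_eq] at h1
  have hfac : (n.factorial : ℝ) ≠ 0 := by exact_mod_cast n.factorial_ne_zero
  have hG : ∀ m : ℕ, Real.Gamma (m + β) = (ascPochhammer ℝ m).eval β * Real.Gamma β := by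
    intro m
    induction m with
    | zero => simp
    | succ m ih =>
      have h2 : (m : ℝ) + β ≠ 0 := by positivity
      rw [ascPochhammer_succ_right, Polynomial.eval_mul, Nat.cast_succ,
        show (m : ℝ) + 1 + β = m + β + 1 by ring, Real.Gamma_add_one h2, ih]
      simp
      ring
  have hΓ : Real.Gamma β ≠ 0 := (Real.Gamma_pos_of_pos hβ).ne'
  rw [binomCoeff, hG, ← h1, nsmul_eq_mul]
  field_simp

theorem hasSum_binomCoeff {β : ℝ} (hβ : 0 < β) {w : ℂ} (hw : ‖w‖ < 1) :
    HasSum (fun n => (binomCoeff β n : ℂ) * w ^ n) (1 / (1 - w) ^ (β : ℂ)) := by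
  have h := (Complex.one_div_one_sub_cpow_hasFPowerSeriesOnBall_zero (β : ℂ)).hasSum (y := w)
    (by simpa [enorm_eq_nnnorm, ← NNReal.coe_lt_coe] using hw)
  rw [zero_add] at h
  refine h.congr_fun fun n => ?_
  rw [FormalMultilinearSeries.ofScalars_apply_eq, ← choose_eq_binomCoeff hβ, Complex.ofReal_choose]
  push_cast
  simp

theorem norm_one_div_cpow {β : ℝ} {w : ℂ} (hw : ‖w‖ < 1) :
    ‖1 / (1 - w) ^ (β : ℂ)‖ = ‖1 - w‖ ^ (-β) := by
  have h0 : (1 : ℂ) - w ≠ 0 := by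
    rw [sub_ne_zero]
    rintro rfl
    simp at hw
  rw [norm_div, norm_one, Complex.norm_cpow_of_ne_zero h0]
  simp [Real.rpow_neg]

theorem hasSum_binomCoeff_real {β : ℝ} (hβ : 0 < β) {x : ℝ} (hx0 : 0 ≤ x) (hx : x < 1) :
    HasSum (fun n => binomCoeff β n * x ^ n) ((1 - x) ^ (-β)) := by
  have h := hasSum_binomCoeff hβ (w := x) (by rwa [Complex.norm_real, Real.norm_of_nonneg hx0])
  have h1 : 1 / (1 - (x : ℂ)) ^ (β : ℂ) = (((1 - x) ^ (-β) : ℝ) : ℂ) := by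
    rw [Real.rpow_neg (by linarith), Complex.ofReal_inv, Complex.ofReal_cpow (by linarith)]
    simp
  rw [h1] at h
  exact_mod_cast h

/-! ### Beta integrals and moments -/

/-- Read off from the total mass one of the beta distribution. -/
theorem lintegral_beta {a b : ℝ} (ha : 0 < a) (hb : 0 < b) :
    ∫⁻ x in Ioo (0 : ℝ) 1, ENNReal.ofReal (x ^ (a - 1) * (1 - x) ^ (b - 1)) =
      ENNReal.ofReal (ProbabilityTheory.beta a b) := by
  have h := ProbabilityTheory.lintegral_betaPDF_eq_one ha hb
  have hpos := ProbabilityTheory.beta_pos ha hb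
  rw [ProbabilityTheory.lintegral_betaPDF] at h
  have h1 : ∀ x : ℝ, ENNReal.ofReal (1 / ProbabilityTheory.beta a b * x ^ (a - 1) *
      (1 - x) ^ (b - 1)) = ENNReal.ofReal (1 / ProbabilityTheory.beta a b) *
      ENNReal.ofReal (x ^ (a - 1) * (1 - x) ^ (b - 1)) := fun x => by
    rw [← ENNReal.ofReal_mul (by positivity), mul_assoc]
  simp_rw [h1] at h
  rw [lintegral_const_mul' _ _ (by finiteness), one_div, ENNReal.ofReal_inv_of_pos hpos] at h
  have h2 := congrArg (fun y => ENNReal.ofReal (ProbabilityTheory.beta a b) * y) h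
  simp only [← mul_assoc, mul_one] at h2
  rwa [ENNReal.mul_inv_cancel (by simpa using hpos) (by finiteness), one_mul] at h2

/-- The substitution `x = ρ ^ 2` brings the beta integral into the form met in polar coordinates
with weight `1 - ρ ^ 2`. -/
theorem lintegral_beta_sq (k : ℕ) {b : ℝ} (hb : 0 < b) :
    ∫⁻ ρ in Ioo (0 : ℝ) 1, ENNReal.ofReal (2 * ρ) *
        ENNReal.ofReal ((ρ ^ 2) ^ k * (1 - ρ ^ 2) ^ (b - 1)) =
      ENNReal.ofReal (ProbabilityTheory.beta (k + 1) b) := by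
  rw [← lintegral_beta (by positivity) hb]
  have himg : (fun x : ℝ => x ^ 2) '' Ioo 0 1 = Ioo 0 1 := by
    ext y
    constructor
    · rintro ⟨x, hx, rfl⟩
      exact ⟨by have := hx.1; positivity, by nlinarith [hx.1, hx.2]⟩
    · intro hy
      refine ⟨√y, ⟨Real.sqrt_pos.2 hy.1, ?_⟩, Real.sq_sqrt hy.1.le⟩
      rw [Real.sqrt_lt' one_pos]
      simpa using hy.2
  have h := lintegral_image_eq_lintegral_abs_deriv_mul (s := Ioo (0 : ℝ) 1)
    (f := fun x : ℝ => x ^ 2) (f' := fun x => 2 * x) measurableSet_Ioo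
    (fun x _ => by simpa using (hasDerivAt_pow 2 x).hasDerivWithinAt)
    (fun x hx y hy hxy => by
      have : x ^ 2 = y ^ 2 := hxy
      exact (sq_eq_sq₀ hx.1.le hy.1.le).1 this)
    (fun x => ENNReal.ofReal (x ^ ((k : ℝ) + 1 - 1) * (1 - x) ^ (b - 1)))
  rw [himg] at h
  rw [h]
  refine setLIntegral_congr_fun measurableSet_Ioo fun x hx => ?_
  simp only [add_sub_cancel_right, Real.rpow_natCast]
  rw [abs_of_pos (by linarith [hx.1])]

theorem measure_univ_eq_tail (μ : Measure (Ico (0 : ℝ) 1)) : μ univ = tail μ 0 := by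
  rw [tail]
  congr 1
  ext x
  simpa using x.2.1

theorem IsCarleson.isFiniteMeasure {μ : Measure (Ico (0 : ℝ) 1)} {s : ℝ} (h : IsCarleson μ s) :
    IsFiniteMeasure μ := by
  obtain ⟨C, _, h⟩ := h
  refine ⟨?_⟩
  rw [measure_univ_eq_tail]
  exact (h 0 ⟨le_rfl, one_pos⟩).trans_lt ENNReal.ofReal_lt_top

/-- The moments of a Carleson measure are dominated by beta integrals. -/
theorem lintegral_pow_le {μ : Measure (Ico (0 : ℝ) 1)} {s C : ℝ} (hs : 0 < s) (hC : 0 < C)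
    (h : ∀ t ∈ Ico (0 : ℝ) 1, tail μ t ≤ ENNReal.ofReal (C * (1 - t) ^ s)) (k : ℕ) :
    ∫⁻ t, ENNReal.ofReal ((t : ℝ) ^ k) ∂μ ≤
      ENNReal.ofReal (C * s * ProbabilityTheory.beta (k + 1) s) := by
  have hΓ : Real.Gamma s ≠ 0 := (Real.Gamma_pos_of_pos hs).ne'
  -- The layer-cake formula carries the weight `k u ^ (k - 1)` and needs `k > 0`; the zeroth moment
  -- is the tail at `0`.
  rcases Nat.eq_zero_or_pos k with rfl | hk
  · have h1 := h 0 ⟨le_rfl, one_pos⟩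
    rw [← measure_univ_eq_tail, sub_zero, Real.one_rpow, mul_one] at h1
    have h2 : s * ProbabilityTheory.beta ((0 : ℕ) + 1) s = 1 := by
      rw [ProbabilityTheory.beta, Nat.cast_zero, zero_add, Real.Gamma_one, one_mul, add_comm,
        Real.Gamma_add_one hs.ne']
      field_simp
    rw [mul_assoc, h2, mul_one]
    simpa using h1
  · have hk' : (0 : ℝ) < k := by exact_mod_cast hk
    have h1 := lintegral_rpow_eq_lintegral_meas_le_mul μ (f := fun t : Ico (0 : ℝ) 1 => (t : ℝ))
      (Eventually.of_forall fun t => t.2.1) (by fun_prop) hk'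
    simp only [Real.rpow_natCast] at h1
    rw [h1]
    have h2 : ∫⁻ u in Ioi (0 : ℝ), μ {a | u ≤ (a : ℝ)} * ENNReal.ofReal (u ^ ((k : ℝ) - 1)) ≤
        ∫⁻ u in Ioo (0 : ℝ) 1, ENNReal.ofReal C *
          ENNReal.ofReal (u ^ ((k : ℝ) - 1) * (1 - u) ^ (s + 1 - 1)) := by
      rw [← lintegral_indicator measurableSet_Ioi, ← lintegral_indicator measurableSet_Ioo]
      refine lintegral_mono fun u => ?_
      by_cases hu0 : 0 < u
      · rw [indicator_of_mem (by exact hu0)]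
        by_cases hu1 : u < 1
        · rw [indicator_of_mem (by exact ⟨hu0, hu1⟩), ← ENNReal.ofReal_mul hC.le,
            add_sub_cancel_right]
          refine (mul_le_mul_left (h u ⟨hu0.le, hu1⟩) _).trans_eq ?_
          have : 0 ≤ (1 - u) ^ s := Real.rpow_nonneg (by linarith) _
          rw [← ENNReal.ofReal_mul (by positivity)]
          congr 1
          ring
        · have : {a : Ico (0 : ℝ) 1 | u ≤ (a : ℝ)} = ∅ := by
            ext a
            simpa using a.2.2.trans_le (not_lt.1 hu1)
          rw [this]
          simp
      · rw [indicator_of_notMem (by simpa using hu0)]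
        exact zero_le
    rw [lintegral_const_mul' _ _ (by finiteness), lintegral_beta hk' (by linarith)] at h2
    refine (mul_le_mul_right h2 _).trans_eq ?_
    rw [← ENNReal.ofReal_mul hC.le, ← ENNReal.ofReal_mul hk'.le]
    congr 1
    rw [ProbabilityTheory.beta, ProbabilityTheory.beta, Real.Gamma_add_one hs.ne',
      Real.Gamma_add_one hk'.ne', show (k : ℝ) + (s + 1) = k + 1 + s by ring]
    ring

/-! ### Hardy's inequality in the Bergman space `A¹` -/

/-- Hardy's inequality: the Taylor coefficients of a function of the Bergman space `A¹` are
summable against beta weights. -/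
theorem tsum_taylorCoeff_beta_le {γ : ℝ} (hγ : -1 < γ) {f : ℂ → ℂ}
    (hf : DifferentiableOn ℂ f disc) :
    ∑' k : ℕ, ‖taylorCoeff f k‖ₑ * ENNReal.ofReal (ProbabilityTheory.beta (k + 1) (γ + 2)) ≤
      4 * ∫⁻ z, ‖f z‖ₑ ∂areaMeasure γ := by
  have hpi := Real.pi_gt_three
  set M : ℝ → ℝ≥0∞ := fun ρ => ∫⁻ θ in Ioo (-Real.pi) Real.pi, ‖f (circleMap 0 ρ θ)‖ₑ with hM
  have hcoef : ∀ k, ∀ ρ ∈ Ioo (0 : ℝ) 1, ‖taylorCoeff f k‖ₑ * ENNReal.ofReal ρ ^ k ≤ M ρ :=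
    fun k ρ hρ => by
      refine le_trans ?_ (enorm_taylorCoeff_mul_le hρ.1
        (hf.mono (Metric.closedBall_subset_ball hρ.2)) k)
      nth_rewrite 1 [← one_mul (‖taylorCoeff f k‖ₑ * _)]
      gcongr
      rw [← ENNReal.ofReal_one]
      exact ENNReal.ofReal_le_ofReal (by linarith)
  have hpolar : ∫⁻ z, ‖f z‖ₑ ∂areaMeasure γ =
      ∫⁻ ρ in Ioo (0 : ℝ) 1, ENNReal.ofReal ρ * (ENNReal.ofReal ((1 - ρ ^ 2) ^ γ) * M ρ) := by
    rw [lintegral_areaMeasure, disc, lintegral_ball_eq_polar]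
    · refine setLIntegral_congr_fun measurableSet_Ioo fun ρ hρ => ?_
      have hn : ∀ θ, ‖circleMap 0 ρ θ‖ = ρ := fun θ => by simp [abs_of_pos hρ.1]
      simp only [hn]
      rw [lintegral_const_mul' _ _ (by finiteness)]
    · have h1 := measurable_indicator_of_continuousOn isOpen_disc hf.continuousOn.enorm
      have h2 := (measurable_weight γ).mul h1
      convert h2 using 1
      ext z
      simp only [Pi.mul_apply, disc, indicator]
      split_ifs <;> simp
  -- The beta integral contains `ρ ^ (2 k)`. One factor `ρ ^ k` turns the coefficient into the
  -- circle mean `M ρ`; the other is summed as a geometric series, whose `1 / (1 - ρ)` is paid for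
  -- by one power of the weight.
  calc ∑' k : ℕ, ‖taylorCoeff f k‖ₑ * ENNReal.ofReal (ProbabilityTheory.beta (k + 1) (γ + 2))
      = ∑' k : ℕ, ∫⁻ ρ in Ioo (0 : ℝ) 1, ‖taylorCoeff f k‖ₑ * (ENNReal.ofReal (2 * ρ) *
        ENNReal.ofReal ((ρ ^ 2) ^ k * (1 - ρ ^ 2) ^ (γ + 2 - 1))) := by
        refine tsum_congr fun k => ?_
        rw [lintegral_const_mul' _ _ (by finiteness), lintegral_beta_sq k (by linarith)]
    _ = ∫⁻ ρ in Ioo (0 : ℝ) 1, ∑' k : ℕ, ‖taylorCoeff f k‖ₑ * (ENNReal.ofReal (2 * ρ) *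
        ENNReal.ofReal ((ρ ^ 2) ^ k * (1 - ρ ^ 2) ^ (γ + 2 - 1))) := by
        rw [lintegral_tsum]
        intro k
        fun_prop
    _ ≤ ∫⁻ ρ in Ioo (0 : ℝ) 1,
          4 * (ENNReal.ofReal ρ * (ENNReal.ofReal ((1 - ρ ^ 2) ^ γ) * M ρ)) := by
        refine setLIntegral_mono' measurableSet_Ioo fun ρ hρ => ?_
        have h0 : 0 < 1 - ρ := by linarith [hρ.2]
        have h1 : 0 < 1 - ρ ^ 2 := by nlinarith [hρ.1, hρ.2]
        have hw : 0 ≤ (1 - ρ ^ 2) ^ (γ + 1) := Real.rpow_nonneg h1.le _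
        calc ∑' k : ℕ, ‖taylorCoeff f k‖ₑ * (ENNReal.ofReal (2 * ρ) *
              ENNReal.ofReal ((ρ ^ 2) ^ k * (1 - ρ ^ 2) ^ (γ + 2 - 1)))
            ≤ ∑' k : ℕ, (M ρ * (ENNReal.ofReal (2 * ρ) *
              ENNReal.ofReal ((1 - ρ ^ 2) ^ (γ + 1)))) * ENNReal.ofReal ρ ^ k := by
              refine ENNReal.tsum_le_tsum fun k => ?_
              have hρ0 := hρ.1
              have he : ENNReal.ofReal ((ρ ^ 2) ^ k * (1 - ρ ^ 2) ^ (γ + 1)) =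
                  ENNReal.ofReal (ρ ^ k) * ENNReal.ofReal (ρ ^ k) *
                    ENNReal.ofReal ((1 - ρ ^ 2) ^ (γ + 1)) := by
                rw [← ENNReal.ofReal_mul (by positivity), ← ENNReal.ofReal_mul (by positivity)]
                ring_nf
              rw [show γ + 2 - 1 = γ + 1 by ring, he, ← ENNReal.ofReal_pow hρ.1.le]
              have h2 := hcoef k ρ hρ
              rw [← ENNReal.ofReal_pow hρ.1.le] at h2
              calc _ = (‖taylorCoeff f k‖ₑ * ENNReal.ofReal (ρ ^ k)) *
                    (ENNReal.ofReal (2 * ρ) * ENNReal.ofReal ((1 - ρ ^ 2) ^ (γ + 1))) *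
                    ENNReal.ofReal (ρ ^ k) := by ring
                _ ≤ _ := mul_le_mul_left (mul_le_mul_left h2 _) _
          _ = M ρ * (ENNReal.ofReal (2 * ρ) * ENNReal.ofReal ((1 - ρ ^ 2) ^ (γ + 1)) *
                ENNReal.ofReal ((1 - ρ)⁻¹)) := by
              rw [ENNReal.tsum_mul_left, ENNReal.tsum_geometric, ENNReal.ofReal_inv_of_pos h0,
                ENNReal.ofReal_sub _ hρ.1.le, ENNReal.ofReal_one]
              ring
          _ ≤ M ρ * (4 * (ENNReal.ofReal ρ * ENNReal.ofReal ((1 - ρ ^ 2) ^ γ))) := by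
              refine mul_le_mul_right ?_ _
              rw [show (4 : ℝ≥0∞) = ENNReal.ofReal 4 by simp, ← ENNReal.ofReal_mul hρ.1.le,
                ← ENNReal.ofReal_mul (p := 4) (by norm_num),
                ← ENNReal.ofReal_mul (p := 2 * ρ) (by linarith [hρ.1]),
                ← ENNReal.ofReal_mul (mul_nonneg (by linarith [hρ.1]) hw)]
              apply ENNReal.ofReal_le_ofReal
              rw [Real.rpow_add_one h1.ne']
              have h3 : 0 ≤ (1 - ρ ^ 2) ^ γ := Real.rpow_nonneg h1.le _
              have h4 : (1 - ρ ^ 2) * (1 - ρ)⁻¹ = 1 + ρ := by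
                field_simp
                ring
              calc 2 * ρ * ((1 - ρ ^ 2) ^ γ * (1 - ρ ^ 2)) * (1 - ρ)⁻¹
                  = 2 * (ρ * (1 - ρ ^ 2) ^ γ) * ((1 - ρ ^ 2) * (1 - ρ)⁻¹) := by ring
                _ ≤ 2 * (ρ * (1 - ρ ^ 2) ^ γ) * 2 := by
                    rw [h4]
                    have := hρ.1
                    gcongr
                    linarith [hρ.2]
                _ = _ := by ring
          _ = _ := by ring
    _ = _ := by rw [lintegral_const_mul' _ _ (by finiteness), hpolar]

/-- For `p ≤ 1` the space `A^p_α` is contained in `A^1_γ`, where `γ + 2 = (α + 2) / p`. -/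
theorem lintegral_enorm_ne_top_of_mem {p α : ℝ} (hp : 0 < p) (hp1 : p ≤ 1) (hα : -1 < α)
    {f : ℂ → ℂ} (hf : f ∈ bergmanSpace p α) :
    ∫⁻ z, ‖f z‖ₑ ∂areaMeasure ((α + 2) / p - 2) ≠ ∞ := by
  obtain ⟨C, hC, h⟩ := exists_pointwise hp hα
  set s := (α + 2) / p with hs
  have hs0 : 0 < s := div_pos (by linarith) hp
  have hfin : ∫⁻ z, ‖f z‖ₑ ^ p ∂areaMeasure α ≠ ∞ := by
    rw [lintegral_eq_bergmanNorm hp hα]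
    exact ENNReal.mul_ne_top (ENNReal.inv_ne_top.2 (normalizer_ne_zero hα))
      (ENNReal.rpow_ne_top_of_nonneg hp.le hf.2.ne)
  set K : ℝ≥0∞ := ENNReal.ofReal (2 ^ s) * (C * bergmanNorm p α f) with hK
  have hKt : K ≠ ∞ := by
    have := hf.2.ne
    finiteness
  have hp1' : 0 ≤ 1 - p := by linarith
  refine ne_top_of_le_ne_top (ENNReal.mul_ne_top
    (ENNReal.rpow_ne_top_of_nonneg hp1' hKt) hfin) ?_
  rw [lintegral_areaMeasure, lintegral_areaMeasure, ← lintegral_const_mul' _ _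
    (ENNReal.rpow_ne_top_of_nonneg hp1' hKt)]
  refine setLIntegral_mono' isOpen_disc.measurableSet fun z hz => ?_
  have hz1 := mem_disc.1 hz
  have hz0 := norm_nonneg z
  set x := 1 - ‖z‖ ^ 2 with hx
  have hx0 : 0 < x := by nlinarith
  have h1 : ‖f z‖ₑ * ENNReal.ofReal (x ^ s) ≤ K := by
    calc ‖f z‖ₑ * ENNReal.ofReal (x ^ s)
        ≤ ‖f z‖ₑ * ENNReal.ofReal (2 ^ s * (1 - ‖z‖) ^ s) := by
          gcongr
          rw [← Real.mul_rpow two_pos.le (by linarith)]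
          exact Real.rpow_le_rpow hx0.le (by nlinarith) hs0.le
      _ = ENNReal.ofReal (2 ^ s) * (‖f z‖ₑ * ENNReal.ofReal ((1 - ‖z‖) ^ s)) := by
          rw [ENNReal.ofReal_mul (by positivity)]
          ring
      _ ≤ K := by
          exact mul_le_mul_right (h f hf.1 z hz) _
  -- Since `s p = α + 2`, the weight splits exactly as needed for `|f| = |f| ^ p |f| ^ (1 - p)`: the
  -- factor `|f| ^ (1 - p)` takes `x ^ (s (1 - p))` and is bounded by pointwise growth.
  have h2 : x ^ (s - 2) = x ^ α * (x ^ s) ^ (1 - p) := by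
    rw [← Real.rpow_mul hx0.le, ← Real.rpow_add hx0]
    congr 1
    have : s * p = α + 2 := by rw [hs]; field_simp
    linarith
  rw [h2, ENNReal.ofReal_mul (by positivity), ← ENNReal.ofReal_rpow_of_nonneg (by positivity) hp1']
  have h3 : ‖f z‖ₑ = ‖f z‖ₑ ^ p * ‖f z‖ₑ ^ (1 - p) := by
    rw [← ENNReal.rpow_add_of_nonneg _ _ hp.le hp1']
    simp
  calc ENNReal.ofReal (x ^ α) * ENNReal.ofReal (x ^ s) ^ (1 - p) * ‖f z‖ₑ
      = (‖f z‖ₑ * ENNReal.ofReal (x ^ s)) ^ (1 - p) * (ENNReal.ofReal (x ^ α) * ‖f z‖ₑ ^ p) := by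
        nth_rewrite 1 [h3]
        rw [ENNReal.mul_rpow_of_nonneg _ _ hp1']
        ring
    _ ≤ _ := by gcongr

/-! ### Partial sums of the Taylor series along the radius -/

theorem norm_geom_sum_le {w : ℂ} (hw : ‖w‖ < 1) {d : ℝ} (hd : 0 < d) (hdw : d ≤ ‖1 - w‖) (N : ℕ) :
    ‖∑ k ∈ Finset.range N, w ^ k‖ ≤ 2 / d := by
  have h := congrArg norm (mul_neg_geom_sum w N)
  rw [norm_mul] at h
  have h1 : ‖1 - w ^ N‖ ≤ 2 := by
    calc ‖1 - w ^ N‖ ≤ ‖(1 : ℂ)‖ + ‖w ^ N‖ := norm_sub_le _ _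
      _ ≤ 1 + 1 := by
          rw [norm_one, norm_pow]
          gcongr
          exact pow_le_one₀ (norm_nonneg _) hw.le
      _ = 2 := by norm_num
  rw [le_div_iff₀ hd, mul_comm]
  calc d * ‖∑ k ∈ Finset.range N, w ^ k‖ ≤ ‖1 - w‖ * ‖∑ k ∈ Finset.range N, w ^ k‖ := by gcongr
    _ ≤ 2 := by rw [h]; exact h1

/-- Cauchy's formula is applied to all terms together, so that the geometric kernel is summed before
absolute values are taken and its cancellation survives. -/
theorem norm_partialSum_le_lintegral {f : ℂ → ℂ} (hf : DifferentiableOn ℂ f disc) {ρ : ℝ}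
    (hρ0 : 0 < ρ) (hρ1 : ρ < 1) (t : ℂ) (N : ℕ) :
    ENNReal.ofReal (2 * Real.pi * ‖∑ k ∈ Finset.range N, taylorCoeff f k * t ^ k‖) ≤
      ∫⁻ θ in Ioo (-Real.pi) Real.pi, ENNReal.ofReal
        (‖∑ k ∈ Finset.range N, (t / circleMap 0 ρ θ) ^ k‖ * ‖f (circleMap 0 ρ θ)‖) := by
  have hsub : Metric.closedBall (0 : ℂ) ρ ⊆ disc := Metric.closedBall_subset_ball hρ1
  have hne : ∀ z ∈ Metric.sphere (0 : ℂ) ρ, z ≠ 0 := fun z hz => by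
    rintro rfl
    simp [hρ0.ne] at hz
  have hcf : ContinuousOn f (Metric.sphere 0 ρ) :=
    hf.continuousOn.mono (Metric.sphere_subset_closedBall.trans hsub)
  have hcd : ∀ k : ℕ, ContinuousOn (fun z : ℂ => (t / z) ^ k) (Metric.sphere 0 ρ) := fun k =>
    ((continuousOn_const.div continuousOn_id) hne).pow k
  have hci : ContinuousOn (fun z : ℂ => z⁻¹) (Metric.sphere 0 ρ) := continuousOn_inv₀.mono hne
  have hsum : ∑ k ∈ Finset.range N, taylorCoeff f k * t ^ k = (2 * Real.pi * Complex.I : ℂ)⁻¹ •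
      ∮ z in C(0, ρ), ∑ k ∈ Finset.range N, (t / z) ^ k • z⁻¹ • f z := by
    rw [circleIntegral.integral_fun_sum, Finset.smul_sum]
    · refine Finset.sum_congr rfl fun k _ => ?_
      rw [← cauchyPowerSeries_apply_eq hρ0 (hf.mono hsub), cauchyPowerSeries_apply]
      simp only [sub_zero]
    · exact fun k _ => ((hcd k).smul (hci.smul hcf)).circleIntegrable hρ0.le
  have hbound : 2 * Real.pi * ‖∑ k ∈ Finset.range N, taylorCoeff f k * t ^ k‖ ≤
      ∫ θ in (0 : ℝ)..2 * Real.pi,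
        ‖∑ k ∈ Finset.range N, (t / circleMap 0 ρ θ) ^ k‖ * ‖f (circleMap 0 ρ θ)‖ := by
    have hpi := Real.pi_pos
    rw [hsum, norm_smul]
    have h1 : ‖(2 * Real.pi * Complex.I : ℂ)⁻¹‖ = (2 * Real.pi)⁻¹ := by
      simp [abs_of_pos hpi]
    rw [h1, mul_inv_cancel_left₀ (by positivity), circleIntegral]
    refine (intervalIntegral.norm_integral_le_integral_norm (by positivity)).trans_eq ?_
    refine intervalIntegral.integral_congr fun θ _ => ?_
    have h2 : ‖circleMap 0 ρ θ‖ = ρ := by simp [abs_of_pos hρ0]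
    simp only [← Finset.sum_smul, norm_smul, deriv_circleMap, norm_mul, Complex.norm_I, norm_inv,
      h2, mul_one]
    field_simp
  refine (ENNReal.ofReal_le_ofReal hbound).trans_eq ?_
  refine lintegral_circle_eq (fun z => ‖∑ k ∈ Finset.range N, (t / z) ^ k‖ * ‖f z‖)
    (fun z => by positivity) ?_
  rw [abs_of_pos hρ0]
  exact (continuousOn_finsetSum _ fun k _ => hcd k).norm.mul hcf.norm

theorem exists_lintegral_abs_rpow {δ : ℝ} (hδ : 0 < δ) :
    ∃ A : ℝ, 0 ≤ A ∧
      ∫⁻ θ in Ioo (-Real.pi) Real.pi, ENNReal.ofReal ((|θ| / Real.pi) ^ (δ - 1)) =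
        ENNReal.ofReal A := by
  have hint : LocallyIntegrable (fun θ : ℝ => (|θ| / Real.pi) ^ (δ - 1)) volume := by
    refine locallyIntegrable_of_norm_le_rpow (C := (Real.pi)⁻¹ ^ (δ - 1)) (α := 1 - δ) (by simp)
      (by simpa using hδ) (Eventually.of_forall fun x => ?_)
      (Measurable.aestronglyMeasurable (by fun_prop))
    have hpi := Real.pi_pos
    rw [Real.norm_of_nonneg (by positivity), div_eq_mul_inv,
      Real.mul_rpow (abs_nonneg _) (by positivity), mul_comm, neg_sub, Real.norm_eq_abs]
  have h2 := (hint.integrableOn_isCompact (isCompact_Icc (a := -Real.pi) (b := Real.pi))).mono_set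
    Ioo_subset_Icc_self
  refine ⟨_, integral_nonneg fun θ => ?_, (ofReal_integral_eq_lintegral_ofReal h2 ?_).symm⟩
  · have := Real.pi_pos
    show (0 : ℝ) ≤ (|θ| / Real.pi) ^ (δ - 1)
    positivity
  · refine Eventually.of_forall fun θ => ?_
    have := Real.pi_pos
    show (0 : ℝ) ≤ (|θ| / Real.pi) ^ (δ - 1)
    positivity

/-- On the circle of radius `(1 + t) / 2` the geometric kernel is at most `2 / |1 - w|`, uniformly
in `N`. Both `(1 - t) / 2` and `|θ| / π` are lower bounds for `|1 - w|`; interpolating them with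
exponents `δ` and `1 - δ` leaves an integrable singularity in `θ` and loses only `(1 - t) ^ (-δ)`.
-/
theorem exists_norm_partialSum_le {f : ℂ → ℂ} (hf : DifferentiableOn ℂ f disc) {K s δ : ℝ}
    (hδ : 0 < δ) (hδ1 : δ < 1) (hK : ∀ z ∈ disc, ‖f z‖ * (1 - ‖z‖) ^ s ≤ K) :
    ∃ C : ℝ, 0 ≤ C ∧ ∀ N : ℕ, ∀ t ∈ Ico (0 : ℝ) 1,
      ‖∑ k ∈ Finset.range N, taylorCoeff f k * (t : ℂ) ^ k‖ ≤ C * (1 - t) ^ (-(s + δ)) := by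
  obtain ⟨A, hA0, hA⟩ := exists_lintegral_abs_rpow hδ
  have hpi := Real.pi_pos
  have hK0 : 0 ≤ K := by
    have := hK 0 (by simp [mem_disc])
    simp only [norm_zero, sub_zero, Real.one_rpow, mul_one] at this
    exact (norm_nonneg _).trans this
  set L : ℝ := 2 * (1 / 2) ^ (-(s + δ)) * K with hL
  have hL0 : 0 ≤ L := by positivity
  refine ⟨(2 * Real.pi)⁻¹ * (L * A), by positivity, fun N t ht => ?_⟩
  obtain ⟨ht0, ht1⟩ := ht
  set ρ := (1 + t) / 2 with hρ
  have hρ0 : 0 < ρ := by linarith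
  have hρ1 : ρ < 1 := by linarith
  have hx : 0 < 1 - t := by linarith
  have hE : 0 ≤ (1 - t) ^ (-(s + δ)) := Real.rpow_nonneg hx.le _
  have hr0 : 0 ≤ t / ρ := div_nonneg ht0 hρ0.le
  have hr : (1 - t) / 2 ≤ 1 - t / ρ := by
    rw [le_sub_comm, div_le_iff₀ hρ0]
    nlinarith
  have hr1 : t / ρ < 1 := by linarith
  have h := norm_partialSum_le_lintegral hf hρ0 hρ1 t N
  have hle : ∫⁻ θ in Ioo (-Real.pi) Real.pi, ENNReal.ofReal
        (‖∑ k ∈ Finset.range N, ((t : ℂ) / circleMap 0 ρ θ) ^ k‖ * ‖f (circleMap 0 ρ θ)‖) ≤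
      ∫⁻ θ in Ioo (-Real.pi) Real.pi, ENNReal.ofReal (L * (1 - t) ^ (-(s + δ))) *
        ENNReal.ofReal ((|θ| / Real.pi) ^ (δ - 1)) := by
    refine lintegral_mono_ae ?_
    -- At `θ = 0` the negative power on the right has the default value `0`, and the pointwise bound
    -- can fail.
    have hne : ∀ᵐ θ : ℝ ∂volume.restrict (Ioo (-Real.pi) Real.pi), θ ≠ 0 :=
      ae_restrict_of_ae (Measure.ae_ne volume 0)
    filter_upwards [ae_restrict_mem measurableSet_Ioo, hne] with θ hθ hθ0
    have hθ' : |θ| ≤ Real.pi := abs_le.2 ⟨hθ.1.le, hθ.2.le⟩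
    have hθpos : 0 < |θ| / Real.pi := by positivity
    have hw : (t : ℂ) / circleMap 0 ρ θ = circleMap 0 (t / ρ) (-θ) := by
      simp only [circleMap, zero_add, Complex.ofReal_div, Complex.ofReal_neg, neg_mul,
        Complex.exp_neg]
      field_simp
    have hwn : ‖circleMap 0 (t / ρ) (-θ)‖ = t / ρ := by simpa using hr0
    have h1 : (1 - t) / 2 ≤ ‖1 - circleMap 0 (t / ρ) (-θ)‖ := by
      have := norm_sub_norm_le 1 (circleMap 0 (t / ρ) (-θ))
      rw [hwn, norm_one] at this
      linarith
    have h2 : |θ| / Real.pi ≤ ‖1 - circleMap 0 (t / ρ) (-θ)‖ := by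
      have := abs_le_pi_mul_norm_one_sub_circleMap hr0 hr1.le (θ := -θ) (by rwa [abs_neg])
      rw [abs_neg] at this
      rwa [div_le_iff₀ hpi, mul_comm]
    have h3 : ((1 - t) / 2) ^ δ * (|θ| / Real.pi) ^ (1 - δ) ≤
        ‖1 - circleMap 0 (t / ρ) (-θ)‖ := by
      set y := ‖1 - circleMap 0 (t / ρ) (-θ)‖ with hy
      have hy0 : 0 < y := hθpos.trans_le h2
      calc ((1 - t) / 2) ^ δ * (|θ| / Real.pi) ^ (1 - δ) ≤ y ^ δ * y ^ (1 - δ) := by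
            gcongr
        _ = y := by rw [← Real.rpow_add hy0]; simp
    have h4 := norm_geom_sum_le (w := circleMap 0 (t / ρ) (-θ)) (by rwa [hwn])
      (mul_pos (Real.rpow_pos_of_pos (by linarith) _) (Real.rpow_pos_of_pos hθpos _)) h3 N
    have h5 : ‖f (circleMap 0 ρ θ)‖ ≤ K * ((1 - t) / 2) ^ (-s) := by
      have hn : ‖circleMap 0 ρ θ‖ = ρ := by simp [abs_of_pos hρ0]
      have := hK (circleMap 0 ρ θ) (mem_disc.2 (by rw [hn]; exact hρ1))
      rw [hn, show 1 - ρ = (1 - t) / 2 by rw [hρ]; ring] at this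
      rwa [Real.rpow_neg (by linarith), ← div_eq_mul_inv, le_div_iff₀ (Real.rpow_pos_of_pos
        (by linarith) _)]
    rw [← ENNReal.ofReal_mul (by positivity), hw]
    refine ENNReal.ofReal_le_ofReal ((mul_le_mul h4 h5 (norm_nonneg _) (by positivity)).trans_eq ?_)
    have h6 : (|θ| / Real.pi) ^ (δ - 1) = ((|θ| / Real.pi) ^ (1 - δ))⁻¹ := by
      rw [← Real.rpow_neg hθpos.le, neg_sub]
    have h7 : (1 / 2 : ℝ) ^ (-(s + δ)) * (1 - t) ^ (-(s + δ)) =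
        (((1 - t) / 2) ^ δ)⁻¹ * ((1 - t) / 2) ^ (-s) := by
      rw [← Real.mul_rpow (by norm_num) hx.le, show 1 / 2 * (1 - t) = (1 - t) / 2 by ring,
        ← Real.rpow_neg (by linarith), ← Real.rpow_add (by linarith)]
      congr 1
      ring
    rw [h6, hL]
    calc 2 / (((1 - t) / 2) ^ δ * (|θ| / Real.pi) ^ (1 - δ)) * (K * ((1 - t) / 2) ^ (-s))
        = 2 * ((((1 - t) / 2) ^ δ)⁻¹ * ((1 - t) / 2) ^ (-s)) * K *
            ((|θ| / Real.pi) ^ (1 - δ))⁻¹ := by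
          rw [div_eq_mul_inv, mul_inv]
          ring
      _ = _ := by
          rw [← h7]
          ring
  rw [lintegral_const_mul' _ _ (by finiteness), hA, ← ENNReal.ofReal_mul (by positivity)] at hle
  have h8 := (ENNReal.ofReal_le_ofReal_iff (by positivity)).1 (h.trans hle)
  calc ‖∑ k ∈ Finset.range N, taylorCoeff f k * (t : ℂ) ^ k‖
      = (2 * Real.pi)⁻¹ * (2 * Real.pi * ‖∑ k ∈ Finset.range N, taylorCoeff f k * (t : ℂ) ^ k‖) := by
        field_simp
    _ ≤ (2 * Real.pi)⁻¹ * (L * (1 - t) ^ (-(s + δ)) * A) := by gcongr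
    _ = _ := by ring

/-! ### Power series in the disc -/

theorem hasFPowerSeriesOnBall_of_hasSum {c : ℕ → ℂ} {g : ℂ → ℂ}
    (h : ∀ z ∈ disc, HasSum (fun n => c n * z ^ n) (g z)) :
    HasFPowerSeriesOnBall g (FormalMultilinearSeries.ofScalars ℂ c) 0 1 where
  r_le := by
    refine ENNReal.le_of_forall_nnreal_lt fun r hr => ?_
    have hr1 : (r : ℝ) < 1 := by exact_mod_cast hr
    refine FormalMultilinearSeries.le_radius_of_tendsto _ (l := 0) ?_
    have h1 := (h (r : ℝ) (ofReal_mem_disc r.2 hr1)).summable.tendsto_atTop_zero.norm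
    simpa [FormalMultilinearSeries.ofScalars_norm] using h1
  r_pos := one_pos
  hasSum := fun {y} hy => by
    have hy' : y ∈ disc := by
      rw [mem_disc]
      simpa [enorm_eq_nnnorm, ← NNReal.coe_lt_coe] using hy
    rw [zero_add]
    refine (h y hy').congr_fun fun n => ?_
    simp [mul_comm]

theorem differentiableOn_of_hasSum {c : ℕ → ℂ} {g : ℂ → ℂ}
    (h : ∀ z ∈ disc, HasSum (fun n => c n * z ^ n) (g z)) : DifferentiableOn ℂ g disc := by
  have := (hasFPowerSeriesOnBall_of_hasSum h).differentiableOn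
  rw [show (1 : ℝ≥0∞) = ENNReal.ofReal 1 by simp, Metric.eball_ofReal] at this
  exact this

theorem taylorCoeff_of_hasSum {c : ℕ → ℂ} {g : ℂ → ℂ}
    (h : ∀ z ∈ disc, HasSum (fun n => c n * z ^ n) (g z)) (n : ℕ) : taylorCoeff g n = c n := by
  have h1 := (hasFPowerSeriesOnBall_of_hasSum h).factorial_smul 1 n
  rw [← iteratedDeriv_eq_iteratedFDeriv] at h1
  have h2 : (n.factorial : ℂ) ≠ 0 := by exact_mod_cast n.factorial_ne_zero
  rw [taylorCoeff, ← h1, nsmul_eq_mul, mul_div_cancel_left₀ _ h2]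
  simp

theorem taylorCoeff_sub {f g : ℂ → ℂ} (hf : DifferentiableOn ℂ f disc)
    (hg : DifferentiableOn ℂ g disc) (n : ℕ) :
    taylorCoeff (f - g) n = taylorCoeff f n - taylorCoeff g n := by
  refine taylorCoeff_of_hasSum (c := fun n => taylorCoeff f n - taylorCoeff g n) (fun z hz => ?_) n
  simp only [sub_mul]
  exact (hasSum_taylorCoeff hf hz).sub (hasSum_taylorCoeff hg hz)

/-! ### The generalized Hilbert operator as an integral operator -/

theorem continuous_radial {f : ℂ → ℂ} (hf : ContinuousOn f disc) :
    Continuous fun t : Ico (0 : ℝ) 1 => f ((t : ℝ) : ℂ) :=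
  hf.comp_continuous (by fun_prop) fun t => ofReal_mem_disc t.2.1 t.2.2

/-- The integral representation of the generalized Hilbert operator. -/
noncomputable def hilbertFun (μ : Measure (Ico (0 : ℝ) 1)) (β : ℝ) (f : ℂ → ℂ) (z : ℂ) : ℂ :=
  ∫ t : Ico (0 : ℝ) 1, f ((t : ℝ) : ℂ) * (1 / (1 - ((t : ℝ) : ℂ) * z) ^ (β : ℂ)) ∂μ

/-- The Taylor coefficients of `hilbertFun`. -/
noncomputable def hilbertCoeff (μ : Measure (Ico (0 : ℝ) 1)) (β : ℝ) (f : ℂ → ℂ) (n : ℕ) : ℂ :=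
  ∫ t : Ico (0 : ℝ) 1, (binomCoeff β n : ℂ) * ((t : ℝ) : ℂ) ^ n * f ((t : ℝ) : ℂ) ∂μ

theorem norm_ofReal_mul_lt_one {z : ℂ} (hz : z ∈ disc) (t : Ico (0 : ℝ) 1) :
    ‖((t : ℝ) : ℂ) * z‖ < 1 := by
  rw [norm_mul, Complex.norm_real, Real.norm_of_nonneg t.2.1]
  have := mem_disc.1 hz
  have := norm_nonneg z
  nlinarith [t.2.1, t.2.2]

theorem hasSum_hilbertCoeff {μ : Measure (Ico (0 : ℝ) 1)} {β : ℝ} (hβ : 0 < β) {f : ℂ → ℂ}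
    (hf : ContinuousOn f disc)
    (hint : Integrable (fun t : Ico (0 : ℝ) 1 => f ((t : ℝ) : ℂ)) μ) {z : ℂ} (hz : z ∈ disc) :
    HasSum (fun n => hilbertCoeff μ β f n * z ^ n) (hilbertFun μ β f z) := by
  have hcont := continuous_radial hf
  have hz1 := mem_disc.1 hz
  have h := hasSum_integral_of_dominated_convergence (μ := μ)
    (F := fun n (t : Ico (0 : ℝ) 1) =>
      (binomCoeff β n : ℂ) * ((t : ℝ) : ℂ) ^ n * f ((t : ℝ) : ℂ) * z ^ n)
    (f := fun t => f ((t : ℝ) : ℂ) * (1 / (1 - ((t : ℝ) : ℂ) * z) ^ (β : ℂ)))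
    (fun n t => binomCoeff β n * ‖z‖ ^ n * ‖f ((t : ℝ) : ℂ)‖) ?_ ?_ ?_ ?_ ?_
  · refine h.congr_fun fun n => ?_
    rw [hilbertCoeff, integral_mul_const]
  · exact fun n => ((((by fun_prop : Continuous fun t : Ico (0 : ℝ) 1 =>
      (binomCoeff β n : ℂ) * ((t : ℝ) : ℂ) ^ n)).mul hcont).mul continuous_const).aestronglyMeasurable
  · refine fun n => Eventually.of_forall fun t => ?_
    have h0 := (binomCoeff_pos hβ n).le
    rw [norm_mul, norm_mul, norm_mul, norm_pow, norm_pow, Complex.norm_real, Complex.norm_real,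
      Real.norm_of_nonneg h0, Real.norm_of_nonneg t.2.1]
    have h1 : (t : ℝ) ^ n ≤ 1 := pow_le_one₀ t.2.1 t.2.2.le
    calc binomCoeff β n * (t : ℝ) ^ n * ‖f ((t : ℝ) : ℂ)‖ * ‖z‖ ^ n
        ≤ binomCoeff β n * 1 * ‖f ((t : ℝ) : ℂ)‖ * ‖z‖ ^ n := by gcongr
      _ = _ := by ring
  · exact Eventually.of_forall fun t =>
      ((hasSum_binomCoeff_real hβ (norm_nonneg z) hz1).summable).mul_right _
  · simp_rw [tsum_mul_right]
    exact hint.norm.const_mul _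
  · refine Eventually.of_forall fun t => ?_
    have h1 := (hasSum_binomCoeff hβ (norm_ofReal_mul_lt_one hz t)).mul_left (f ((t : ℝ) : ℂ))
    refine h1.congr_fun fun n => ?_
    rw [mul_pow]
    ring

theorem enorm_hilbertFun_le {μ : Measure (Ico (0 : ℝ) 1)} {β : ℝ} {f : ℂ → ℂ} {z : ℂ}
    (hz : z ∈ disc) :
    ‖hilbertFun μ β f z‖ₑ ≤ ∫⁻ t : Ico (0 : ℝ) 1, ‖f ((t : ℝ) : ℂ)‖ₑ *
      ENNReal.ofReal (‖1 - ((t : ℝ) : ℂ) * z‖ ^ (-β)) ∂μ := by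
  refine (enorm_integral_le_lintegral_enorm _).trans_eq (lintegral_congr fun t => ?_)
  rw [enorm_mul, ← norm_one_div_cpow (norm_ofReal_mul_lt_one hz t), ofReal_norm]

/-- The partial sums of the Taylor series of `f` along the radius are dominated by a
`μ`-integrable function. -/
def IsDominated (μ : Measure (Ico (0 : ℝ) 1)) (f : ℂ → ℂ) : Prop :=
  ∃ B : Ico (0 : ℝ) 1 → ℝ, Integrable B μ ∧ ∀ N : ℕ, ∀ t : Ico (0 : ℝ) 1,
    ‖∑ k ∈ Finset.range N, taylorCoeff f k * ((t : ℝ) : ℂ) ^ k‖ ≤ B t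

theorem tendsto_partialSum {f : ℂ → ℂ} (hf : DifferentiableOn ℂ f disc) (t : Ico (0 : ℝ) 1) :
    Tendsto (fun N => ∑ k ∈ Finset.range N, taylorCoeff f k * ((t : ℝ) : ℂ) ^ k) atTop
      (𝓝 (f ((t : ℝ) : ℂ))) :=
  (hasSum_taylorCoeff hf (ofReal_mem_disc t.2.1 t.2.2)).tendsto_sum_nat

theorem IsDominated.integrable {μ : Measure (Ico (0 : ℝ) 1)} {f : ℂ → ℂ}
    (hf : DifferentiableOn ℂ f disc) (h : IsDominated μ f) :
    Integrable (fun t : Ico (0 : ℝ) 1 => f ((t : ℝ) : ℂ)) μ := by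
  obtain ⟨B, hB, hS⟩ := h
  refine hB.mono' (continuous_radial hf.continuousOn).aestronglyMeasurable
    (Eventually.of_forall fun t => ?_)
  exact le_of_tendsto (tendsto_partialSum hf t).norm (Eventually.of_forall fun N => hS N t)

/-- Each partial sum is the integral of a Taylor partial sum, so dominated convergence applies.
Absolute convergence in `k` is not required, which is why the majorant bounds partial sums. -/
theorem IsDominated.tendsto_hilbertCoeff {μ : Measure (Ico (0 : ℝ) 1)} [IsFiniteMeasure μ] {β : ℝ}
    (hβ : 0 < β) {f : ℂ → ℂ} (hf : DifferentiableOn ℂ f disc) (h : IsDominated μ f) (n : ℕ) :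
    Tendsto (fun N => ∑ k ∈ Finset.range N, (hankelEntry μ β n k : ℂ) * taylorCoeff f k) atTop
      (𝓝 (hilbertCoeff μ β f n)) := by
  obtain ⟨B, hB, hS⟩ := h
  have h0 := (binomCoeff_pos hβ n).le
  have hpow : ∀ k : ℕ, Integrable (fun t : Ico (0 : ℝ) 1 => ((t : ℝ) : ℂ) ^ k) μ := fun k => by
    refine (integrable_const (1 : ℝ)).mono' (Continuous.aestronglyMeasurable (by fun_prop))
      (Eventually.of_forall fun t => ?_)
    rw [norm_pow, Complex.norm_real, Real.norm_of_nonneg t.2.1]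
    exact pow_le_one₀ t.2.1 t.2.2.le
  have hsum : ∀ N, ∑ k ∈ Finset.range N, (hankelEntry μ β n k : ℂ) * taylorCoeff f k =
      ∫ t : Ico (0 : ℝ) 1, (binomCoeff β n : ℂ) * ((t : ℝ) : ℂ) ^ n *
        ∑ k ∈ Finset.range N, taylorCoeff f k * ((t : ℝ) : ℂ) ^ k ∂μ := fun N => by
    simp_rw [Finset.mul_sum]
    rw [integral_finsetSum]
    · refine Finset.sum_congr rfl fun k _ => ?_
      rw [hankelEntry, ← integral_complex_ofReal, ← integral_mul_const]
      refine integral_congr_ae (Eventually.of_forall fun t => ?_)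
      simp only [binomCoeff]
      push_cast
      ring
    · intro k _
      have := (hpow (n + k)).const_mul ((binomCoeff β n : ℂ) * taylorCoeff f k)
      refine this.congr (Eventually.of_forall fun t => ?_)
      ring
  simp_rw [hsum]
  refine tendsto_integral_of_dominated_convergence (fun t => binomCoeff β n * B t)
    (fun N => Continuous.aestronglyMeasurable (by fun_prop)) (hB.const_mul _) (fun N => ?_) ?_
  · refine Eventually.of_forall fun t => ?_
    rw [norm_mul, norm_mul, norm_pow, Complex.norm_real, Complex.norm_real,
      Real.norm_of_nonneg h0, Real.norm_of_nonneg t.2.1]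
    have h1 : (t : ℝ) ^ n ≤ 1 := pow_le_one₀ t.2.1 t.2.2.le
    calc binomCoeff β n * (t : ℝ) ^ n * _ ≤ binomCoeff β n * 1 * B t := by
          gcongr
          exact hS N t
      _ = _ := by ring
  · exact Eventually.of_forall fun t => (tendsto_partialSum hf t).const_mul _

theorem IsDominated.isHilbertImage {μ : Measure (Ico (0 : ℝ) 1)} [IsFiniteMeasure μ] {β : ℝ}
    (hβ : 0 < β) {f : ℂ → ℂ} (hf : DifferentiableOn ℂ f disc) (h : IsDominated μ f) :
    IsHilbertImage μ β f (hilbertFun μ β f) :=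
  ⟨hilbertCoeff μ β f, h.tendsto_hilbertCoeff hβ hf, fun _ hz =>
    hasSum_hilbertCoeff hβ hf.continuousOn (h.integrable hf) hz⟩

/-- Compactness quantifies over arbitrary images; uniqueness of limits ties each of them to the
integral formula. -/
theorem IsDominated.hasSum_of_isHilbertImage {μ : Measure (Ico (0 : ℝ) 1)} [IsFiniteMeasure μ]
    {β : ℝ} (hβ : 0 < β) {f g : ℂ → ℂ} (hf : DifferentiableOn ℂ f disc) (h : IsDominated μ f)
    (hg : IsHilbertImage μ β f g) :
    ∀ z ∈ disc, HasSum (fun n => hilbertCoeff μ β f n * z ^ n) (g z) := by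
  obtain ⟨c, hc, hgc⟩ := hg
  have : c = hilbertCoeff μ β f :=
    funext fun n => tendsto_nhds_unique (hc n) (h.tendsto_hilbertCoeff hβ hf n)
  rwa [this] at hgc

theorem IsDominated.eqOn_of_isHilbertImage {μ : Measure (Ico (0 : ℝ) 1)} [IsFiniteMeasure μ]
    {β : ℝ} (hβ : 0 < β) {f g : ℂ → ℂ} (hf : DifferentiableOn ℂ f disc) (h : IsDominated μ f)
    (hg : IsHilbertImage μ β f g) : EqOn g (hilbertFun μ β f) disc := fun z hz =>
  (h.hasSum_of_isHilbertImage hβ hf hg z hz).unique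
    (hasSum_hilbertCoeff hβ hf.continuousOn (h.integrable hf) hz)

theorem differentiableOn_hilbertFun {μ : Measure (Ico (0 : ℝ) 1)} {β : ℝ} (hβ : 0 < β) {f : ℂ → ℂ}
    (hf : ContinuousOn f disc)
    (hint : Integrable (fun t : Ico (0 : ℝ) 1 => f ((t : ℝ) : ℂ)) μ) :
    DifferentiableOn ℂ (hilbertFun μ β f) disc :=
  differentiableOn_of_hasSum fun _ hz => hasSum_hilbertCoeff hβ hf hint hz

theorem integrable_hilbertKernel {μ : Measure (Ico (0 : ℝ) 1)} {β : ℝ} (hβ : 0 < β) {f : ℂ → ℂ}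
    (hint : Integrable (fun t : Ico (0 : ℝ) 1 => f ((t : ℝ) : ℂ)) μ) {z : ℂ} (hz : z ∈ disc) :
    Integrable (fun t : Ico (0 : ℝ) 1 =>
      f ((t : ℝ) : ℂ) * (1 / (1 - ((t : ℝ) : ℂ) * z) ^ (β : ℂ))) μ := by
  have hz1 := mem_disc.1 hz
  refine hint.mul_bdd (c := (1 - ‖z‖) ^ (-β)) ?_ (Eventually.of_forall fun t => ?_)
  · refine Continuous.aestronglyMeasurable ?_
    refine continuous_const.div (Continuous.cpow (by fun_prop) continuous_const fun t => ?_)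
      fun t => ?_
    · have := norm_ofReal_mul_lt_one hz t
      refine Or.inl ?_
      have h2 := Complex.re_le_norm (((t : ℝ) : ℂ) * z)
      rw [Complex.sub_re, Complex.one_re]
      linarith
    · have := norm_ofReal_mul_lt_one hz t
      rw [Ne, Complex.cpow_eq_zero_iff, sub_eq_zero, not_and_or]
      left
      intro h
      rw [← h, norm_one] at this
      exact lt_irrefl _ this
  · rw [norm_one_div_cpow (norm_ofReal_mul_lt_one hz t)]
    refine Real.rpow_le_rpow_of_nonpos (by linarith) ?_ (by linarith)
    have h1 := norm_sub_norm_le 1 (((t : ℝ) : ℂ) * z)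
    rw [norm_one, norm_mul, Complex.norm_real, Real.norm_of_nonneg t.2.1] at h1
    have := norm_nonneg z
    nlinarith [t.2.1, t.2.2]

theorem hilbertFun_sub {μ : Measure (Ico (0 : ℝ) 1)} {β : ℝ} (hβ : 0 < β) {f g : ℂ → ℂ}
    (hf : Integrable (fun t : Ico (0 : ℝ) 1 => f ((t : ℝ) : ℂ)) μ)
    (hg : Integrable (fun t : Ico (0 : ℝ) 1 => g ((t : ℝ) : ℂ)) μ) {z : ℂ} (hz : z ∈ disc) :
    hilbertFun μ β (f - g) z = hilbertFun μ β f z - hilbertFun μ β g z := by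
  rw [hilbertFun, hilbertFun, hilbertFun, ← integral_sub (integrable_hilbertKernel hβ hf hz)
    (integrable_hilbertKernel hβ hg hz)]
  simp only [Pi.sub_apply, sub_mul]

/-! ### Dyadic masses of `μ` -/

/-- The mass of the `j`-th dyadic interval. -/
noncomputable def dyadicMass (μ : Measure (Ico (0 : ℝ) 1)) (j : ℕ) : ℝ≥0∞ :=
  μ {t | (t : ℝ) ∈ dyadic j}

theorem lintegral_le_tsum_dyadicMass (μ : Measure (Ico (0 : ℝ) 1)) (F : Ico (0 : ℝ) 1 → ℝ≥0∞)
    (b : ℕ → ℝ≥0∞) (h : ∀ j, ∀ t : Ico (0 : ℝ) 1, (t : ℝ) ∈ dyadic j → F t ≤ b j) :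
    ∫⁻ t, F t ∂μ ≤ ∑' j, b j * dyadicMass μ j := by
  have hU : ⋃ j, {t : Ico (0 : ℝ) 1 | (t : ℝ) ∈ dyadic j} = univ :=
    eq_univ_of_forall fun t => mem_iUnion.2 (exists_mem_dyadic t.2)
  have hm : ∀ j, MeasurableSet {t : Ico (0 : ℝ) 1 | (t : ℝ) ∈ dyadic j} := fun j =>
    measurable_subtype_coe (measurableSet_dyadic j)
  rw [← setLIntegral_univ, ← hU]
  refine (lintegral_iUnion_le _ _).trans (ENNReal.tsum_le_tsum fun j => ?_)
  refine (setLIntegral_mono' (hm j) (h j)).trans_eq ?_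
  rw [setLIntegral_const, dyadicMass]

theorem dyadicMass_le_tail (μ : Measure (Ico (0 : ℝ) 1)) (j : ℕ) :
    dyadicMass μ j ≤ tail μ (1 - (1 / 2) ^ j) := by
  refine measure_mono fun t ht => ?_
  have := ht.2
  show 1 - (1 / 2 : ℝ) ^ j ≤ t
  linarith

theorem tendsto_one_sub_half_pow : Tendsto (fun j : ℕ => 1 - (1 / 2 : ℝ) ^ j) atTop (𝓝[<] 1) := by
  refine tendsto_nhdsWithin_iff.2 ⟨?_, Eventually.of_forall fun j => ?_⟩
  · have := (tendsto_pow_atTop_nhds_zero_of_lt_one (r := (1 / 2 : ℝ)) (by norm_num)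
      (by norm_num)).const_sub 1
    simpa using this
  · have : (0 : ℝ) < (1 / 2) ^ j := by positivity
    show 1 - (1 / 2 : ℝ) ^ j < 1
    linarith

theorem IsVanishingCarleson.tendsto_dyadicMass {μ : Measure (Ico (0 : ℝ) 1)} {σ : ℝ}
    (h : IsVanishingCarleson μ σ) :
    Tendsto (fun j : ℕ => dyadicMass μ j * 2 ^ (j * σ)) atTop (𝓝 0) := by
  have h1 := h.comp tendsto_one_sub_half_pow
  refine tendsto_of_tendsto_of_tendsto_of_le_of_le tendsto_const_nhds h1 (fun _ => zero_le)
    fun j => ?_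
  simp only [Function.comp_apply, sub_sub_cancel]
  rw [ofReal_half_pow_rpow, ENNReal.div_eq_inv_mul, ← ENNReal.rpow_neg, neg_neg, mul_comm]
  gcongr
  exact dyadicMass_le_tail μ j

theorem IsVanishingLogCarleson.tendsto_dyadicMass {μ : Measure (Ico (0 : ℝ) 1)} {s : ℝ}
    (h : IsVanishingLogCarleson μ 1 s) :
    Tendsto (fun j : ℕ => ((j : ℝ≥0∞) + 1) * dyadicMass μ j * 2 ^ (j * s)) atTop (𝓝 0) := by
  have h1 := ENNReal.Tendsto.const_mul (a := 4) (h.comp tendsto_one_sub_half_pow)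
    (Or.inr ENNReal.ofNat_ne_top)
  rw [mul_zero] at h1
  refine tendsto_of_tendsto_of_tendsto_of_le_of_le' tendsto_const_nhds h1
    (Eventually.of_forall fun _ => zero_le) ?_
  filter_upwards [eventually_ge_atTop 1] with j hj
  simp only [Function.comp_apply, sub_sub_cancel]
  rw [ofReal_half_pow_rpow, ENNReal.div_eq_inv_mul, ← ENNReal.rpow_neg, neg_neg, Real.rpow_one]
  have hj' : (1 : ℝ) ≤ j := by exact_mod_cast hj
  -- For `j ≥ 1`, `j + 1 ≤ 2 j ≤ 4 j log 2`, because `log 2 > 1 / 2`; at `j = 0` the logarithm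
  -- vanishes.
  have hlog : (j : ℝ≥0∞) + 1 ≤ 4 * ENNReal.ofReal (Real.log (1 / (1 / 2) ^ j)) := by
    rw [show (4 : ℝ≥0∞) = ENNReal.ofReal 4 by simp, ← ENNReal.ofReal_mul (by norm_num),
      show (j : ℝ≥0∞) + 1 = ENNReal.ofReal (j + 1) by
        rw [ENNReal.ofReal_add (by positivity) (by norm_num)]; simp]
    apply ENNReal.ofReal_le_ofReal
    rw [one_div_pow, one_div_one_div, Real.log_pow]
    have := Real.log_two_gt_d9
    nlinarith
  calc ((j : ℝ≥0∞) + 1) * dyadicMass μ j * 2 ^ (j * s)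
      ≤ (4 * ENNReal.ofReal (Real.log (1 / (1 / 2) ^ j))) * tail μ (1 - (1 / 2) ^ j) *
          2 ^ (j * s) := by
        gcongr
        exact dyadicMass_le_tail μ j
    _ = _ := by ring

theorem exists_bound_of_tendsto_zero {W : ℕ → ℝ≥0∞} (hW : Tendsto W atTop (𝓝 0))
    (hfin : ∀ j, W j ≠ ∞) : ∃ K : ℝ≥0∞, K ≠ ∞ ∧ ∀ j, W j ≤ K := by
  obtain ⟨J, hJ⟩ := eventually_atTop.1 
    (hW.eventually (Iic_mem_nhds one_pos : ∀ᶠ y : ℝ≥0∞ in 𝓝 0, y ≤ 1))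
  refine ⟨∑ j ∈ Finset.range J, W j + 1, ?_, fun j => ?_⟩
  · exact ENNReal.add_ne_top.2 ⟨ENNReal.sum_ne_top.2 fun j _ => hfin j, ENNReal.one_ne_top⟩
  · rcases lt_or_ge j J with h | h
    · exact le_add_right (Finset.single_le_sum (f := W) (fun _ _ => zero_le)
        (Finset.mem_range.2 h))
    · exact le_add_left (hJ j h)

/-! ### Domination of partial sums -/

theorem exists_norm_mul_le {p α : ℝ} (hp : 0 < p) (hα : -1 < α) {f : ℂ → ℂ}
    (hf : f ∈ bergmanSpace p α) :
    ∃ K : ℝ, ∀ z ∈ disc, ‖f z‖ * (1 - ‖z‖) ^ ((α + 2) / p) ≤ K := by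
  obtain ⟨C, hC, h⟩ := exists_pointwise hp hα
  have hfin : C * bergmanNorm p α f ≠ ∞ := ENNReal.mul_ne_top hC hf.2.ne
  refine ⟨(C * bergmanNorm p α f).toReal, fun z hz => ?_⟩
  have h1 := h f hf.1 z hz
  rw [← ofReal_norm, ← ENNReal.ofReal_mul (norm_nonneg _)] at h1
  exact (ENNReal.ofReal_le_iff_le_toReal hfin).1 h1

theorem isDominated_of_dyadicMass {μ : Measure (Ico (0 : ℝ) 1)} {p α σ : ℝ} (hp : 0 < p)
    (hα : -1 < α) (hσ : (α + 2) / p < σ) {K : ℝ≥0∞} (hK : K ≠ ∞)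
    (hW : ∀ j : ℕ, dyadicMass μ j * 2 ^ (j * σ) ≤ K) {f : ℂ → ℂ} (hf : f ∈ bergmanSpace p α) :
    IsDominated μ f := by
  set s := (α + 2) / p with hs
  have hs0 : 0 < s := div_pos (by linarith) hp
  -- The first entry gives `δ < 1` for the partial-sum bound; the second leaves the geometric decay
  -- `σ - s - δ > 0`.
  set δ := min (1 / 2) ((σ - s) / 2) with hδ
  have hδ0 : 0 < δ := lt_min (by norm_num) (by linarith)
  have hδ1 : δ < 1 := (min_le_left _ _).trans_lt (by norm_num)
  have hδ2 : δ ≤ (σ - s) / 2 := min_le_right _ _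
  obtain ⟨L, hL⟩ := exists_norm_mul_le hp hα hf
  obtain ⟨C, hC0, hC⟩ := exists_norm_partialSum_le hf.1 hδ0 hδ1 hL
  refine ⟨fun t => C * (1 - (t : ℝ)) ^ (-(s + δ)), Integrable.const_mul ?_ _,
    fun N t => hC N t t.2⟩
  have hnn : ∀ t : Ico (0 : ℝ) 1, 0 ≤ (1 - (t : ℝ)) ^ (-(s + δ)) := fun t =>
    Real.rpow_nonneg (by linarith [t.2.2]) _
  refine ⟨Measurable.aestronglyMeasurable (by fun_prop), ?_⟩
  rw [hasFiniteIntegral_iff_ofReal (Eventually.of_forall hnn)]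
  refine (lintegral_le_tsum_dyadicMass μ _ (fun j => 2 ^ ((j + 1) * (s + δ))) ?_).trans_lt ?_
  · intro j t ht
    rw [← ofReal_two_rpow]
    refine ENNReal.ofReal_le_ofReal ?_
    have h1 : ((1 / 2 : ℝ) ^ (j + 1)) ^ (-(s + δ)) = 2 ^ (((j : ℝ) + 1) * (s + δ)) := by
      rw [half_pow_eq, ← Real.rpow_mul two_pos.le]
      congr 1
      push_cast
      ring
    rw [← h1]
    exact Real.rpow_le_rpow_of_nonpos (by positivity) ht.1.le (by linarith)
  · have hε : 0 < σ - s - δ := by linarith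
    have h2 : ∑' j : ℕ, (2 : ℝ≥0∞) ^ (((j : ℝ) + 1) * (s + δ)) * dyadicMass μ j ≤
        2 ^ (s + δ) * K * ∑' j : ℕ, (2 : ℝ≥0∞) ^ (-((σ - s - δ) * j)) := by
      rw [← ENNReal.tsum_mul_left]
      refine ENNReal.tsum_le_tsum fun j => ?_
      calc (2 : ℝ≥0∞) ^ (((j : ℝ) + 1) * (s + δ)) * dyadicMass μ j
          = 2 ^ (s + δ) * (dyadicMass μ j * 2 ^ (j * σ)) * 2 ^ (-((σ - s - δ) * j)) := by
            rw [show ((j : ℝ) + 1) * (s + δ) = (s + δ) + (j * σ + -((σ - s - δ) * j)) by ring,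
              two_rpow_add (s + δ), two_rpow_add (j * σ)]
            ac_rfl
        _ ≤ _ := by
            gcongr
            exact hW j
    refine h2.trans_lt ?_
    have h3 := tsum_two_rpow_ne_top hε
    have h4 := two_rpow_ne_top (s + δ)
    exact (ENNReal.mul_ne_top (ENNReal.mul_ne_top h4 hK) h3).lt_top

/-- At the critical exponent the `δ`-loss is not affordable. Instead `f` lies in `A¹` with weight
exponent `s - 2`, where Hardy's inequality has the weights `B(k + 1, s)`, and these dominate the
moments of `μ`. Hence `∑ |a_k| t ^ k` is itself a majorant. -/
theorem isDominated_of_isCarleson {μ : Measure (Ico (0 : ℝ) 1)} {p α : ℝ} (hp : 0 < p)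
    (hp1 : p ≤ 1) (hα : -1 < α) (hμ : IsCarleson μ ((α + 2) / p)) {f : ℂ → ℂ}
    (hf : f ∈ bergmanSpace p α) : IsDominated μ f := by
  obtain ⟨C, hC0, hC⟩ := hμ
  set s := (α + 2) / p with hs
  have hs0 : 0 < s := div_pos (by linarith) hp
  have hs1 : 1 < s := by
    rw [hs, lt_div_iff₀ hp]
    linarith
  have hfin := lintegral_enorm_ne_top_of_mem hp hp1 hα hf
  have hH := tsum_taylorCoeff_beta_le (γ := s - 2) (by linarith) hf.1
  set E : Ico (0 : ℝ) 1 → ℝ≥0∞ := fun t => ∑' k : ℕ, ‖taylorCoeff f k‖ₑ *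
    ENNReal.ofReal ((t : ℝ) ^ k) with hE
  have hEm : Measurable E := Measurable.tsum fun k => by fun_prop
  have hEt : ∫⁻ t, E t ∂μ ≠ ∞ := by
    rw [hE, lintegral_tsum fun k => by fun_prop]
    have h1 : ∀ k : ℕ, ∫⁻ t : Ico (0 : ℝ) 1, ‖taylorCoeff f k‖ₑ *
        ENNReal.ofReal ((t : ℝ) ^ k) ∂μ ≤ ENNReal.ofReal (C * s) *
        (‖taylorCoeff f k‖ₑ * ENNReal.ofReal (ProbabilityTheory.beta (k + 1) (s - 2 + 2))) :=
      fun k => by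
        rw [lintegral_const_mul' _ _ (by finiteness)]
        refine (mul_le_mul_right (lintegral_pow_le hs0 hC0 hC k) _).trans_eq ?_
        rw [ENNReal.ofReal_mul (by positivity), sub_add_cancel]
        ring
    refine ne_top_of_le_ne_top ?_ (ENNReal.tsum_le_tsum h1)
    rw [ENNReal.tsum_mul_left]
    exact ENNReal.mul_ne_top (by finiteness) (ne_top_of_le_ne_top
      (ENNReal.mul_ne_top ENNReal.ofNat_ne_top hfin) hH)
  refine ⟨fun t => (E t).toReal, integrable_toReal_of_lintegral_ne_top hEm.aemeasurable hEt,
    fun N t => ?_⟩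
  have hsm := (hasSum_taylorCoeff hf.1 (ofReal_mem_disc t.2.1 t.2.2)).summable.norm
  have hterm : ∀ k, ‖taylorCoeff f k * ((t : ℝ) : ℂ) ^ k‖ = ‖taylorCoeff f k‖ * (t : ℝ) ^ k :=
    fun k => by
      rw [norm_mul, norm_pow, Complex.norm_real, Real.norm_of_nonneg t.2.1]
  simp_rw [hterm] at hsm
  have hEe : E t = ENNReal.ofReal (∑' k, ‖taylorCoeff f k‖ * (t : ℝ) ^ k) := by
    rw [ENNReal.ofReal_tsum_of_nonneg (fun k => by have := t.2.1; positivity) hsm]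
    refine tsum_congr fun k => ?_
    rw [ENNReal.ofReal_mul (norm_nonneg _), ofReal_norm]
  have hnn : ∀ k, 0 ≤ ‖taylorCoeff f k‖ * (t : ℝ) ^ k := fun k => by have := t.2.1; positivity
  simp only [hEe]
  rw [ENNReal.toReal_ofReal (tsum_nonneg hnn)]
  refine (norm_sum_le _ _).trans ?_
  simp_rw [hterm]
  exact hsm.sum_le_tsum _ fun k _ => hnn k

/-! ### The norm estimate for the Hilbert operator -/

/-- Both `1 - t` and `|1 - z| / 2` are lower bounds for `|1 - t z|`; the better one is selected by
`min i j`. -/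
theorem ofReal_norm_rpow_le {β : ℝ} (hβ : 0 < β) {i j : ℕ} {t : ℝ} (ht : t ∈ dyadic j) {z : ℂ}
    (hz : z ∈ shell i) (hzd : z ∈ disc) :
    ENNReal.ofReal (‖1 - (t : ℂ) * z‖ ^ (-β)) ≤ 2 ^ β * 2 ^ (β * (min i j : ℕ)) := by
  obtain ⟨ht0, ht1⟩ := dyadic_bounds ht
  have hz1 := (mem_disc.1 hzd).le
  have h1 := one_sub_le_norm_one_sub_mul hz1 ht0
  have h2 := norm_one_sub_le_two_mul hz1 ht0 ht1.le
  have h3 : (1 / 2 : ℝ) ^ (min i j + 1) ≤ ‖1 - (t : ℂ) * z‖ := by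
    rcases le_total i j with h | h
    · rw [min_eq_left h, pow_succ]
      linarith [hz.1]
    · rw [min_eq_right h]
      exact ht.1.le.trans h1
  rw [← two_rpow_add, ← ofReal_two_rpow]
  refine ENNReal.ofReal_le_ofReal ((Real.rpow_le_rpow_of_nonpos (by positivity) h3
    (by linarith)).trans_eq ?_)
  rw [half_pow_eq, ← Real.rpow_mul two_pos.le]
  congr 1
  push_cast
  ring

/-- In the exponent, `min i j` comes from the kernel and `i / q` from the area of the shell, moved
inside the `q`-th power. -/
theorem exists_lintegral_hilbertFun_le {q α : ℝ} (hq : 0 < q) (hα : -1 < α) :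
    ∃ C : ℝ≥0∞, C ≠ ∞ ∧ ∀ (μ : Measure (Ico (0 : ℝ) 1)) (f : ℂ → ℂ),
      ∫⁻ z, ‖hilbertFun μ (α + 2) f z‖ₑ ^ q ∂areaMeasure α ≤
        C * ∑' i : ℕ, (∑' j : ℕ, radialSup f j * dyadicMass μ j *
          2 ^ ((α + 2) * ((min i j : ℕ) - i / q))) ^ q := by
  obtain ⟨C, hC, h⟩ := exists_lintegral_le_tsum hα
  have hβ : 0 < α + 2 := by linarith
  refine ⟨C * (2 ^ (α + 2)) ^ q, by finiteness, fun μ f => ?_⟩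
  refine (h _ (fun i => (2 ^ (α + 2) * ∑' j : ℕ, radialSup f j * dyadicMass μ j *
    2 ^ ((α + 2) * (min i j : ℕ))) ^ q) ?_).trans_eq ?_
  · rintro i z ⟨hz, hzd⟩
    refine ENNReal.rpow_le_rpow ((enorm_hilbertFun_le hzd).trans ?_) hq.le
    refine (lintegral_le_tsum_dyadicMass μ _ (fun j => radialSup f j *
      (2 ^ (α + 2) * 2 ^ ((α + 2) * (min i j : ℕ)))) fun j t ht => ?_).trans_eq ?_
    · exact mul_le_mul' (le_radialSup f ht) (ofReal_norm_rpow_le hβ ht hz hzd)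
    · rw [← ENNReal.tsum_mul_left]
      refine tsum_congr fun j => ?_
      ring
  · rw [mul_assoc C, ← ENNReal.tsum_mul_left (a := ((2 : ℝ≥0∞) ^ (α + 2)) ^ q)]
    congr 1
    refine tsum_congr fun i => ?_
    rw [ENNReal.mul_rpow_of_nonneg _ _ hq.le, mul_assoc]
    congr 1
    have h1 : (2 : ℝ≥0∞) ^ (-(i * (α + 2))) = (2 ^ (-((α + 2) * (i / q)))) ^ q := by
      rw [← ENNReal.rpow_mul]
      congr 1
      field_simp
    rw [h1, ← ENNReal.mul_rpow_of_nonneg _ _ hq.le, ← ENNReal.tsum_mul_right]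
    congr 1
    refine tsum_congr fun j => ?_
    rw [mul_assoc, ← two_rpow_add]
    ring_nf

/-- After normalization the matrix decays at rate `(α + 2)(1 - 1 / q)` for `i ≤ j` and `(α + 2) / q`
for `j ≤ i`. Both are positive exactly because `q > 1`; `κ` is the smaller one. -/
theorem exists_lintegral_hilbertFun_le_of_one_lt {q α : ℝ} (s : ℝ) (hq : 1 < q) (hα : -1 < α) :
    ∃ C : ℝ≥0∞, C ≠ ∞ ∧ ∀ (μ : Measure (Ico (0 : ℝ) 1)) (f : ℂ → ℂ),
      ∫⁻ z, ‖hilbertFun μ (α + 2) f z‖ₑ ^ q ∂areaMeasure α ≤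
        C * ∑' j : ℕ, (radialSup f j * 2 ^ (-(j * s)) *
          (dyadicMass μ j * 2 ^ (j * (s + (α + 2) * (1 - 1 / q))))) ^ q := by
  have hq0 : 0 < q := by linarith
  have hβ : 0 < α + 2 := by linarith
  have h1q : 0 < 1 / q := by positivity
  have h1q' : 0 < 1 - 1 / q := by
    rw [sub_pos, div_lt_one hq0]
    exact hq
  obtain ⟨C, hC, h⟩ := exists_lintegral_hilbertFun_le hq0 hα
  set κ := (α + 2) * min (1 / q) (1 - 1 / q) with hκ
  have hκ0 : 0 < κ := mul_pos hβ (lt_min h1q h1q')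
  have hκ1 : κ ≤ (α + 2) * (1 / q) := mul_le_mul_of_nonneg_left (min_le_left _ _) hβ.le
  have hκ2 : κ ≤ (α + 2) * (1 - 1 / q) := mul_le_mul_of_nonneg_left (min_le_right _ _) hβ.le
  obtain ⟨C', hC', h'⟩ := exists_tsum_conv_rpow_le hq0 hκ0
  refine ⟨C * C', by finiteness, fun μ f => (h μ f).trans ?_⟩
  rw [mul_assoc C]
  refine mul_le_mul_right (le_trans ?_ (h' _)) _
  refine ENNReal.tsum_le_tsum fun i => ENNReal.rpow_le_rpow (ENNReal.tsum_le_tsum fun j => ?_) hq0.le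
  have h2 : -(κ * |(i : ℝ) - j|) ≥
      (α + 2) * ((min i j : ℕ) - i / q) + j * s - j * (s + (α + 2) * (1 - 1 / q)) := by
    rcases le_total i j with hij | hij
    · have hij' : (i : ℝ) ≤ j := by exact_mod_cast hij
      rw [min_eq_left hij, abs_of_nonpos (by linarith)]
      have := mul_le_mul_of_nonneg_right hκ2 (sub_nonneg.2 hij')
      have e : (α + 2) * ((i : ℝ) - i / q) + j * s - j * (s + (α + 2) * (1 - 1 / q)) =
        -((α + 2) * (1 - 1 / q) * (j - i)) := by ring
      rw [e]
      linarith
    · have hij' : (j : ℝ) ≤ i := by exact_mod_cast hij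
      rw [min_eq_right hij, abs_of_nonneg (by linarith)]
      have := mul_le_mul_of_nonneg_right hκ1 (sub_nonneg.2 hij')
      have e : (α + 2) * ((j : ℝ) - i / q) + j * s - j * (s + (α + 2) * (1 - 1 / q)) =
        -((α + 2) * (1 / q) * (i - j)) := by ring
      rw [e]
      linarith
  have h3 := two_rpow_le h2
  have e : (2 : ℝ≥0∞) ^ ((α + 2) * ((min i j : ℕ) - i / q)) = 2 ^ (-(j * s)) *
      2 ^ (j * (s + (α + 2) * (1 - 1 / q))) * 2 ^ ((α + 2) * ((min i j : ℕ) - i / q) + j * s -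
        j * (s + (α + 2) * (1 - 1 / q))) := by
    rw [← two_rpow_add, ← two_rpow_add]
    congr 1
    ring
  rw [e]
  calc _ = radialSup f j * 2 ^ (-(j * s)) * (dyadicMass μ j *
        2 ^ (j * (s + (α + 2) * (1 - 1 / q)))) * 2 ^ ((α + 2) * ((min i j : ℕ) - i / q) + j * s -
        j * (s + (α + 2) * (1 - 1 / q))) := by ring
    _ ≤ _ := by gcongr

/-- For `q = 1` the exponent is zero for all `i ≤ j`, so `j + 1` shells count fully and the rest
form a geometric series. -/
theorem exists_lintegral_hilbertFun_le_of_eq_one {α : ℝ} (s : ℝ) (hα : -1 < α) :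
    ∃ C : ℝ≥0∞, C ≠ ∞ ∧ ∀ (μ : Measure (Ico (0 : ℝ) 1)) (f : ℂ → ℂ),
      ∫⁻ z, ‖hilbertFun μ (α + 2) f z‖ₑ ^ (1 : ℝ) ∂areaMeasure α ≤
        C * ∑' j : ℕ, (radialSup f j * 2 ^ (-(j * s)) *
          (((j : ℝ≥0∞) + 1) * dyadicMass μ j * 2 ^ (j * s))) ^ (1 : ℝ) := by
  have hβ : 0 < α + 2 := by linarith
  obtain ⟨C, hC, h⟩ := exists_lintegral_hilbertFun_le one_pos hα
  obtain ⟨C', hC', h'⟩ := exists_tsum_two_rpow_le hβ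
  refine ⟨C * (1 + C'), by finiteness, fun μ f => (h μ f).trans ?_⟩
  rw [mul_assoc C]
  refine mul_le_mul_right ?_ _
  simp only [ENNReal.rpow_one, div_one]
  rw [ENNReal.tsum_comm, ← ENNReal.tsum_mul_left]
  refine ENNReal.tsum_le_tsum fun j => ?_
  rw [ENNReal.tsum_mul_left]
  have h1 : ∑' i : ℕ, (2 : ℝ≥0∞) ^ ((α + 2) * ((min i j : ℕ) - i)) ≤ (j + 1) * (1 + C') := by
    have h2 : ∀ i : ℕ, (2 : ℝ≥0∞) ^ ((α + 2) * ((min i j : ℕ) - i)) ≤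
        (if i ∈ Finset.range (j + 1) then 1 else 0) + 2 ^ (-((α + 2) * |(j : ℝ) - i|)) :=
      fun i => by
        rcases le_or_gt i j with hij | hij
        · rw [min_eq_left hij, if_pos (Finset.mem_range.2 (by omega))]
          simp
        · have hij' : (j : ℝ) < i := by exact_mod_cast hij
          rw [min_eq_right hij.le, if_neg (by simp; omega), zero_add, abs_of_neg (by linarith)]
          apply two_rpow_le
          linarith
    refine (ENNReal.tsum_le_tsum h2).trans ?_
    rw [ENNReal.tsum_add, tsum_eq_sum (s := Finset.range (j + 1)) (fun b hb => if_neg hb)]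
    rw [Finset.sum_ite_mem, Finset.inter_self, Finset.sum_const, Finset.card_range, nsmul_eq_mul,
      mul_one, mul_add, mul_one]
    push_cast
    gcongr
    calc _ ≤ 1 * C' := by rw [one_mul]; exact h' j
      _ ≤ _ := by gcongr; simp
  have e : (2 : ℝ≥0∞) ^ (-(j * s)) * 2 ^ (j * s) = 1 := by
    rw [← two_rpow_add]
    simp
  calc radialSup f j * dyadicMass μ j * ∑' i : ℕ, (2 : ℝ≥0∞) ^ ((α + 2) * ((min i j : ℕ) - i))
      ≤ radialSup f j * dyadicMass μ j * ((j + 1) * (1 + C')) := by gcongr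
    _ = (1 + C') * (radialSup f j * (((j : ℝ≥0∞) + 1) * dyadicMass μ j)) *
          (2 ^ (-(j * s)) * 2 ^ (j * s)) := by
        rw [e]
        ring
    _ = _ := by ring

/-! ### Normal families in Bergman spaces -/

theorem exists_enorm_taylorCoeff_le {p α : ℝ} (hp : 0 < p) (hα : -1 < α) {r : ℝ} (hr0 : 0 < r)
    (hr1 : r < 1) :
    ∃ C : ℝ≥0∞, C ≠ ∞ ∧ ∀ f : ℂ → ℂ, DifferentiableOn ℂ f disc → ∀ k,
      ‖taylorCoeff f k‖ₑ * ENNReal.ofReal r ^ k ≤ C * bergmanNorm p α f := by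
  obtain ⟨C, hC, h⟩ := exists_pointwise hp hα
  have hw : 0 < ENNReal.ofReal ((1 - r) ^ ((α + 2) / p)) :=
    ENNReal.ofReal_pos.2 (Real.rpow_pos_of_pos (by linarith) _)
  refine ⟨C / ENNReal.ofReal ((1 - r) ^ ((α + 2) / p)), ENNReal.div_ne_top hC hw.ne',
    fun f hf k => ?_⟩
  have hsub : Metric.closedBall (0 : ℂ) r ⊆ disc := Metric.closedBall_subset_ball hr1
  have h1 := enorm_taylorCoeff_mul_le hr0 (hf.mono hsub) k
  have h2 : ∀ θ : ℝ, ‖f (circleMap 0 r θ)‖ₑ ≤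
      C / ENNReal.ofReal ((1 - r) ^ ((α + 2) / p)) * bergmanNorm p α f := fun θ => by
    have h3 : ‖circleMap 0 r θ‖ = r := by rw [norm_circleMap_zero, abs_of_pos hr0]
    have h4 := h f hf (circleMap 0 r θ) (by rw [mem_disc, h3]; exact hr1)
    rw [h3] at h4
    rw [ENNReal.mul_comm_div, ← mul_div_assoc]
    exact (ENNReal.le_div_iff_mul_le (Or.inl hw.ne') (Or.inl ENNReal.ofReal_ne_top)).2 h4
  have h5 := h1.trans (lintegral_mono h2)
  rw [setLIntegral_const, Real.volume_Ioo, mul_comm (_ * bergmanNorm p α f),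
    show Real.pi - -Real.pi = 2 * Real.pi by ring] at h5
  have hπ : 0 < 2 * Real.pi := by positivity
  exact (ENNReal.mul_le_mul_iff_right (ENNReal.ofReal_pos.2 hπ).ne' ENNReal.ofReal_ne_top).1 h5

theorem aemeasurable_areaMeasure {f : ℂ → ℂ} (hf : ContinuousOn f disc) (p α : ℝ) :
    AEMeasurable (fun z => ‖f z‖ₑ ^ p) (areaMeasure α) := by
  have h : AEMeasurable f (areaMeasure α) :=
    (hf.aemeasurable isOpen_disc.measurableSet).mono_ac (withDensity_absolutelyContinuous _ _)
  exact h.enorm.pow_const p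

theorem bergmanNorm_le_of_tendsto {p α : ℝ} (hp : 0 < p) {f : ℕ → ℂ → ℂ} {F : ℂ → ℂ}
    (hf : ∀ n, DifferentiableOn ℂ (f n) disc)
    (h : ∀ z ∈ disc, Tendsto (fun n => f n z) atTop (𝓝 (F z))) {B : ℝ≥0∞}
    (hB : ∀ n, bergmanNorm p α (f n) ≤ B) : bergmanNorm p α F ≤ B := by
  have h1 : ∫⁻ z, ‖F z‖ₑ ^ p ∂areaMeasure α ≤
      liminf (fun n => ∫⁻ z, ‖f n z‖ₑ ^ p ∂areaMeasure α) atTop := by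
    refine le_trans (lintegral_mono_ae ?_) (lintegral_liminf_le' fun n =>
      aemeasurable_areaMeasure (hf n).continuousOn p α)
    filter_upwards [ae_areaMeasure_mem_disc α] with z hz
    exact (((ENNReal.continuous_rpow_const.tendsto _).comp (h z hz).enorm).liminf_eq).ge
  rw [← ENNReal.rpow_le_rpow_iff hp, bergmanNorm_rpow hp]
  have h2 : ∀ n, normalizer α * ∫⁻ z, ‖f n z‖ₑ ^ p ∂areaMeasure α ≤ B ^ p := fun n => by
    rw [← bergmanNorm_rpow hp]
    exact ENNReal.rpow_le_rpow (hB n) hp.le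
  refine (mul_le_mul_right h1 _).trans ?_
  rw [← ENNReal.liminf_const_mul_of_ne_top (normalizer_ne_top α)]
  exact liminf_le_of_le ⟨0, by simp⟩ fun b hb => by
    obtain ⟨n, hn⟩ := hb.exists
    exact hn.trans (h2 n)

theorem add_rpow_le {p : ℝ} (hp : 0 < p) (x y : ℝ≥0∞) :
    (x + y) ^ p ≤ 2 ^ p * (x ^ p + y ^ p) := by
  have h : x + y ≤ 2 * max x y := by
    rw [two_mul]
    exact add_le_add (le_max_left _ _) (le_max_right _ _)
  refine (ENNReal.rpow_le_rpow h hp.le).trans ?_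
  rw [ENNReal.mul_rpow_of_nonneg _ _ hp.le]
  gcongr
  rcases le_total x y with hxy | hxy
  · rw [max_eq_right hxy]
    exact le_add_self
  · rw [max_eq_left hxy]
    exact le_self_add

theorem bergmanNorm_sub_rpow_le {p α : ℝ} (hp : 0 < p) {f g : ℂ → ℂ}
    (hf : DifferentiableOn ℂ f disc) :
    bergmanNorm p α (f - g) ^ p ≤
      2 ^ p * (bergmanNorm p α f ^ p + bergmanNorm p α g ^ p) := by
  simp only [bergmanNorm_rpow hp]
  rw [← mul_add, ← lintegral_add_left' (aemeasurable_areaMeasure hf.continuousOn p α),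
    mul_left_comm, ← lintegral_const_mul' (2 ^ p) _ (two_rpow_ne_top p)]
  refine mul_le_mul_right (lintegral_mono fun z => ?_) _
  exact (ENNReal.rpow_le_rpow (enorm_sub_le (a := f z) (b := g z)) hp.le).trans (add_rpow_le hp _ _)

/-- Coefficient sequences live in a countable product of compact discs, which replaces a diagonal
argument. The bounds for every `r < 1` later dominate the power series. -/
theorem exists_subseq_tendsto_taylorCoeff {p α : ℝ} (hp : 0 < p) (hα : -1 < α) {f : ℕ → ℂ → ℂ}
    (hf : ∀ n, DifferentiableOn ℂ (f n) disc) {B : ℝ≥0∞} (hB : B ≠ ∞)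
    (hfB : ∀ n, bergmanNorm p α (f n) ≤ B) :
    ∃ a : ℕ → ℂ, ∃ φ : ℕ → ℕ, StrictMono φ ∧
      (∀ k, Tendsto (fun n => taylorCoeff (f (φ n)) k) atTop (𝓝 (a k))) ∧
      ∀ r : ℝ, 0 < r → r < 1 → ∃ M : ℝ, ∀ k, (∀ n, ‖taylorCoeff (f n) k‖ * r ^ k ≤ M) ∧
        ‖a k‖ * r ^ k ≤ M := by
  have hbd : ∀ r : ℝ, 0 < r → r < 1 → ∃ M : ℝ, ∀ n k, ‖taylorCoeff (f n) k‖ * r ^ k ≤ M := by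
    intro r hr0 hr1
    obtain ⟨C, hC, h⟩ := exists_enorm_taylorCoeff_le hp hα hr0 hr1
    have hfin : C * B ≠ ∞ := ENNReal.mul_ne_top hC hB
    refine ⟨(C * B).toReal, fun n k => ?_⟩
    have h1 := (h (f n) (hf n) k).trans (mul_le_mul_right (hfB n) C)
    rw [← ofReal_norm, ← ENNReal.ofReal_pow hr0.le, ← ENNReal.ofReal_mul (norm_nonneg _)] at h1
    exact (ENNReal.ofReal_le_iff_le_toReal hfin).1 h1
  obtain ⟨M, hM⟩ := hbd (1 / 2) (by norm_num) (by norm_num)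
  have hcpt : IsCompact (univ.pi fun k : ℕ => Metric.closedBall (0 : ℂ) (M * 2 ^ k)) :=
    isCompact_univ_pi fun k => isCompact_closedBall _ _
  obtain ⟨a, -, φ, hφ, ha⟩ := hcpt.tendsto_subseq (x := fun n k => taylorCoeff (f n) k)
    fun n k _ => by
      have := hM n k
      rw [one_div, inv_pow, ← div_eq_mul_inv, div_le_iff₀ (by positivity)] at this
      simpa using this
  have ha' : ∀ k, Tendsto (fun n => taylorCoeff (f (φ n)) k) atTop (𝓝 (a k)) :=
    tendsto_pi_nhds.1 ha
  refine ⟨a, φ, hφ, ha', fun r hr0 hr1 => ?_⟩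
  obtain ⟨M, hM⟩ := hbd r hr0 hr1
  exact ⟨M, fun k => ⟨fun n => hM n k, le_of_tendsto ((ha' k).norm.mul_const _)
    (Eventually.of_forall fun n => hM (φ n) k)⟩⟩

theorem summable_of_mul_pow_le {a : ℕ → ℂ} {r M : ℝ} (hr : 0 < r) (h : ∀ k, ‖a k‖ * r ^ k ≤ M)
    {z : ℂ} (hz : ‖z‖ < r) : Summable fun k => a k * z ^ k := by
  have hg : Summable fun k : ℕ => M * (‖z‖ / r) ^ k :=
    (summable_geometric_of_lt_one (by positivity) ((div_lt_one hr).2 hz)).mul_left _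
  refine hg.of_norm_bounded fun k => ?_
  rw [norm_mul, norm_pow, div_pow, mul_div_assoc', le_div_iff₀ (by positivity)]
  calc ‖a k‖ * ‖z‖ ^ k * r ^ k = (‖a k‖ * r ^ k) * ‖z‖ ^ k := by ring
    _ ≤ M * ‖z‖ ^ k := by gcongr; exact h k

theorem exists_subseq_tendsto_radialSup {p α : ℝ} (hp : 0 < p) (hα : -1 < α) {f : ℕ → ℂ → ℂ}
    (hf : ∀ n, DifferentiableOn ℂ (f n) disc) {B : ℝ≥0∞} (hB : B ≠ ∞)
    (hfB : ∀ n, bergmanNorm p α (f n) ≤ B) :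
    ∃ F ∈ bergmanSpace p α, bergmanNorm p α F ≤ B ∧ ∃ φ : ℕ → ℕ, StrictMono φ ∧
      ∀ j, Tendsto (fun n => radialSup (f (φ n) - F) j) atTop (𝓝 0) := by
  obtain ⟨a, φ, hφ, ha, hM⟩ := exists_subseq_tendsto_taylorCoeff hp hα hf hB hfB
  have hF : ∀ z ∈ disc, HasSum (fun k => a k * z ^ k) (∑' k, a k * z ^ k) := fun z hz => by
    obtain ⟨r, hr, hr1⟩ := exists_between (mem_disc.1 hz)
    have hr0 := (norm_nonneg z).trans_lt hr
    obtain ⟨M, hM⟩ := hM r hr0 hr1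
    exact (summable_of_mul_pow_le hr0 (fun k => (hM k).2) hr).hasSum
  set F : ℂ → ℂ := fun z => ∑' k, a k * z ^ k with hFdef
  have hFd : DifferentiableOn ℂ F disc := differentiableOn_of_hasSum hF
  have key : ∀ r : ℝ, 0 < r → r < 1 → ∃ S : ℕ → ℝ, Tendsto S atTop (𝓝 0) ∧
      ∀ n, ∀ z : ℂ, ‖z‖ ≤ r → ‖f (φ n) z - F z‖ ≤ S n := by
    intro r hr0 hr1
    -- Coefficient bounds at the larger radius `r'` give a convergent geometric majorant of ratio `r
    -- / r'` on `|z| ≤ r`.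
    obtain ⟨r', hr, hr1'⟩ := exists_between hr1
    have hr0' := hr0.trans hr
    obtain ⟨M, hM⟩ := hM r' hr0' hr1'
    have hg : Summable fun k : ℕ => 2 * M * (r / r') ^ k :=
      (summable_geometric_of_lt_one (by positivity) ((div_lt_one hr0').2 hr)).mul_left _
    have hle : ∀ n k, ‖taylorCoeff (f (φ n)) k - a k‖ * r ^ k ≤ 2 * M * (r / r') ^ k := by
      intro n k
      rw [div_pow, mul_div_assoc', le_div_iff₀ (by positivity)]
      have h1 : ‖taylorCoeff (f (φ n)) k - a k‖ * r' ^ k ≤ 2 * M := by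
        have h2 := mul_le_mul_of_nonneg_right (norm_sub_le (taylorCoeff (f (φ n)) k) (a k))
          (pow_nonneg hr0'.le k)
        rw [add_mul] at h2
        linarith [(hM k).1 (φ n), (hM k).2]
      calc _ = (‖taylorCoeff (f (φ n)) k - a k‖ * r' ^ k) * r ^ k := by ring
        _ ≤ _ := by gcongr
    have hnn : ∀ n k, 0 ≤ ‖taylorCoeff (f (φ n)) k - a k‖ * r ^ k := fun n k => by positivity
    refine ⟨fun n => ∑' k, ‖taylorCoeff (f (φ n)) k - a k‖ * r ^ k, ?_, fun n z hz => ?_⟩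
    · have h0 : Tendsto (fun n => ∑' k, ‖taylorCoeff (f (φ n)) k - a k‖ * r ^ k) atTop
          (𝓝 (∑' _ : ℕ, (0 : ℝ))) := by
        refine tendsto_tsum_of_dominated_convergence hg (fun k => ?_)
          (Eventually.of_forall fun n k => ?_)
        · have h1 := (((ha k).sub_const (a k)).norm).mul_const (r ^ k)
          simpa using h1
        · rw [Real.norm_of_nonneg (hnn n k)]
          exact hle n k
      simpa using h0
    · have hzd : z ∈ disc := mem_disc.2 (hz.trans_lt hr1)
      have h1 := (hasSum_taylorCoeff (hf (φ n)) hzd).sub (hF z hzd)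
      have hs : Summable fun k => ‖taylorCoeff (f (φ n)) k - a k‖ * r ^ k :=
        Summable.of_nonneg_of_le (hnn n) (hle n) hg
      rw [← h1.tsum_eq]
      refine tsum_of_norm_bounded hs.hasSum fun k => ?_
      rw [← sub_mul, norm_mul, norm_pow]
      gcongr
  have hpt : ∀ z ∈ disc, Tendsto (fun n => f (φ n) z) atTop (𝓝 (F z)) := fun z hz => by
    obtain ⟨r, hr, hr1⟩ := exists_between (mem_disc.1 hz)
    obtain ⟨S, hS, h⟩ := key r ((norm_nonneg z).trans_lt hr) hr1
    exact tendsto_iff_norm_sub_tendsto_zero.2 (squeeze_zero (fun _ => norm_nonneg _)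
      (fun n => h n z hr.le) hS)
  have hFB := bergmanNorm_le_of_tendsto hp (fun n => hf (φ n)) hpt fun n => hfB (φ n)
  refine ⟨F, ⟨hFd, hFB.trans_lt hB.lt_top⟩, hFB, φ, hφ, fun j => ?_⟩
  have hj : (0 : ℝ) < (1 / 2) ^ (j + 1) := by positivity
  have hj1 : (1 / 2 : ℝ) ^ (j + 1) < 1 := pow_lt_one₀ (by norm_num) (by norm_num) (by omega)
  obtain ⟨S, hS, h⟩ := key (1 - (1 / 2) ^ (j + 1)) (by linarith) (by linarith)
  have hS' := ENNReal.tendsto_ofReal hS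
  rw [ENNReal.ofReal_zero] at hS'
  refine tendsto_of_tendsto_of_tendsto_of_le_of_le tendsto_const_nhds hS' (fun _ => zero_le)
    fun n => iSup₂_le fun t ht => ?_
  rw [← ofReal_norm]
  refine ENNReal.ofReal_le_ofReal (h n _ ?_)
  rw [Complex.norm_real, Real.norm_of_nonneg (dyadic_bounds ht).1]
  linarith [ht.1]

/-! ### Weighted sequence estimates -/

/-- Keep one factor `x j ^ p` and bound its remaining power `q / p - 1` by that of the whole sum. -/
theorem tsum_rpow_le {p q : ℝ} (hp : 0 < p) (hpq : p ≤ q) (x : ℕ → ℝ≥0∞) :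
    ∑' j, x j ^ q ≤ (∑' j, x j ^ p) ^ (q / p) := by
  have h1 : 0 ≤ q / p - 1 := by rw [sub_nonneg, le_div_iff₀ hp]; linarith
  have e : ∀ y : ℝ≥0∞, y ^ (q / p) = y * y ^ (q / p - 1) := fun y => by
    conv_lhs => rw [show q / p = 1 + (q / p - 1) by ring]
    rw [ENNReal.rpow_add_of_nonneg _ _ zero_le_one h1, ENNReal.rpow_one]
  rw [e, ← ENNReal.tsum_mul_right]
  refine ENNReal.tsum_le_tsum fun j => ?_
  have e2 : x j ^ q = (x j ^ p) ^ (q / p) := by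
    rw [← ENNReal.rpow_mul, mul_div_cancel₀ _ hp.ne']
  rw [e2, e]
  gcongr
  exact ENNReal.le_tsum j

/-- Compactness of a diagonal operator: the tail is small uniformly in `n` because `W` is, and
finitely many coordinates tend to zero. -/
theorem tendsto_tsum_mul_rpow {q : ℝ} (hq : 0 < q) {x : ℕ → ℕ → ℝ≥0∞} {W : ℕ → ℝ≥0∞} {A : ℝ≥0∞}
    (hA : A ≠ ∞) (hxA : ∀ n, ∑' j, x n j ^ q ≤ A)
    (hx : ∀ j, Tendsto (fun n => x n j) atTop (𝓝 0)) (hW : Tendsto W atTop (𝓝 0))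
    (hfin : ∀ j, W j ≠ ∞) : Tendsto (fun n => ∑' j, (x n j * W j) ^ q) atTop (𝓝 0) := by
  have hrp : Tendsto (fun y : ℝ≥0∞ => y ^ q) (𝓝 0) (𝓝 0) := by
    have := (ENNReal.continuous_rpow_const (y := q)).tendsto 0
    rwa [ENNReal.zero_rpow_of_pos hq] at this
  rw [ENNReal.tendsto_nhds_zero]
  intro ε hε
  -- `A + 1` instead of `A` avoids division by zero.
  set δ := ε / 2 / (A + 1) with hδ
  have hA1 : A + 1 ≠ ∞ := ENNReal.add_ne_top.2 ⟨hA, ENNReal.one_ne_top⟩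
  have hδ0 : 0 < δ := ENNReal.div_pos (ENNReal.half_pos hε.ne').ne' hA1
  obtain ⟨J, hJ⟩ := eventually_atTop.1 ((ENNReal.tendsto_nhds_zero.1 (hrp.comp hW)) δ hδ0)
  have hfinite : Tendsto (fun n => ∑ j ∈ Finset.range J, (x n j * W j) ^ q) atTop (𝓝 0) := by
    rw [← Finset.sum_const_zero (s := Finset.range J)]
    refine tendsto_finsetSum _ fun j _ => hrp.comp ?_
    have := ENNReal.Tendsto.mul_const (b := W j) (hx j) (Or.inr (hfin j))
    rwa [zero_mul] at this
  filter_upwards [(ENNReal.tendsto_nhds_zero.1 hfinite) (ε / 2) (ENNReal.half_pos hε.ne')] with n hn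
  rw [← Summable.sum_add_tsum_nat_add' (k := J) ENNReal.summable, ← ENNReal.add_halves ε]
  refine add_le_add hn ?_
  calc ∑' j, (x n (j + J) * W (j + J)) ^ q ≤ ∑' j, x n (j + J) ^ q * δ := by
        refine ENNReal.tsum_le_tsum fun j => ?_
        rw [ENNReal.mul_rpow_of_nonneg _ _ hq.le]
        exact mul_le_mul_right (hJ (j + J) (by omega)) _
    _ = (∑' j, x n (j + J) ^ q) * δ := ENNReal.tsum_mul_right
    _ ≤ (A + 1) * δ := by
        refine mul_le_mul_left (le_trans ?_ ((hxA n).trans le_self_add)) _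
        exact ENNReal.tsum_comp_le_tsum_of_injective (add_left_injective J) _
    _ = ε / 2 := ENNReal.mul_div_cancel (by simp) hA1

/-! ### Sufficiency -/

/-- Shared by `q > 1` and `q = 1`, which enter through their weights `W` and their proofs of
domination. The estimate is applied to `f (φ n) - F`, whose radial maxima tend to zero on each
dyadic interval. -/
theorem isCompactHilbert_of_estimate {μ : Measure (Ico (0 : ℝ) 1)} [IsFiniteMeasure μ] {p q α : ℝ}
    (hp : 0 < p) (hpq : p ≤ q) (hα : -1 < α) {W : ℕ → ℝ≥0∞} (hW : Tendsto W atTop (𝓝 0))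
    (hWfin : ∀ j, W j ≠ ∞) {C : ℝ≥0∞} (hC : C ≠ ∞)
    (hest : ∀ f : ℂ → ℂ, ∫⁻ z, ‖hilbertFun μ (α + 2) f z‖ₑ ^ q ∂areaMeasure α ≤
      C * ∑' j : ℕ, (radialSup f j * 2 ^ (-(j * ((α + 2) / p))) * W j) ^ q)
    (hdom : ∀ f ∈ bergmanSpace p α, IsDominated μ f) :
    IsCompactHilbert μ (α + 2) p α q α := by
  have hq : 0 < q := hp.trans_le hpq
  have hβ : 0 < α + 2 := by linarith
  obtain ⟨C₁, hC₁, hrad⟩ := exists_tsum_radialSup_le hp hα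
  obtain ⟨K, hK, hWK⟩ := exists_bound_of_tendsto_zero hW hWfin
  have hsum : ∀ f : ℂ → ℂ, DifferentiableOn ℂ f disc →
      ∑' j : ℕ, (radialSup f j * 2 ^ (-(j * ((α + 2) / p)))) ^ q ≤
        (C₁ * bergmanNorm p α f ^ p) ^ (q / p) := fun f hf =>
    (tsum_rpow_le hp hpq _).trans (ENNReal.rpow_le_rpow (hrad f hf) (by positivity))
  have hmem : ∀ f ∈ bergmanSpace p α, hilbertFun μ (α + 2) f ∈ bergmanSpace q α := by
    intro f hf
    refine ⟨differentiableOn_hilbertFun hβ hf.1.continuousOn ((hdom f hf).integrable hf.1), ?_⟩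
    rw [bergmanNorm_eq]
    refine (ENNReal.rpow_ne_top_of_nonneg (by positivity)
      (ENNReal.mul_ne_top (normalizer_ne_top α) ?_)).lt_top
    refine ne_top_of_le_ne_top ?_ (hest f)
    refine ENNReal.mul_ne_top hC ?_
    have h1 : ∑' j : ℕ, (radialSup f j * 2 ^ (-(j * ((α + 2) / p))) * W j) ^ q ≤
        (∑' j : ℕ, (radialSup f j * 2 ^ (-(j * ((α + 2) / p)))) ^ q) * K ^ q := by
      rw [← ENNReal.tsum_mul_right]
      refine ENNReal.tsum_le_tsum fun j => ?_
      rw [ENNReal.mul_rpow_of_nonneg _ _ hq.le]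
      exact mul_le_mul_right (ENNReal.rpow_le_rpow (hWK j) hq.le) _
    refine ne_top_of_le_ne_top ?_ h1
    have hn : bergmanNorm p α f ≠ ∞ := hf.2.ne
    refine ENNReal.mul_ne_top (ne_top_of_le_ne_top ?_ (hsum f hf.1)) (by finiteness)
    exact ENNReal.rpow_ne_top_of_nonneg (by positivity) (ENNReal.mul_ne_top hC₁
      (ENNReal.rpow_ne_top_of_nonneg hp.le hn))
  refine ⟨fun f hf => ⟨_, hmem f hf, (hdom f hf).isHilbertImage hβ hf.1⟩, ?_⟩
  rintro f g hf ⟨B, hB, hfB⟩ hg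
  obtain ⟨F, hF, hFB, φ, hφ, hlim⟩ :=
    exists_subseq_tendsto_radialSup hp hα (fun n => (hf n).1) hB.ne hfB
  refine ⟨hilbertFun μ (α + 2) F, hmem F hF, φ, hφ, ?_⟩
  have hcongr : ∀ n, bergmanNorm q α (g (φ n) - hilbertFun μ (α + 2) F) =
      bergmanNorm q α (hilbertFun μ (α + 2) (f (φ n) - F)) := fun n =>
    bergmanNorm_congr fun z hz => by
      rw [hilbertFun_sub hβ ((hdom _ (hf (φ n))).integrable (hf (φ n)).1)
        ((hdom F hF).integrable hF.1) hz, Pi.sub_apply,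
        (hdom _ (hf (φ n))).eqOn_of_isHilbertImage hβ (hf (φ n)).1 (hg (φ n)) hz]
  set A := (C₁ * (2 ^ p * (B ^ p + B ^ p))) ^ (q / p) with hA
  have hAfin : A ≠ ∞ := by
    have hB' := hB.ne
    refine ENNReal.rpow_ne_top_of_nonneg (by positivity) (ENNReal.mul_ne_top hC₁ ?_)
    have : B ^ p ≠ ∞ := ENNReal.rpow_ne_top_of_nonneg hp.le hB'
    exact ENNReal.mul_ne_top (two_rpow_ne_top p) (ENNReal.add_ne_top.2 ⟨this, this⟩)
  have hseq := tendsto_tsum_mul_rpow (W := W) hq hAfin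
    (x := fun n j => radialSup (f (φ n) - F) j * 2 ^ (-(j * ((α + 2) / p))))
    (fun n => (hsum _ ((hf (φ n)).1.sub hF.1)).trans (ENNReal.rpow_le_rpow
      (mul_le_mul_right ((bergmanNorm_sub_rpow_le hp (hf (φ n)).1).trans (by
        gcongr
        exact hfB (φ n))) _) (by positivity)))
    (fun j => by
      have := ENNReal.Tendsto.mul_const (b := (2 : ℝ≥0∞) ^ (-(j * ((α + 2) / p)))) (hlim j)
        (Or.inr (two_rpow_ne_top _))
      rwa [zero_mul] at this)
    hW hWfin
  have hup : Tendsto (fun n => (normalizer α * (C * ∑' j : ℕ,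
      (radialSup (f (φ n) - F) j * 2 ^ (-(j * ((α + 2) / p))) * W j) ^ q)) ^ (1 / q)) atTop
      (𝓝 0) := by
    have h1 := ENNReal.Tendsto.const_mul (a := C) hseq (Or.inr hC)
    have h2 := ENNReal.Tendsto.const_mul (a := normalizer α) h1 (Or.inr (normalizer_ne_top α))
    have h3 := ((ENNReal.continuous_rpow_const (y := 1 / q)).tendsto _).comp h2
    rw [mul_zero, mul_zero, ENNReal.zero_rpow_of_pos (by positivity)] at h3
    exact h3
  refine tendsto_of_tendsto_of_tendsto_of_le_of_le tendsto_const_nhds hup (fun _ => zero_le)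
    fun n => ?_
  simp only [hcongr]
  rw [bergmanNorm_eq]
  exact ENNReal.rpow_le_rpow (mul_le_mul_right (hest _) _) (by positivity)

theorem StandingCondition.isFiniteMeasure {μ : Measure (Ico (0 : ℝ) 1)} {p α : ℝ}
    (h : StandingCondition μ p α) : IsFiniteMeasure μ := by
  rcases le_total p 1 with h1 | h1
  · exact (h.le_one h1).isFiniteMeasure
  · rcases le_total p 2 with h2 | h2
    · exact (h.one_le_two h1 h2).isFiniteMeasure
    · exact (h.two_le h2).isFiniteMeasure

theorem dyadicMass_ne_top (μ : Measure (Ico (0 : ℝ) 1)) [IsFiniteMeasure μ] (j : ℕ) :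
    dyadicMass μ j ≠ ∞ :=
  measure_ne_top _ _

theorem IsVanishingCarleson.isCompactHilbert {μ : Measure (Ico (0 : ℝ) 1)} [IsFiniteMeasure μ]
    {p q α : ℝ} (hp : 0 < p) (hpq : p ≤ q) (hq : 1 < q) (hα : -1 < α)
    (h : IsVanishingCarleson μ ((α + 2) / p + (α + 2) * (1 - 1 / q))) :
    IsCompactHilbert μ (α + 2) p α q α := by
  have hW := h.tendsto_dyadicMass
  have hfin : ∀ j : ℕ, dyadicMass μ j * 2 ^ (j * ((α + 2) / p + (α + 2) * (1 - 1 / q))) ≠ ∞ :=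
    fun j => ENNReal.mul_ne_top (dyadicMass_ne_top μ j) (two_rpow_ne_top _)
  obtain ⟨C, hC, hest⟩ := exists_lintegral_hilbertFun_le_of_one_lt ((α + 2) / p) hq hα
  obtain ⟨K, hK, hWK⟩ := exists_bound_of_tendsto_zero hW hfin
  have hσ : 0 < (α + 2) * (1 - 1 / q) := by
    refine mul_pos (by linarith) ?_
    rw [sub_pos, div_lt_one (by linarith)]
    exact hq
  exact isCompactHilbert_of_estimate hp hpq hα hW hfin hC (hest μ) fun f hf =>
    isDominated_of_dyadicMass hp hα (by linarith) hK hWK hf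

theorem IsVanishingLogCarleson.isCompactHilbert {μ : Measure (Ico (0 : ℝ) 1)} [IsFiniteMeasure μ]
    {p α : ℝ} (hp : 0 < p) (hp1 : p ≤ 1) (hα : -1 < α) (hμ : IsCarleson μ ((α + 2) / p))
    (h : IsVanishingLogCarleson μ 1 ((α + 2) / p)) : IsCompactHilbert μ (α + 2) p α 1 α := by
  obtain ⟨C, hC, hest⟩ := exists_lintegral_hilbertFun_le_of_eq_one ((α + 2) / p) hα
  exact isCompactHilbert_of_estimate hp hp1 hα h.tendsto_dyadicMass
    (fun j => ENNReal.mul_ne_top (ENNReal.mul_ne_top (by finiteness) (dyadicMass_ne_top μ j))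
      (two_rpow_ne_top _)) hC (hest μ)
    fun f hf => isDominated_of_isCarleson hp hp1 hα hμ hf

/-! ### Test functions -/

/-- The function `(1 - a) ^ s / (1 - a z) ^ (2 s)`. -/
noncomputable def testFun (s a : ℝ) (z : ℂ) : ℂ :=
  (((1 - a) ^ s : ℝ) : ℂ) * (1 / (1 - (a : ℂ) * z) ^ ((2 * s : ℝ) : ℂ))

theorem norm_ofReal_mul_lt {a : ℝ} (ha : a ∈ Ico (0 : ℝ) 1) {z : ℂ} (hz : z ∈ disc) :
    ‖(a : ℂ) * z‖ < 1 :=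
  norm_ofReal_mul_lt_one hz ⟨a, ha⟩

theorem hasSum_testFun {s a : ℝ} (hs : 0 < s) (ha : a ∈ Ico (0 : ℝ) 1) :
    ∀ z ∈ disc, HasSum (fun k : ℕ =>
      (((1 - a) ^ s * (binomCoeff (2 * s) k * a ^ k) : ℝ) : ℂ) * z ^ k) (testFun s a z) := by
  intro z hz
  have h := (hasSum_binomCoeff (β := 2 * s) (by positivity) (norm_ofReal_mul_lt ha hz)).mul_left
    (((1 - a) ^ s : ℝ) : ℂ)
  refine h.congr_fun fun k => ?_
  push_cast
  rw [mul_pow]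
  ring

theorem differentiableOn_testFun {s a : ℝ} (hs : 0 < s) (ha : a ∈ Ico (0 : ℝ) 1) :
    DifferentiableOn ℂ (testFun s a) disc :=
  differentiableOn_of_hasSum (hasSum_testFun hs ha)

theorem testFun_ofReal {s a : ℝ} (hs : 0 < s) (ha : a ∈ Ico (0 : ℝ) 1) {t : ℝ}
    (ht : t ∈ Ico (0 : ℝ) 1) :
    testFun s a t = (((1 - a) ^ s * (1 - a * t) ^ (-(2 * s)) : ℝ) : ℂ) := by
  have h1 := hasSum_testFun hs ha t (ofReal_mem_disc ht.1 ht.2)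
  have h2 := (hasSum_binomCoeff_real (β := 2 * s) (by positivity) (mul_nonneg ha.1 ht.1)
    (mul_lt_one_of_nonneg_of_lt_one_left ha.1 ha.2 ht.2.le)).mul_left ((1 - a) ^ s)
  refine h1.unique ((Complex.hasSum_ofReal.2 h2).congr_fun fun k => ?_)
  push_cast
  rw [mul_pow]
  ring

/-- The coefficients are nonnegative and summable, so a constant dominates and finiteness of `μ`
suffices. -/
theorem isDominated_testFun {μ : Measure (Ico (0 : ℝ) 1)} [IsFiniteMeasure μ] {s a : ℝ}
    (hs : 0 < s) (ha : a ∈ Ico (0 : ℝ) 1) : IsDominated μ (testFun s a) := by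
  have hsum := (hasSum_binomCoeff_real (β := 2 * s) (by positivity) ha.1 ha.2).mul_left
    ((1 - a) ^ s)
  have h1a : 0 < 1 - a := by linarith [ha.2]
  have hnn : ∀ k : ℕ, 0 ≤ (1 - a) ^ s * (binomCoeff (2 * s) k * a ^ k) := fun k => by
    have h1 := Real.rpow_pos_of_pos h1a s
    have h2 := binomCoeff_pos (β := 2 * s) (by positivity) k
    have h3 := ha.1
    positivity
  refine ⟨fun _ => (1 - a) ^ s * (1 - a) ^ (-(2 * s)), integrable_const _, fun N t => ?_⟩
  refine (norm_sum_le _ _).trans (le_trans (Finset.sum_le_sum fun k _ => ?_)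
    (sum_le_hasSum (Finset.range N) (fun k _ => hnn k) hsum))
  rw [taylorCoeff_of_hasSum (hasSum_testFun hs ha), norm_mul, Complex.norm_real,
    Real.norm_of_nonneg (hnn k), norm_pow, Complex.norm_real, Real.norm_of_nonneg t.2.1]
  exact mul_le_of_le_one_right (hnn k) (pow_le_one₀ t.2.1 t.2.2.le)

/-- For `a` in the `j`-th dyadic interval, the contribution of the `i`-th shell is of order `2 ^ ((α
+ 2)(2 min(i, j) - j - i))`, and `2 min(i, j) - j - i = -|i - j|`. -/
theorem exists_bergmanNorm_testFun_le {p α : ℝ} (hp : 0 < p) (hα : -1 < α) :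
    ∃ C : ℝ≥0∞, C ≠ ∞ ∧ ∀ a ∈ Ico (0 : ℝ) 1, bergmanNorm p α (testFun ((α + 2) / p) a) ≤ C := by
  have hβ : 0 < α + 2 := by linarith
  set s := (α + 2) / p with hs
  have hs0 : 0 < s := div_pos hβ hp
  have hsp : s * p = α + 2 := div_mul_cancel₀ _ hp.ne'
  obtain ⟨C₁, hC₁, h₁⟩ := exists_lintegral_le_tsum hα
  obtain ⟨C₂, hC₂, h₂⟩ := exists_tsum_two_rpow_le hβ
  refine ⟨(normalizer α * (C₁ * (2 ^ (2 * (α + 2)) * C₂))) ^ (1 / p), ?_, fun a ha => ?_⟩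
  · exact ENNReal.rpow_ne_top_of_nonneg (by positivity) (ENNReal.mul_ne_top (normalizer_ne_top α)
      (ENNReal.mul_ne_top hC₁ (ENNReal.mul_ne_top (two_rpow_ne_top _) hC₂)))
  obtain ⟨j, hj⟩ := exists_mem_dyadic ha
  have h1a : 0 < 1 - a := by linarith [ha.2]
  rw [bergmanNorm_eq]
  refine ENNReal.rpow_le_rpow (mul_le_mul_right ?_ _) (by positivity)
  refine (h₁ _ (fun i => 2 ^ (2 * (α + 2) + (2 * (min i j : ℕ) - j) * (α + 2))) ?_).trans ?_
  · rintro i z ⟨hz, hzd⟩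
    have h3 : ‖testFun s a z‖ₑ ≤ 2 ^ (-(j * s)) * (2 ^ (2 * s) * 2 ^ (2 * s * (min i j : ℕ))) := by
      rw [testFun, enorm_mul]
      refine mul_le_mul' ?_ ?_
      · rw [← ofReal_norm, Complex.norm_real, Real.norm_of_nonneg (Real.rpow_nonneg h1a.le _),
          ← ofReal_half_pow_rpow]
        exact ENNReal.ofReal_le_ofReal (Real.rpow_le_rpow h1a.le hj.2 hs0.le)
      · rw [← ofReal_norm, norm_one_div_cpow (norm_ofReal_mul_lt ha hzd)]
        exact ofReal_norm_rpow_le (by positivity) hj hz hzd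
    refine (ENNReal.rpow_le_rpow h3 hp.le).trans_eq ?_
    rw [← two_rpow_add, ← two_rpow_add, ← ENNReal.rpow_mul, ← hsp]
    congr 1
    ring
  · refine mul_le_mul_right ?_ _
    refine le_trans ?_ (mul_le_mul_right (h₂ j) _)
    rw [← ENNReal.tsum_mul_left]
    refine ENNReal.tsum_le_tsum fun i => ?_
    rw [← two_rpow_add, ← two_rpow_add]
    apply two_rpow_le
    rcases le_total i j with hij | hij
    · have hij' : (i : ℝ) ≤ j := by exact_mod_cast hij
      rw [min_eq_left hij, abs_of_nonneg (by linarith)]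
      linarith
    · have hij' : (j : ℝ) ≤ i := by exact_mod_cast hij
      rw [min_eq_right hij, abs_of_nonpos (by linarith)]
      linarith

/-- The integrand is nonnegative, so it may be restricted to `t ≥ a`, where `t ^ n ≥ a ^ n` and `1 -
a t ≤ 2 (1 - a)`. -/
theorem exists_hilbertCoeff_testFun {μ : Measure (Ico (0 : ℝ) 1)} [IsFiniteMeasure μ] {s β a : ℝ}
    (hs : 0 < s) (hβ : 0 < β) (ha : a ∈ Ico (0 : ℝ) 1) :
    ∃ c : ℕ → ℝ, (∀ n, hilbertCoeff μ β (testFun s a) n = c n) ∧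
      ∀ n, binomCoeff β n * a ^ n * (2 ^ (-(2 * s)) * (1 - a) ^ (-s) * (tail μ a).toReal) ≤ c n := by
  have h1a : 0 < 1 - a := by linarith [ha.2]
  have hat : ∀ t : Ico (0 : ℝ) 1, 1 - a ≤ 1 - a * t := fun t => by
    have := mul_le_of_le_one_right ha.1 t.2.2.le
    linarith
  set F : ℕ → Ico (0 : ℝ) 1 → ℝ := fun n t =>
    binomCoeff β n * (t : ℝ) ^ n * ((1 - a) ^ s * (1 - a * t) ^ (-(2 * s))) with hF
  have hFnn : ∀ n t, 0 ≤ F n t := fun n t => by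
    have h1 := Real.rpow_pos_of_pos h1a s
    have h2 := binomCoeff_pos hβ n
    have h3 := t.2.1
    have h4 : 0 ≤ (1 - a * (t : ℝ)) ^ (-(2 * s)) := Real.rpow_nonneg (h1a.le.trans (hat t)) _
    positivity
  have hFint : ∀ n, Integrable (F n) μ := fun n => by
    refine Integrable.of_bound (C := binomCoeff β n * ((1 - a) ^ s * (1 - a) ^ (-(2 * s))))
      (Measurable.aestronglyMeasurable (by fun_prop)) (Eventually.of_forall fun t => ?_)
    rw [Real.norm_of_nonneg (hFnn n t)]
    have h1 := Real.rpow_pos_of_pos h1a s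
    have h2 := binomCoeff_pos hβ n
    have h3 := t.2.1
    have h4 : 0 ≤ (1 - a * (t : ℝ)) ^ (-(2 * s)) := Real.rpow_nonneg (h1a.le.trans (hat t)) _
    have h5 : (1 - a * (t : ℝ)) ^ (-(2 * s)) ≤ (1 - a) ^ (-(2 * s)) :=
      Real.rpow_le_rpow_of_nonpos h1a (hat t) (by linarith)
    exact mul_le_mul (mul_le_of_le_one_right h2.le (pow_le_one₀ t.2.1 t.2.2.le))
      (mul_le_mul_of_nonneg_left h5 h1.le) (by positivity) h2.le
  refine ⟨fun n => ∫ t, F n t ∂μ, fun n => ?_, fun n => ?_⟩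
  · rw [hilbertCoeff, ← integral_complex_ofReal]
    refine integral_congr_ae (Eventually.of_forall fun t => ?_)
    simp only [hF]
    rw [testFun_ofReal hs ha t.2]
    push_cast
    ring
  · have hS : MeasurableSet {t : Ico (0 : ℝ) 1 | a ≤ (t : ℝ)} :=
      measurableSet_le measurable_const measurable_subtype_coe
    refine le_trans ?_ (setIntegral_le_integral (s := {t : Ico (0 : ℝ) 1 | a ≤ (t : ℝ)}) (hFint n)
      (Eventually.of_forall (hFnn n)))
    have h1 : ∫ _ in {t : Ico (0 : ℝ) 1 | a ≤ (t : ℝ)},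
        binomCoeff β n * a ^ n * (2 ^ (-(2 * s)) * (1 - a) ^ (-s)) ∂μ ≤
        ∫ t in {t : Ico (0 : ℝ) 1 | a ≤ (t : ℝ)}, F n t ∂μ := by
      refine setIntegral_mono_on (integrable_const _) (hFint n).integrableOn hS fun t ht => ?_
      have ht' : a ≤ (t : ℝ) := ht
      have h2 := binomCoeff_pos hβ n
      have h3 := ha.1
      have h4 : 1 - a * (t : ℝ) ≤ 2 * (1 - a) := by nlinarith [ha.2]
      have h5 : (2 * (1 - a)) ^ (-(2 * s)) ≤ (1 - a * (t : ℝ)) ^ (-(2 * s)) :=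
        Real.rpow_le_rpow_of_nonpos (h1a.trans_le (hat t)) h4 (by linarith)
      have h6 : (2 : ℝ) ^ (-(2 * s)) * (1 - a) ^ (-s) = (1 - a) ^ s * (2 * (1 - a)) ^ (-(2 * s)) := by
        rw [Real.mul_rpow two_pos.le h1a.le, mul_left_comm, ← Real.rpow_add h1a]
        congr 2
        ring
      rw [h6]
      have h7 := Real.rpow_pos_of_pos h1a s
      have h8 : 0 ≤ (2 * (1 - a)) ^ (-(2 * s)) := by positivity
      have h9 : 0 ≤ (t : ℝ) := t.2.1
      simp only [hF]
      gcongr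
    refine le_trans (le_of_eq ?_) h1
    rw [setIntegral_const, smul_eq_mul, tail, measureReal_def]
    ring

/-! ### Necessity -/

theorem ofReal_rpow_neg {x : ℝ} (hx : 0 < x) (y : ℝ) :
    ENNReal.ofReal (x ^ (-y)) = (ENNReal.ofReal (x ^ y))⁻¹ := by
  rw [Real.rpow_neg hx.le, ENNReal.ofReal_inv_of_pos (Real.rpow_pos_of_pos hx _)]

theorem tail_ne_top (μ : Measure (Ico (0 : ℝ) 1)) [IsFiniteMeasure μ] (a : ℝ) : tail μ a ≠ ∞ :=
  measure_ne_top _ _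

/-- Summing the coefficient bounds at `z = a` gives `(1 - a ^ 2) ^ (-β)`, which is at least `(2 (1 -
a)) ^ (-β)`. -/
theorem mul_tail_le_enorm_image {μ : Measure (Ico (0 : ℝ) 1)} [IsFiniteMeasure μ] {s β a : ℝ}
    (hs : 0 < s) (hβ : 0 < β) (ha : a ∈ Ico (0 : ℝ) 1) {g : ℂ → ℂ}
    (hg : IsHilbertImage μ β (testFun s a) g) :
    ENNReal.ofReal (2 ^ (-(2 * s + β)) * (1 - a) ^ (-(s + β))) * tail μ a ≤ ‖g a‖ₑ := by
  have h1a : 0 < 1 - a := by linarith [ha.2]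
  obtain ⟨c, hc, hcle⟩ := exists_hilbertCoeff_testFun (μ := μ) hs hβ ha
  have h1 := (isDominated_testFun hs ha).hasSum_of_isHilbertImage hβ
    (differentiableOn_testFun hs ha) hg a (ofReal_mem_disc ha.1 ha.2)
  simp only [hc] at h1
  set K := (2 : ℝ) ^ (-(2 * s)) * (1 - a) ^ (-s) * (tail μ a).toReal with hK
  have hK0 : 0 ≤ K := by
    have := Real.rpow_pos_of_pos h1a (-s)
    positivity
  have haa : a * a < 1 := mul_lt_one_of_nonneg_of_lt_one_left ha.1 ha.2 ha.2.le
  have h2 := (hasSum_binomCoeff_real hβ (mul_nonneg ha.1 ha.1) haa).mul_right K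
  have h3 : HasSum (fun n => c n * a ^ n) (g a).re := by
    refine (Complex.hasSum_re h1).congr_fun fun n => ?_
    rw [← Complex.ofReal_pow, ← Complex.ofReal_mul, Complex.ofReal_re]
  have h4 : (1 - a * a) ^ (-β) * K ≤ (g a).re := by
    refine hasSum_le (fun n => ?_) h2 h3
    have := mul_le_mul_of_nonneg_right (hcle n) (pow_nonneg ha.1 n)
    calc binomCoeff β n * (a * a) ^ n * K = binomCoeff β n * a ^ n * K * a ^ n := by
          rw [mul_pow]
          ring
      _ ≤ _ := this
  have h5 : (2 * (1 - a)) ^ (-β) ≤ (1 - a * a) ^ (-β) :=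
    Real.rpow_le_rpow_of_nonpos (by linarith) (by nlinarith [ha.1]) (by linarith)
  rw [← ofReal_norm, ← ENNReal.ofReal_toReal (tail_ne_top μ a),
    ← ENNReal.ofReal_mul (by positivity)]
  refine ENNReal.ofReal_le_ofReal (le_trans ?_ ((mul_le_mul_of_nonneg_right h5 hK0).trans
    (h4.trans ((le_abs_self _).trans (Complex.abs_re_le_norm _)))))
  rw [hK, Real.mul_rpow two_pos.le h1a.le, neg_add, neg_add, Real.rpow_add two_pos,
    Real.rpow_add h1a]
  apply le_of_eq
  ring

/-- Compactness only yields subsequences, and these suffice. A sequence tending to `1` from the left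
may leave `[0, 1)` at finitely many indices, where it is replaced by `0`. -/
theorem tendsto_zero_of_forall_seq {Φ : ℝ → ℝ≥0∞}
    (h : ∀ a : ℕ → ℝ, (∀ n, a n ∈ Ico (0 : ℝ) 1) → Tendsto a atTop (𝓝[<] 1) →
      ∃ φ : ℕ → ℕ, StrictMono φ ∧ Tendsto (fun n => Φ (a (φ n))) atTop (𝓝 0)) :
    Tendsto Φ (𝓝[<] 1) (𝓝 0) := by
  classical
  refine tendsto_of_subseq_tendsto fun a ha => ?_
  have hev : ∀ᶠ n in atTop, a n ∈ Ico (0 : ℝ) 1 :=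
    ha.eventually (Ico_mem_nhdsLT (by norm_num))
  have heq : a =ᶠ[atTop] fun n => if a n ∈ Ico (0 : ℝ) 1 then a n else 0 := by
    filter_upwards [hev] with n hn
    rw [if_pos hn]
  obtain ⟨φ, hφ, hlim⟩ := h (fun n => if a n ∈ Ico (0 : ℝ) 1 then a n else 0)
    (fun n => by
      by_cases hn : a n ∈ Ico (0 : ℝ) 1
      · simpa only [if_pos hn] using hn
      · simp only [if_neg hn]
        norm_num) (ha.congr' heq)
  refine ⟨φ, hlim.congr' ?_⟩
  filter_upwards [hφ.tendsto_atTop.eventually heq] with n hn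
  rw [← hn]

theorem IsCompactHilbert.exists_testFun_limit {μ : Measure (Ico (0 : ℝ) 1)} {p q α β : ℝ}
    (hp : 0 < p) (hα : -1 < α) (h : IsCompactHilbert μ β p α q α) {a : ℕ → ℝ}
    (ha : ∀ n, a n ∈ Ico (0 : ℝ) 1) :
    ∃ g : ℕ → ℂ → ℂ, ∃ F ∈ bergmanSpace q α, ∃ φ : ℕ → ℕ, StrictMono φ ∧
      (∀ n, DifferentiableOn ℂ (g n) disc) ∧
      (∀ n, IsHilbertImage μ β (testFun ((α + 2) / p) (a n)) (g n)) ∧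
      Tendsto (fun n => bergmanNorm q α (g (φ n) - F)) atTop (𝓝 0) := by
  have hs : 0 < (α + 2) / p := div_pos (by linarith) hp
  obtain ⟨C, hC, hCle⟩ := exists_bergmanNorm_testFun_le hp hα
  have hmem : ∀ n, testFun ((α + 2) / p) (a n) ∈ bergmanSpace p α := fun n =>
    ⟨differentiableOn_testFun hs (ha n), (hCle _ (ha n)).trans_lt hC.lt_top⟩
  choose g hg hgi using fun n => h.maps _ (hmem n)
  obtain ⟨F, hF, φ, hφ, hlim⟩ := h.compact _ g hmem ⟨C, hC.lt_top, fun n => hCle _ (ha n)⟩ hgi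
  exact ⟨g, F, hF, φ, hφ, fun n => (hg n).1, hgi, hlim⟩

theorem IsCompactHilbert.isVanishingCarleson {μ : Measure (Ico (0 : ℝ) 1)} [IsFiniteMeasure μ]
    {p q α : ℝ} (hp : 0 < p) (hq : 0 < q) (hα : -1 < α)
    (h : IsCompactHilbert μ (α + 2) p α q α) :
    IsVanishingCarleson μ ((α + 2) / p + (α + 2) * (1 - 1 / q)) := by
  have hβ : 0 < α + 2 := by linarith
  set s := (α + 2) / p with hs
  have hs0 : 0 < s := div_pos hβ hp
  refine tendsto_zero_of_forall_seq fun a ha halim => ?_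
  obtain ⟨g, F, hF, φ, hφ, hgd, hgi, hlim⟩ := h.exists_testFun_limit hp hα ha
  obtain ⟨C, hC, hpt⟩ := exists_pointwise hq hα
  refine ⟨φ, hφ, ?_⟩
  set K := ENNReal.ofReal (2 ^ (2 * s + (α + 2))) with hK
  have hup : Tendsto (fun n => K * (C * bergmanNorm q α (g (φ n) - F) +
      ‖F (a (φ n))‖ₑ * ENNReal.ofReal ((1 - a (φ n)) ^ ((α + 2) / q)))) atTop (𝓝 0) := by
    have h1 := ENNReal.Tendsto.const_mul (a := C) hlim (Or.inr hC)
    have h2 := (tendsto_enorm_mul_rpow hq hα hF).comp (halim.comp hφ.tendsto_atTop)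
    have h3 := ENNReal.Tendsto.const_mul (a := K) (h1.add h2) (Or.inr ENNReal.ofReal_ne_top)
    simpa using h3
  refine tendsto_of_tendsto_of_tendsto_of_le_of_le tendsto_const_nhds hup (fun _ => zero_le)
    fun n => ?_
  set b := a (φ n) with hb
  have hbm : b ∈ Ico (0 : ℝ) 1 := ha _
  have h1b : 0 < 1 - b := by linarith [hbm.2]
  have h1 := mul_tail_le_enorm_image hs0 hβ hbm (hgi (φ n))
  have hbd := ofReal_mem_disc hbm.1 hbm.2
  have h2 := hpt (g (φ n) - F) ((hgd (φ n)).sub hF.1) b hbd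
  rw [Complex.norm_real, Real.norm_of_nonneg hbm.1] at h2
  -- The first term is controlled by norm convergence and point evaluation, the second by the slow
  -- radial growth of the fixed function `F`.
  have h3 : ‖g (φ n) b‖ₑ ≤ ‖(g (φ n) - F) b‖ₑ + ‖F b‖ₑ := by
    have := enorm_add_le (g (φ n) b - F b) (F b)
    rwa [sub_add_cancel] at this
  have e : (ENNReal.ofReal ((1 - b) ^ (s + (α + 2) * (1 - 1 / q))))⁻¹ =
      K * ENNReal.ofReal (2 ^ (-(2 * s + (α + 2))) * (1 - b) ^ (-(s + (α + 2)))) *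
        ENNReal.ofReal ((1 - b) ^ ((α + 2) / q)) := by
    rw [← ofReal_rpow_neg h1b, hK, ← ENNReal.ofReal_mul (by positivity),
      ← ENNReal.ofReal_mul (by positivity), ← mul_assoc, ← Real.rpow_add two_pos, add_neg_cancel,
      Real.rpow_zero, one_mul, ← Real.rpow_add h1b]
    congr 2
    ring
  calc tail μ b / ENNReal.ofReal ((1 - b) ^ (s + (α + 2) * (1 - 1 / q)))
      = K * (ENNReal.ofReal (2 ^ (-(2 * s + (α + 2))) * (1 - b) ^ (-(s + (α + 2)))) * tail μ b) *
        ENNReal.ofReal ((1 - b) ^ ((α + 2) / q)) := by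
        rw [div_eq_mul_inv, e]
        ac_rfl
    _ ≤ K * (‖(g (φ n) - F) b‖ₑ + ‖F b‖ₑ) * ENNReal.ofReal ((1 - b) ^ ((α + 2) / q)) :=
        mul_le_mul_left (mul_le_mul_right (h1.trans h3) _) _
    _ = K * (‖(g (φ n) - F) b‖ₑ * ENNReal.ofReal ((1 - b) ^ ((α + 2) / q)) +
          ‖F b‖ₑ * ENNReal.ofReal ((1 - b) ^ ((α + 2) / q))) := by
        rw [mul_assoc, add_mul]
    _ ≤ _ := mul_le_mul_right (add_le_add_left h2 _) _

/-- Hardy's weights turn the coefficients of the kernel into a harmonic series, the source of the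
logarithm in the necessity part. -/
theorem binomCoeff_mul_beta {β : ℝ} (hβ : 0 < β) (m : ℕ) :
    binomCoeff β m * ProbabilityTheory.beta (m + 1) β = 1 / (m + β) := by
  have h1 : 0 < (m : ℝ) + β := by positivity
  have h2 := Real.Gamma_pos_of_pos hβ
  have h3 := Real.Gamma_pos_of_pos h1
  have h4 : (m.factorial : ℝ) ≠ 0 := by exact_mod_cast m.factorial_ne_zero
  rw [binomCoeff, ProbabilityTheory.beta, Real.Gamma_nat_eq_factorial,
    show (m : ℝ) + 1 + β = m + β + 1 by ring, Real.Gamma_add_one h1.ne']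
  field_simp

/-- In the series of the logarithm each of the first `N` terms is at most one, so discarding them
costs at most `N`. -/
theorem ofReal_log_le_add_tsum {a : ℝ} (ha : a ∈ Ico (0 : ℝ) 1) (N : ℕ) :
    ENNReal.ofReal (Real.log (1 / (1 - a))) ≤
      N + ∑' m : ℕ, ENNReal.ofReal (a ^ (m + N) / ((m + N : ℕ) + 1)) := by
  have h1 := Real.hasSum_pow_div_log_of_abs_lt_one (x := a) (by rw [abs_of_nonneg ha.1]; exact ha.2)
  have ha0 := ha.1
  rw [one_div, Real.log_inv, ← h1.tsum_eq,
    ENNReal.ofReal_tsum_of_nonneg (fun n => by positivity) h1.summable]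
  have h2 : ∑' m : ℕ, ENNReal.ofReal (a ^ (m + 1) / ((m : ℝ) + 1)) ≤
      ∑' m : ℕ, ENNReal.ofReal (a ^ m / ((m : ℝ) + 1)) := by
    refine ENNReal.tsum_le_tsum fun m => ENNReal.ofReal_le_ofReal ?_
    gcongr ?_ / _
    exact pow_le_pow_of_le_one ha0 ha.2.le (Nat.le_succ m)
  refine h2.trans ?_
  rw [← Summable.sum_add_tsum_nat_add' (k := N) ENNReal.summable]
  refine add_le_add_left ?_ _
  calc ∑ m ∈ Finset.range N, ENNReal.ofReal (a ^ m / ((m : ℝ) + 1))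
      ≤ ∑ m ∈ Finset.range N, 1 := Finset.sum_le_sum fun m _ => by
        rw [ENNReal.ofReal_le_one, div_le_one (by positivity)]
        exact (pow_le_one₀ ha0 ha.2.le).trans (by linarith [(Nat.cast_nonneg m : (0 : ℝ) ≤ m)])
    _ = N := by simp

theorem mul_tail_le_enorm_taylorCoeff {μ : Measure (Ico (0 : ℝ) 1)} [IsFiniteMeasure μ] {s β a : ℝ}
    (hs : 0 < s) (hβ : 0 < β) (ha : a ∈ Ico (0 : ℝ) 1) {g : ℂ → ℂ}
    (hg : IsHilbertImage μ β (testFun s a) g) (m : ℕ) :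
    ENNReal.ofReal (2 ^ (-(2 * s))) * (tail μ a / ENNReal.ofReal ((1 - a) ^ s)) *
        (ENNReal.ofReal (1 / (β + 1)) * ENNReal.ofReal (a ^ m / ((m : ℕ) + 1))) ≤
      ‖taylorCoeff g m‖ₑ * ENNReal.ofReal (ProbabilityTheory.beta (m + 1) β) := by
  have h1a : 0 < 1 - a := by linarith [ha.2]
  have ha0 := ha.1
  obtain ⟨c, hc, hcle⟩ := exists_hilbertCoeff_testFun (μ := μ) hs hβ ha
  have h1 := (isDominated_testFun hs ha).hasSum_of_isHilbertImage hβ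
    (differentiableOn_testFun hs ha) hg
  have hbeta : 0 < ProbabilityTheory.beta (m + 1) β :=
    ProbabilityTheory.beta_pos (by positivity) hβ
  have hb := binomCoeff_pos hβ m
  have hr := Real.rpow_pos_of_pos h1a (-s)
  rw [taylorCoeff_of_hasSum h1, hc, div_eq_mul_inv, ← ofReal_rpow_neg h1a, ← ofReal_norm,
    ← ENNReal.ofReal_toReal (tail_ne_top μ a),
    ← ENNReal.ofReal_mul (by positivity), ← ENNReal.ofReal_mul (by positivity),
    ← ENNReal.ofReal_mul (by positivity), ← ENNReal.ofReal_mul (by positivity),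
    ← ENNReal.ofReal_mul (by positivity), Complex.norm_real]
  refine ENNReal.ofReal_le_ofReal (le_trans ?_ (mul_le_mul_of_nonneg_right
    ((hcle m).trans (Real.le_norm_self _)) hbeta.le))
  have h2 : 1 / (β + 1) * (1 / ((m : ℝ) + 1)) ≤
      binomCoeff β m * ProbabilityTheory.beta (m + 1) β := by
    rw [binomCoeff_mul_beta hβ, one_div_mul_one_div]
    refine one_div_le_one_div_of_le (by positivity) ?_
    nlinarith [mul_nonneg hβ.le (Nat.cast_nonneg m : (0 : ℝ) ≤ m)]
  have hK : 0 ≤ 2 ^ (-(2 * s)) * (1 - a) ^ (-s) * (tail μ a).toReal * a ^ m := by positivity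
  have h3 := mul_le_mul_of_nonneg_left h2 hK
  calc _ = 2 ^ (-(2 * s)) * (1 - a) ^ (-s) * (tail μ a).toReal * a ^ m *
        (1 / (β + 1) * (1 / ((m : ℝ) + 1))) := by ring
    _ ≤ _ := h3
    _ = _ := by ring

theorem IsCompactHilbert.isVanishingLogCarleson {μ : Measure (Ico (0 : ℝ) 1)} [IsFiniteMeasure μ]
    {p α : ℝ} (hp : 0 < p) (hα : -1 < α) (h : IsCompactHilbert μ (α + 2) p α 1 α) :
    IsVanishingLogCarleson μ 1 ((α + 2) / p) := by
  have hβ : 0 < α + 2 := by linarith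
  set s := (α + 2) / p with hs
  have hs0 : 0 < s := div_pos hβ hp
  refine tendsto_zero_of_forall_seq fun a ha halim => ?_
  obtain ⟨g, F, hF, φ, hφ, hgd, hgi, hlim⟩ := h.exists_testFun_limit hp hα ha
  refine ⟨φ, hφ, ?_⟩
  set w : ℕ → ℝ≥0∞ := fun m => ENNReal.ofReal (ProbabilityTheory.beta (m + 1) (α + 2)) with hw
  have hHardy : ∀ f : ℂ → ℂ, DifferentiableOn ℂ f disc →
      ∑' m, ‖taylorCoeff f m‖ₑ * w m ≤ 4 * (normalizer α)⁻¹ * bergmanNorm 1 α f := fun f hf => by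
    refine (tsum_taylorCoeff_beta_le hα hf).trans_eq ?_
    have := lintegral_eq_bergmanNorm one_pos hα f
    simp only [ENNReal.rpow_one] at this
    rw [this, mul_assoc]
  set C := 4 * (normalizer α)⁻¹ with hC
  have hCfin : C ≠ ∞ :=
    ENNReal.mul_ne_top ENNReal.ofNat_ne_top (ENNReal.inv_ne_top.2 (normalizer_ne_zero hα))
  have hFsum : ∑' m, ‖taylorCoeff F m‖ₑ * w m ≠ ∞ :=
    ne_top_of_le_ne_top (ENNReal.mul_ne_top hCfin hF.2.ne) (hHardy F hF.1)
  have hR := ENNReal.tendsto_sum_nat_add (fun m => ‖taylorCoeff F m‖ₑ * w m) hFsum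
  set c₁ := ENNReal.ofReal (2 ^ (-(2 * s))) with hc₁
  set c₂ := ENNReal.ofReal (1 / (α + 2 + 1)) with hc₂
  have hc₁0 : c₁ ≠ 0 := (ENNReal.ofReal_pos.2 (by positivity)).ne'
  have hc₂0 : c₂ ≠ 0 := (ENNReal.ofReal_pos.2 (by positivity)).ne'
  set D := 2 * (c₁ * c₂)⁻¹ with hD
  have hcc : c₁ * c₂ ≠ 0 := mul_ne_zero hc₁0 hc₂0
  have hcc' : c₁ * c₂ ≠ ∞ := ENNReal.mul_ne_top ENNReal.ofReal_ne_top ENNReal.ofReal_ne_top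
  have hDfin : D ≠ ∞ := ENNReal.mul_ne_top ENNReal.ofNat_ne_top (ENNReal.inv_ne_top.2 hcc)
  set L : ℝ → ℝ≥0∞ := fun x => ENNReal.ofReal (Real.log (1 / (1 - x))) with hL
  -- Only coefficients of index at least `N` are used, so that `F` contributes just a tail of its
  -- Hardy sum. Once `L ≥ 2 N`, the remaining harmonic-type sum is still at least `L / 2`.
  have hbound : ∀ N n : ℕ, (2 * N : ℝ≥0∞) ≤ L (a (φ n)) →
      tail μ (a (φ n)) * L (a (φ n)) / ENNReal.ofReal ((1 - a (φ n)) ^ s) ≤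
        D * (C * bergmanNorm 1 α (g (φ n) - F)) +
          D * ∑' m, ‖taylorCoeff F (m + N)‖ₑ * w (m + N) := by
    intro N n hN
    set b := a (φ n) with hb
    have hbm : b ∈ Ico (0 : ℝ) 1 := ha _
    set T := ∑' m : ℕ, ENNReal.ofReal (b ^ (m + N) / ((m + N : ℕ) + 1)) with hT
    have h1 : L b ≤ 2 * T := by
      have h2 := ofReal_log_le_add_tsum hbm N
      have h3 : L b + L b ≤ L b + 2 * T := by
        calc L b + L b ≤ (N + T) + (N + T) := add_le_add h2 h2
          _ = 2 * N + 2 * T := by ring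
          _ ≤ _ := add_le_add_left hN _
      exact (ENNReal.add_le_add_iff_left ENNReal.ofReal_ne_top).1 h3
    set Q := tail μ b / ENNReal.ofReal ((1 - b) ^ s) with hQ
    have h4 : c₁ * Q * (c₂ * T) ≤ C * bergmanNorm 1 α (g (φ n) - F) +
        ∑' m, ‖taylorCoeff F (m + N)‖ₑ * w (m + N) := by
      rw [hT, ← ENNReal.tsum_mul_left, ← ENNReal.tsum_mul_left]
      calc _ ≤ ∑' m, (‖taylorCoeff (g (φ n) - F) (m + N)‖ₑ * w (m + N) +
            ‖taylorCoeff F (m + N)‖ₑ * w (m + N)) := by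
            refine ENNReal.tsum_le_tsum fun m => ?_
            refine (mul_tail_le_enorm_taylorCoeff hs0 hβ hbm (hgi (φ n)) (m + N)).trans ?_
            rw [← add_mul]
            refine mul_le_mul_left ?_ _
            rw [taylorCoeff_sub (hgd (φ n)) hF.1]
            have := enorm_add_le (taylorCoeff (g (φ n)) (m + N) - taylorCoeff F (m + N))
              (taylorCoeff F (m + N))
            rwa [sub_add_cancel] at this
        _ ≤ _ := by
            rw [ENNReal.tsum_add]
            refine add_le_add_left (le_trans ?_ (hHardy _ ((hgd (φ n)).sub hF.1))) _
            exact ENNReal.tsum_comp_le_tsum_of_injective (add_left_injective N)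
              fun m => ‖taylorCoeff (g (φ n) - F) m‖ₑ * w m
    rw [← mul_add]
    calc tail μ b * L b / ENNReal.ofReal ((1 - b) ^ s) = Q * L b := by
          rw [hQ, div_eq_mul_inv, div_eq_mul_inv]
          ac_rfl
      _ ≤ Q * (2 * T) := mul_le_mul_right h1 _
      _ = 2 * ((c₁ * c₂)⁻¹ * (c₁ * c₂)) * (Q * T) := by
          rw [ENNReal.inv_mul_cancel hcc hcc']
          ring
      _ = D * (c₁ * Q * (c₂ * T)) := by
          rw [hD]
          ring
      _ ≤ _ := mul_le_mul_right h4 _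
  have hLlim : Tendsto (fun n => L (a (φ n))) atTop (𝓝 ∞) := by
    have h1 : Tendsto (fun x : ℝ => Real.log (1 / (1 - x))) (𝓝[<] 1) atTop := by
      refine Real.tendsto_log_atTop.comp ?_
      simp only [one_div]
      refine tendsto_inv_nhdsGT_zero.comp (tendsto_nhdsWithin_iff.2 ⟨?_, ?_⟩)
      · have : Tendsto (fun x : ℝ => 1 - x) (𝓝 1) (𝓝 (1 - 1)) := (continuous_const.sub
          continuous_id).tendsto 1
        rw [sub_self] at this
        exact this.mono_left nhdsWithin_le_nhds
      · filter_upwards [self_mem_nhdsWithin] with x hx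
        exact sub_pos.2 (mem_Iio.1 hx)
    exact ENNReal.tendsto_ofReal_atTop.comp (h1.comp (halim.comp hφ.tendsto_atTop))
  simp only [Real.rpow_one]
  rw [ENNReal.tendsto_nhds_zero]
  intro ε hε
  have hε2 : 0 < ε / 2 := ENNReal.half_pos hε.ne'
  have hR' := ENNReal.Tendsto.const_mul (a := D) hR (Or.inr hDfin)
  rw [mul_zero] at hR'
  -- `N` is fixed first, making the tail of `F` small; only then does `n` grow, so that the norm
  -- term is small and `L ≥ 2 N`.
  obtain ⟨N, hN⟩ := ((ENNReal.tendsto_nhds_zero.1 hR') (ε / 2) hε2).exists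
  have hG := ENNReal.Tendsto.const_mul (a := D)
    (ENNReal.Tendsto.const_mul (a := C) hlim (Or.inr hCfin)) (Or.inr hDfin)
  rw [mul_zero, mul_zero] at hG
  have h2N : (2 * N : ℝ≥0∞) < ∞ := by finiteness
  filter_upwards [(ENNReal.tendsto_nhds_zero.1 hG) (ε / 2) hε2,
    hLlim.eventually (lt_mem_nhds h2N)] with n hn hLn
  refine (hbound N n hLn.le).trans ?_
  rw [← ENNReal.add_halves ε]
  exact add_le_add hn hN

end HilbertBergman

theorem theorem5p01 (p α : ℝ) (hp : 0 < p) (hα : -1 < α)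
    (μ : MeasureTheory.Measure (Set.Ico (0 : ℝ) 1))
    (hμ : HilbertBergman.StandingCondition μ p α) :
    (∀ q q' : ℝ, p ≤ q → 1 < q → 1 / q + 1 / q' = 1 →
      (HilbertBergman.IsCompactHilbert μ (α + 2) p α q α ↔
        HilbertBergman.IsVanishingCarleson μ ((α + 2) / p + (α + 2) / q'))) ∧
    (p ≤ 1 →
      (HilbertBergman.IsCompactHilbert μ (α + 2) p α 1 α ↔
        HilbertBergman.IsVanishingLogCarleson μ 1 ((α + 2) / p))) := by
  have := hμ.isFiniteMeasure
  refine ⟨fun q q' hpq hq hqq' => ?_, fun hp1 => ⟨fun h => h.isVanishingLogCarleson hp hα,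
    fun h => h.isCompactHilbert hp hp1 hα (hμ.le_one hp1)⟩⟩
  have e : (α + 2) / q' = (α + 2) * (1 - 1 / q) := by
    rw [show 1 - 1 / q = 1 / q' by linarith, mul_one_div]
  rw [e]
  exact ⟨fun h => h.isVanishingCarleson hp (by linarith) hα,
    fun h => h.isCompactHilbert hp hpq hq hα⟩
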